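/- All vector spaces are real and all cochain complexes are $\mathbb Z$-graded. A Hilbert structure on a finite-dimensional vector space is an inner product; subspaces carry the substructure, and quotients carry the quotient structure. A finite Hilbert complex is a bounded cochain complex of finite-dimensional Hilbert spaces. **Torsion.** For a linear isomorphism $f$ of finite-dimensional Hilbert spaces put $[[f]]=\frac12\ln|\det(f^*f)|$. For an acyclic finite Hilbert complex $C$ put $\rho(C)=[[c+\gamma:C^{ev}\to C^{odd}]]$, where $c$ is the differential and $\gamma$ any chain contraction. For a chain homotopy equivalence $f:C\to D$ of finite Hilbert complexes put $t(f)=\rho(\operatorname{cone}f)$, where $\operatorname{cone}(f)^n=C^n\oplus D^{n-1}$ has differential $(x,y)\mapsto(cx,fx-dy)$. For a finite Hilbert complex $C$ with Hilbert structures on $H^n(C)$ put $\rho(C)=-t(i)$, where $i:H(C)\to C$ is a chain map with $H(i)=\mathrm{id}$ (and $H(C)$ has zero differential). **Simple structures.** A simple structure on a cochain complex $C$ is a class of chain homotopy equivalences $u:\overline C\to C$ from finite Hilbert complexes, where $u\sim v$ if $t(v^{-1}\circ u)=0$. If moreover $H(C)$ has a Hilbert structure, put $\rho(C)=\rho(\overline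 C)$ for any representative $u$, with the structure on $H(\overline C)$ making $H(u)$ an isometry. For a short exact sequence $C\to D\to E$ of finite Hilbert complexes put $\rho(C\to D\to E)=\sum_n(-1)^n\rho(C^n\to D^n\to E^n)$, where $C^n\to D^n\to E^n$ is an acyclic complex in degrees $0,1,2$. For complexes with simple structures, $\rho(C\to D\to E)=\rho(\overline C\to\overline D\to\overline E)$ for any short exact sequence of finite Hilbert complexes that maps to $C\to D\to E$ (strictly commuting) by representatives of the simple structures. **Data.** Let $C=F_0\supset F_1\supset F_2\supset\dots$ be a filtration of a cochain complex by subcomplexes with $F_l=0$, and put $F_p=C$ for $p<0$. Fix simple structures on $F_p/F_{p+1}$ ($0\le p<l$), Hilbert structures on all $H^n(C)$, and Hilbert structures on all (finite-dimensional) $H^n(F_p/F_{p+1})$; the latter may be arbitrary. By descending induction on $p$, starting from the trivial simple structure (represented by $0\to 0$) on $F_l=0$, equip $F_p$ with the simple structure for which $\rho(F_{p+1}\to F_p\to F_p/F_{p+1})=0$. **Spectral sequence.** For $r\ge1$ let $Z_r^{p,q}=\operatorname{im}(H^{p+q}(F_p/F_{p+r})\to H^{p+q}(F_p/F_{p+1}))$,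 $B_r^{p,q}=\operatorname{im}(\partial:H^{p+q-1}(F_{p-r+1}/F_p)\to H^{p+q}(F_p/F_{p+1}))$, $Z_\infty^{p,q}=\operatorname{im}(H^{p+q}(F_p)\to H^{p+q}(F_p/F_{p+1}))$, $B_\infty^{p,q}=\operatorname{im}(\partial:H^{p+q-1}(C/F_p)\to H^{p+q}(F_p/F_{p+1}))$, $E_r=Z_r/B_r$, $E_\infty=Z_\infty/B_\infty$ and $F^{p,q}=\operatorname{im}(H^{p+q}(F_p)\to H^{p+q}(C))$. The differential $d_r^{p,q}:E_r^{p,q}\to E_r^{p+r,q-r+1}$ sends the class of the image of $x\in H^{p+q}(F_p/F_{p+r})$ to the class of $\partial x$, and $\psi^{p,q}:F^{p,q}/F^{p+1,q-1}\to E_\infty^{p,q}$ is the isomorphism sending the class of the image of $x\in H^{p+q}(F_p)$ in $H^{p+q}(C)$ to the class of its image in $H^{p+q}(F_p/F_{p+1})$. For fixed $r,p,q$, let $E_r^{p+r*,q-(r-1)*}$ be the finite complex with $E_r^{p+rk,q-(r-1)k}$ in degree $k$ and differential $d_r$. All $E_r$, $E_\infty$, the cohomology of these complexes, $F^{p,q}$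 and $F^{p,q}/F^{p+1,q-1}$ carry the Hilbert sub- and quotient structures coming from $H^n(F_p/F_{p+1})$ and $H^n(C)$. Define $$\rho_{fil}(F_*C)=\sum_{p=0}^{l-1}\rho(F_p/F_{p+1})+\sum_{r\ge1}\sum_{p=0}^{r-1}\sum_q(-1)^{p+q}\rho(E_r^{p+r*,q-(r-1)*})-\sum_{p,q}(-1)^{p+q}[[\psi^{p,q}]].$$ **Theorem.** The inductive construction determines exactly one simple structure on $C=F_0$, only finitely many terms of the sums above are non-zero, and, for this simple structure on $C$ and the given Hilbert structure on $H(C)$, $$\rho(C)=\rho_{fil}(F_*C).$$ -/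

import Mathlib

open CategoryTheory

universe u

namespace FilteredTorsion

/-- A Hilbert structure on a real vector space: the space is finite-dimensional and carries
a (positive definite, symmetric) inner product. -/
structure HilbertStructure (V : Type*) [AddCommGroup V] [Module ℝ V] where
  core : InnerProductSpace.Core ℝ V
  finite : Module.Finite ℝ V

namespace HilbertStructure

variable {V W : Type*} [AddCommGroup V] [Module ℝ V] [AddCommGroup W] [Module ℝ W]

/-- The inner product of a Hilbert structure. -/
def ip (h : HilbertStructure V) (x y : V) : ℝ := h.core.inner x y

theorem ip_symm (h : HilbertStructure V) (x y : V) : h.ip y x = h.ip x y :=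
  h.core.conj_inner_symm x y

theorem ip_nonneg (h : HilbertStructure V) (x : V) : 0 ≤ h.ip x x := h.core.re_inner_nonneg x

theorem ip_add (h : HilbertStructure V) (x y z : V) : h.ip (x + y) z = h.ip x z + h.ip y z :=
  h.core.add_left x y z

theorem ip_smul (h : HilbertStructure V) (r : ℝ) (x y : V) : h.ip (r • x) y = r * h.ip x y :=
  h.core.smul_left x y r

theorem ip_definite (h : HilbertStructure V) (x : V) (hx : h.ip x x = 0) : x = 0 :=
  h.core.definite x hx

/-- A Hilbert structure from a positive definite symmetric bilinear form. -/
def mk' (hV : Module.Finite ℝ V) (b : V → V → ℝ) (symm : ∀ x y, b y x = b x y)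
    (nonneg : ∀ x, 0 ≤ b x x) (add : ∀ x y z, b (x + y) z = b x z + b y z)
    (smul : ∀ (r : ℝ) x y, b (r • x) y = r * b x y) (definite : ∀ x, b x x = 0 → x = 0) :
    HilbertStructure V where
  core :=
    { inner := b
      conj_inner_symm := symm
      re_inner_nonneg := nonneg
      add_left := add
      smul_left := fun x y r => smul r x y
      definite := definite }
  finite := hV

/-- The structure transported along an injective linear map into a Hilbert space;
for the inclusion of a subspace this is the Hilbert substructure. -/
def comap (h : HilbertStructure W) (f : V →ₗ[ℝ] W) (hf : Function.Injective f) :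
    HilbertStructure V :=
  mk' (haveI := h.finite; Module.Finite.of_injective f hf) (fun x y => h.ip (f x) (f y))
    (fun _ _ => h.ip_symm _ _) (fun _ => h.ip_nonneg _)
    (fun _ _ _ => by rw [map_add, h.ip_add]) (fun _ _ _ => by rw [map_smul, h.ip_smul])
    (fun _ hx => hf (by rw [map_zero]; exact h.ip_definite _ hx))

/-- A surjective linear map out of a Hilbert space has a linear section whose image is
orthogonal to the kernel. -/
theorem exists_orthogonal_section (h : HilbertStructure V) (f : V →ₗ[ℝ] W)
    (hf : Function.Surjective f) :
    ∃ s : W →ₗ[ℝ] V, (∀ w, f (s w) = w) ∧ ∀ w k, f k = 0 → h.ip (s w) k = 0 := by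
  let : NormedAddCommGroup V := h.core.toNormedAddCommGroup
  let : InnerProductSpace ℝ V := InnerProductSpace.ofCore h.core.toCore
  have : FiniteDimensional ℝ V := h.finite
  obtain ⟨t, ht⟩ := LinearMap.exists_rightInverse_of_surjective f (LinearMap.range_eq_top.2 hf)
  have ht' : ∀ w, f (t w) = w := fun w => LinearMap.congr_fun ht w
  let K : Submodule ℝ V := LinearMap.ker f
  refine ⟨((Kᗮ).starProjection : V →L[ℝ] V).toLinearMap ∘ₗ t, fun w => ?_, fun w k hk => ?_⟩
  · have h1 := K.starProjection_add_starProjection_orthogonal (t w)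
    have h2 : f (K.starProjection (t w)) = 0 := (K.starProjection_apply_mem (t w))
    have h3 := congrArg f h1
    rw [map_add, h2, zero_add, ht'] at h3
    exact h3
  · have h1 : (Kᗮ).starProjection (t w) ∈ Kᗮ := (Kᗮ).starProjection_apply_mem (t w)
    exact (Submodule.mem_orthogonal' K _).1 h1 k hk

/-- The Hilbert quotient structure along a surjective linear map `f : V → W`: the structure
for which `f` restricts to an isometry from the orthogonal complement of `ker f` onto `W`. -/
noncomputable def map (h : HilbertStructure V) (f : V →ₗ[ℝ] W) (hf : Function.Surjective f) :
    HilbertStructure W :=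
  h.comap (h.exists_orthogonal_section f hf).choose
    (Function.LeftInverse.injective (h.exists_orthogonal_section f hf).choose_spec.1)

/-- The orthogonal sum of two Hilbert spaces. -/
def prod (h : HilbertStructure V) (k : HilbertStructure W) : HilbertStructure (V × W) :=
  mk' (haveI := h.finite; haveI := k.finite; Module.Finite.prod)
    (fun x y => h.ip x.1 y.1 + k.ip x.2 y.2)
    (fun x y => by rw [h.ip_symm, k.ip_symm])
    (fun x => add_nonneg (h.ip_nonneg _) (k.ip_nonneg _))
    (fun x y z => by rw [Prod.fst_add, Prod.snd_add, h.ip_add, k.ip_add]; ring)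
    (fun r x y => by rw [Prod.smul_fst, Prod.smul_snd, h.ip_smul, k.ip_smul]; ring)
    (fun x hx => by
      have h1 := h.ip_nonneg x.1
      have h2 := k.ip_nonneg x.2
      exact Prod.ext (h.ip_definite _ (by linarith)) (k.ip_definite _ (by linarith)))

theorem ip_of_subsingleton (h : HilbertStructure V) [Subsingleton V] (x y : V) :
    h.ip x y = 0 := by
  have h1 := h.ip_smul 0 x y
  rwa [Subsingleton.elim ((0 : ℝ) • x) x, zero_mul] at h1

/-- The orthogonal sum of a family of Hilbert spaces almost all of which are zero. For such a
family the product of the underlying spaces is their direct sum. -/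
noncomputable def pi {ι : Type*} {E : ι → Type*} [∀ i, AddCommGroup (E i)]
    [∀ i, Module ℝ (E i)] (h : ∀ i, HilbertStructure (E i))
    (hfin : {i | ¬ Subsingleton (E i)}.Finite) : HilbertStructure (∀ i, E i) :=
  have hs : ∀ x y : ∀ i, E i, (Function.support fun i => (h i).ip (x i) (y i)).Finite :=
    fun x y => hfin.subset fun i hi hE => hi ((h i).ip_of_subsingleton (x i) (y i))
  mk'
    (by
      have := fun i => (h i).finite
      have : Finite {i | ¬ Subsingleton (E i)} := hfin
      refine Module.Finite.of_injective
        (LinearMap.pi fun i : {i | ¬ Subsingleton (E i)} => LinearMap.proj (R := ℝ) (φ := E) i.1)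
        fun x y hxy => funext fun i => ?_
      by_cases hi : Subsingleton (E i)
      · exact Subsingleton.elim _ _
      · exact congrFun hxy ⟨i, hi⟩)
    (fun x y => ∑ᶠ i, (h i).ip (x i) (y i))
    (fun x y => finsum_congr fun i => (h i).ip_symm (x i) (y i))
    (fun x => finsum_nonneg fun i => (h i).ip_nonneg (x i))
    (fun x y z => by
      rw [← finsum_add_distrib (hs x z) (hs y z)]
      exact finsum_congr fun i => (h i).ip_add (x i) (y i) (z i))
    (fun r x y => by
      rw [← smul_eq_mul, smul_finsum]
      exact finsum_congr fun i => (h i).ip_smul r (x i) (y i))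
    (fun x hx => funext fun i => (h i).ip_definite _ <| by
      have h1 := single_le_finsum i (hs x x) (fun j => (h j).ip_nonneg (x j))
      exact le_antisymm (h1.trans hx.le) ((h i).ip_nonneg _))

end HilbertStructure

/-- The number `[[f]] = (1/2) ln |det (f* f)|` of a linear map between Hilbert spaces. -/
noncomputable def bracket {V W : Type*} [AddCommGroup V] [Module ℝ V] [AddCommGroup W]
    [Module ℝ W] (h : HilbertStructure V) (k : HilbertStructure W) (f : V →ₗ[ℝ] W) : ℝ :=
  letI : NormedAddCommGroup V := h.core.toNormedAddCommGroup
  letI : InnerProductSpace ℝ V := InnerProductSpace.ofCore h.core.toCore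
  letI : NormedAddCommGroup W := k.core.toNormedAddCommGroup
  letI : InnerProductSpace ℝ W := InnerProductSpace.ofCore k.core.toCore
  haveI : FiniteDimensional ℝ V := h.finite
  haveI : FiniteDimensional ℝ W := k.finite
  let f' : V →ₗ[ℝ] W := f
  1 / 2 * Real.log |LinearMap.det (LinearMap.adjoint f' ∘ₗ f')|

theorem exists_section {V W : Type*} [AddCommGroup V] [Module ℝ V] [AddCommGroup W]
    [Module ℝ W] (f : V →ₗ[ℝ] W) (hf : Function.Surjective f) :
    ∃ s : W →ₗ[ℝ] V, f ∘ₗ s = LinearMap.id :=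
  LinearMap.exists_rightInverse_of_surjective f (LinearMap.range_eq_top.2 hf)

/-- Cochain complexes of real vector spaces, graded by the integers. -/
abbrev RealComplex := CochainComplex (ModuleCat.{u} ℝ) ℤ

/-- A finite Hilbert cochain complex: a cochain complex of finite-dimensional Hilbert spaces
which vanishes in all degrees of large absolute value. -/
structure HilbertComplex where
  cx : RealComplex.{u}
  hilbert : ∀ n, HilbertStructure (cx.X n)
  bounded : ∃ N : ℕ, ∀ n : ℤ, (N : ℤ) ≤ |n| → Subsingleton (cx.X n)

namespace HilbertComplex

variable (C D : HilbertComplex.{u})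

theorem finite_nonzero {P : ℤ → Prop} :
    {n : {n : ℤ // P n} | ¬ Subsingleton (C.cx.X n.1)}.Finite := by
  obtain ⟨N, hN⟩ := C.bounded
  refine Set.Finite.preimage (f := Subtype.val) Subtype.val_injective.injOn
    (s := {n : ℤ | ¬ Subsingleton (C.cx.X n)})
    ((Set.finite_Icc (-(N : ℤ)) N).subset fun n hn => ?_)
  have h1 : ¬ (N : ℤ) ≤ |n| := fun h => hn (hN n h)
  exact abs_le.1 (by omega)

/-- `C^ev`, the sum of all even-degree terms (an orthogonal direct sum, as the complex is
bounded). -/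
abbrev EvenPart : Type u := ∀ n : {n : ℤ // Even n}, C.cx.X n.1

/-- `C^odd`, the sum of all odd-degree terms. -/
abbrev OddPart : Type u := ∀ n : {n : ℤ // Odd n}, C.cx.X n.1

noncomputable def evenHilbert : HilbertStructure C.EvenPart :=
  HilbertStructure.pi (fun n => C.hilbert n.1) C.finite_nonzero

noncomputable def oddHilbert : HilbertStructure C.OddPart :=
  HilbertStructure.pi (fun n => C.hilbert n.1) C.finite_nonzero

/-- The map `c + γ : C^ev → C^odd`, where `c` is the differential and `γ` a chain contraction,
i.e. a homotopy from the identity to zero. -/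
noncomputable def evenToOdd (γ : Homotopy (𝟙 C.cx) 0) : C.EvenPart →ₗ[ℝ] C.OddPart :=
  LinearMap.pi fun m =>
    let x (n : {n : ℤ // Even n}) : C.EvenPart →ₗ[ℝ] C.cx.X n.1 := LinearMap.proj n
    (C.cx.d (m.1 - 1) m.1).hom ∘ₗ x ⟨m.1 - 1, m.2.sub_odd odd_one⟩ +
      (γ.hom (m.1 + 1) m.1).hom ∘ₗ x ⟨m.1 + 1, m.2.add_odd odd_one⟩

open Classical in
/-- The torsion `[[c + γ : C^ev → C^odd]]` of an acyclic (that is, contractible) finite Hilbert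
complex. It does not depend on the chain contraction `γ`. -/
noncomputable def acyclicTorsion : ℝ :=
  if h : Nonempty (Homotopy (𝟙 C.cx) 0) then
    bracket C.evenHilbert C.oddHilbert (C.evenToOdd h.some)
  else 0

variable {C D}

/-- The component `Cⁿ → Dᵏ` of a chain map, for `k = n`. -/
noncomputable def component (f : C.cx ⟶ D.cx) (n k : ℤ) (h : n = k) : C.cx.X n ⟶ D.cx.X k :=
  f.f n ≫ (D.cx.XIsoOfEq h).hom

theorem component_comm (f : C.cx ⟶ D.cx) (n k n' k' : ℤ) (h : n = k) (h' : n' = k')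
    (x : C.cx.X n) :
    component f n' k' h' (C.cx.d n n' x) = D.cx.d k k' (component f n k h x) := by
  subst h h'
  have := congrArg (fun g => g.hom x) (f.comm n n')
  simp only [component, HomologicalComplex.XIsoOfEq, eqToIso_refl, Iso.refl_hom, Category.comp_id]
  exact this.symm

open Classical in
/-- The mapping cone with `cone(f)ⁿ = Cⁿ ⊕ Dⁿ⁻¹` and differential
`(x, y) ↦ (c x, f x - d y)`. -/
noncomputable def coneCx (f : C.cx ⟶ D.cx) : RealComplex.{u} where
  X n := ModuleCat.of ℝ (C.cx.X n × D.cx.X (n - 1))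
  d n m := if h : n + 1 = m then ModuleCat.ofHom
      (LinearMap.prod ((C.cx.d n m).hom ∘ₗ LinearMap.fst ℝ _ _)
        ((component f n (m - 1) (by omega)).hom ∘ₗ LinearMap.fst ℝ _ _ -
          (D.cx.d (n - 1) (m - 1)).hom ∘ₗ LinearMap.snd ℝ _ _))
    else 0
  shape n m h := dif_neg h
  d_comp_d' i j k hij hjk := by
    have hij' : i + 1 = j := hij
    have hjk' : j + 1 = k := hjk
    rw [dif_pos hij', dif_pos hjk', ← ModuleCat.ofHom_comp]
    refine ModuleCat.hom_ext (LinearMap.ext fun x => Prod.ext ?_ ?_)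
    · change C.cx.d j k (C.cx.d i j x.1) = 0
      rw [← ModuleCat.comp_apply, C.cx.d_comp_d]; rfl
    · change component f j (k - 1) _ (C.cx.d i j x.1) - D.cx.d (j - 1) (k - 1)
        (component f i (j - 1) _ x.1 - D.cx.d (i - 1) (j - 1) x.2) = 0
      rw [component_comm f i (j - 1) j (k - 1) (by omega) (by omega), map_sub, sub_sub_cancel,
        ← ModuleCat.comp_apply, D.cx.d_comp_d]
      rfl

/-- The cone of a chain map as a finite Hilbert complex, with orthogonal sums. -/
noncomputable def cone (f : C.cx ⟶ D.cx) : HilbertComplex.{u} where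
  cx := coneCx f
  hilbert n := (C.hilbert n).prod (D.hilbert (n - 1))
  bounded := by
    obtain ⟨N, hN⟩ := C.bounded
    obtain ⟨M, hM⟩ := D.bounded
    refine ⟨N + M + 1, fun n hn => ?_⟩
    push_cast at hn
    have h1 := hN n (by omega)
    have h2 := hM (n - 1) (by
      have := abs_sub_abs_le_abs_sub n 1
      rw [abs_one] at this; omega)
    exact inferInstanceAs (Subsingleton (C.cx.X n × D.cx.X (n - 1)))

/-- The torsion `t(f) = ρ(cone f)` of a chain homotopy equivalence. -/
noncomputable def equivTorsion (f : C.cx ⟶ D.cx) : ℝ := (cone f).acyclicTorsion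

variable (C)

/-- The cohomology of a complex as a complex with zero differential, with given Hilbert
structures. -/
noncomputable def cohomology (h : ∀ n, HilbertStructure (C.cx.homology n)) :
    HilbertComplex.{u} where
  cx :=
    { X := fun n => C.cx.homology n
      d := fun _ _ => 0 }
  hilbert := h
  bounded := by
    obtain ⟨N, hN⟩ := C.bounded
    refine ⟨N, fun n hn => ?_⟩
    have := hN n hn
    exact ModuleCat.subsingleton_of_isZero (ShortComplex.isZero_homology_of_isZero_X₂ _
      (ModuleCat.isZero_of_subsingleton (C.cx.X n)))

theorem exists_cycles_section (n : ℤ) :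
    ∃ s : C.cx.homology n ⟶ C.cx.cycles n, s ≫ C.cx.homologyπ n = 𝟙 _ := by
  obtain ⟨t, ht⟩ := exists_section (C.cx.homologyπ n).hom
    ((ModuleCat.epi_iff_surjective _).1 inferInstance)
  exact ⟨ModuleCat.ofHom t, ModuleCat.hom_ext ht⟩

/-- A chain map `i : H(C) → C` inducing the identity on cohomology: it picks in each
cohomology class a representing cocycle, linearly. It is unique up to homotopy. -/
noncomputable def cohomologyInclusion (h : ∀ n, HilbertStructure (C.cx.homology n)) :
    (C.cohomology h).cx ⟶ C.cx where
  f n := (C.exists_cycles_section n).choose ≫ C.cx.iCycles n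
  comm' i j _ := by simp [cohomology]

/-- The torsion `ρ(C) = -t(i : H(C) → C)` of a finite Hilbert complex with respect to given
Hilbert structures on its cohomology. -/
noncomputable def torsion (h : ∀ n, HilbertStructure (C.cx.homology n)) : ℝ :=
  - equivTorsion (C := C.cohomology h) (D := C) (C.cohomologyInclusion h)

/-- The Hilbert structure on cohomology obtained from that of the complex by passing to the
substructure on the cocycles and then to the quotient structure on cohomology. -/
noncomputable def homologyHilbert (n : ℤ) : HilbertStructure (C.cx.homology n) :=
  ((C.hilbert n).comap (C.cx.iCycles n).hom
      ((ModuleCat.mono_iff_injective _).1 inferInstance)).map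
    (C.cx.homologyπ n).hom ((ModuleCat.epi_iff_surjective _).1 inferInstance)

end HilbertComplex

/-- A representative of a simple structure on `C`: a chain homotopy equivalence to `C` from a
finite Hilbert complex. -/
structure SimpleRep (C : RealComplex.{u}) where
  source : HilbertComplex.{u}
  equiv : HomotopyEquiv source.cx C

/-- A simple structure on `C`: a class of representatives, where `u` and `v` are equivalent if
`t(v⁻¹ ∘ u) = 0`. -/
def SimpleStructure (C : RealComplex.{u}) : Type (u + 1) :=
  Quot fun u v : SimpleRep C => HilbertComplex.equivTorsion (u.equiv.hom ≫ v.equiv.inv) = 0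

/-- The torsion `ρ(C)` computed from a representative `u : C̄ → C` of the simple structure and
Hilbert structures on `H(C)`: it is `ρ(C̄)` for the structures on `H(C̄)` making `H(u)` an
isometry. -/
noncomputable def SimpleRep.torsion {C : RealComplex.{u}} (u : SimpleRep C)
    (h : ∀ n, HilbertStructure (C.homology n)) : ℝ :=
  u.source.torsion fun n => (h n).comap (u.equiv.toHomologyIso n).hom.hom
    ((ModuleCat.mono_iff_injective _).1 inferInstance)

namespace SimpleStructure

/-- `u` represents the simple structure `σ`. -/
def IsRepresentedBy {C : RealComplex.{u}} (σ : SimpleStructure C) (u : SimpleRep C) : Prop :=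
  σ = Quot.mk _ u

/-- The torsion `ρ(C)` of a complex with simple structure and Hilbert structures on its
cohomology. It does not depend on the representative that is chosen. -/
noncomputable def torsion {C : RealComplex.{u}} (σ : SimpleStructure C)
    (h : ∀ n, HilbertStructure (C.homology n)) : ℝ :=
  (Quot.out σ).torsion h

/-- The simple structure transported along an isomorphism of complexes. -/
noncomputable def transport {C D : RealComplex.{u}} (e : C ≅ D) (σ : SimpleStructure C) :
    SimpleStructure D :=
  Quot.map (fun u => ⟨u.source, u.equiv.trans (HomotopyEquiv.ofIso e)⟩)
    (fun u v huv => by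
      simpa [HomotopyEquiv.trans, HomotopyEquiv.ofIso] using huv) σ

end SimpleStructure

/-- The torsion `ρ(C → D → E)` of a short exact sequence of finite Hilbert complexes.
In each degree `n` the acyclic complex `Cⁿ → Dⁿ → Eⁿ` sits in degrees `0, 1, 2`; a chain
contraction of it is determined by its component `s : Eⁿ → Dⁿ`, which can be any section of
`Dⁿ → Eⁿ`, and the torsion is `[[a + s : Cⁿ ⊕ Eⁿ → Dⁿ]]`, independently of `s`. -/
noncomputable def sequenceTorsion {C D E : HilbertComplex.{u}} (a : C.cx ⟶ D.cx)
    (b : D.cx ⟶ E.cx) (hb : ∀ n, Function.Surjective (b.f n)) : ℝ :=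
  ∑ᶠ n : ℤ, (-1 : ℝ) ^ n *
    bracket ((C.hilbert n).prod (E.hilbert n)) (D.hilbert n)
      (LinearMap.coprod (a.f n).hom
        (exists_section (b.f n).hom (hb n)).choose)

/-- For a sequence `C → D → E` of complexes with simple structures: `ρ(C → D → E) = r`.
The number is computed from a strictly commutative diagram
whose upper row is a short exact sequence of finite Hilbert complexes and whose
vertical maps are homotopy equivalences representing the simple structures. -/
def HasSequenceTorsion {C D E : RealComplex.{u}} (i : C ⟶ D) (p : D ⟶ E)
    (σ : SimpleStructure C) (τ : SimpleStructure D) (υ : SimpleStructure E) (r : ℝ) : Prop :=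
  ∃ (f : SimpleRep C) (g : SimpleRep D) (h : SimpleRep E)
    (a : f.source.cx ⟶ g.source.cx) (b : g.source.cx ⟶ h.source.cx)
    (_ : ∀ n, Function.Injective (a.f n)) (_ : ∀ n, Function.Exact (a.f n) (b.f n))
    (hb : ∀ n, Function.Surjective (b.f n)),
    σ.IsRepresentedBy f ∧ τ.IsRepresentedBy g ∧ υ.IsRepresentedBy h ∧
    a ≫ g.equiv.hom = f.equiv.hom ≫ i ∧ b ≫ h.equiv.hom = g.equiv.hom ≫ p ∧
    sequenceTorsion a b hb = r

/-- A subcomplex of a cochain complex. -/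
structure Subcomplex (C : RealComplex.{u}) where
  carrier : ∀ n, Submodule ℝ (C.X n)
  d_mem : ∀ n m, ∀ x ∈ carrier n, C.d n m x ∈ carrier m

namespace Subcomplex

variable {C : RealComplex.{u}}

instance : LE (Subcomplex C) := ⟨fun K L => ∀ n, K.carrier n ≤ L.carrier n⟩

instance : Top (Subcomplex C) := ⟨⟨fun _ => ⊤, fun _ _ _ _ => trivial⟩⟩

instance : Bot (Subcomplex C) :=
  ⟨⟨fun _ => ⊥, fun n m x hx => by
    rw [Submodule.mem_bot] at hx ⊢; rw [hx, map_zero]⟩⟩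

theorem le_refl' (K : Subcomplex C) : K ≤ K := fun _ => le_rfl

theorem le_top' (K : Subcomplex C) : K ≤ ⊤ := fun n => (le_top : K.carrier n ≤ ⊤)

/-- The differential restricted to a subcomplex. -/
noncomputable def restrictD (K : Subcomplex C) (n m : ℤ) : K.carrier n →ₗ[ℝ] K.carrier m :=
  (C.d n m).hom.restrict (K.d_mem n m)

/-- A subcomplex as a cochain complex. -/
noncomputable def toCx (K : Subcomplex C) : RealComplex.{u} where
  X n := ModuleCat.of ℝ (K.carrier n)
  d n m := ModuleCat.ofHom (K.restrictD n m)
  shape n m h := ModuleCat.hom_ext <| LinearMap.ext fun x => Subtype.ext <| by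
    change C.d n m x.1 = 0
    rw [C.shape n m h]; rfl
  d_comp_d' i j k _ _ := ModuleCat.hom_ext <| LinearMap.ext fun x => Subtype.ext <| by
    change C.d j k (C.d i j x.1) = 0
    rw [← ModuleCat.comp_apply, C.d_comp_d]; rfl

/-- The inclusion of a subcomplex. -/
noncomputable def ι (K : Subcomplex C) : K.toCx ⟶ C where
  f n := ModuleCat.ofHom (K.carrier n).subtype

/-- The inclusion of a subcomplex into a larger one. -/
noncomputable def inclusion {K L : Subcomplex C} (h : K ≤ L) : K.toCx ⟶ L.toCx where
  f n := ModuleCat.ofHom (Submodule.inclusion (h n))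

/-- The quotient complex `K / L` for subcomplexes `L ≤ K`. -/
noncomputable def quot (K L : Subcomplex C) : RealComplex.{u} where
  X n := ModuleCat.of ℝ (K.carrier n ⧸ (L.carrier n).submoduleOf (K.carrier n))
  d n m := ModuleCat.ofHom (Submodule.mapQ _ _ (K.restrictD n m) fun x hx => L.d_mem n m x.1 hx)
  shape n m h := ModuleCat.hom_ext <| Submodule.linearMap_qext _ <| LinearMap.ext fun x => by
    change Submodule.Quotient.mk (K.restrictD n m x) = 0
    have : K.restrictD n m x = 0 := Subtype.ext <| by
      change C.d n m x.1 = 0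
      rw [C.shape n m h]; rfl
    rw [this]; rfl
  d_comp_d' i j k _ _ := ModuleCat.hom_ext <| Submodule.linearMap_qext _ <|
    LinearMap.ext fun x => by
      change Submodule.Quotient.mk (K.restrictD j k (K.restrictD i j x)) = 0
      have : K.restrictD j k (K.restrictD i j x) = 0 := Subtype.ext <| by
        change C.d j k (C.d i j x.1) = 0
        rw [← ModuleCat.comp_apply, C.d_comp_d]; rfl
      rw [this]; rfl

/-- The projection `K → K / L`. -/
noncomputable def π (K L : Subcomplex C) : K.toCx ⟶ K.quot L where
  f n := ModuleCat.ofHom (Submodule.mkQ _)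

/-- The projection `C → C / K`. -/
noncomputable def πTop (K : Subcomplex C) : C ⟶ (⊤ : Subcomplex C).quot K where
  f n := ModuleCat.ofHom (Submodule.mkQ _ ∘ₗ
    LinearMap.codRestrict (⊤ : Submodule ℝ (C.X n)) LinearMap.id fun _ => trivial)

/-- The map `K / L → K' / L'` induced by the inclusions `K ≤ K'` and `L ≤ L'`. -/
noncomputable def quotMap {K L K' L' : Subcomplex C} (hK : K ≤ K') (hL : L ≤ L') :
    K.quot L ⟶ K'.quot L' where
  f n := ModuleCat.ofHom (Submodule.mapQ _ _ (Submodule.inclusion (hK n)) fun _ hx => hL n hx)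
  comm' _ _ _ := ModuleCat.hom_ext <| Submodule.linearMap_qext _ <| LinearMap.ext fun _ => rfl

theorem quotMap_comp {K L K' L' K'' L'' : Subcomplex C} (hK : K ≤ K') (hL : L ≤ L')
    (hK' : K' ≤ K'') (hL' : L' ≤ L'') (hK'' : K ≤ K'') (hL'' : L ≤ L'') :
    quotMap hK hL ≫ quotMap hK' hL' = quotMap hK'' hL'' := by
  ext n : 1
  exact ModuleCat.hom_ext <| Submodule.linearMap_qext _ <| LinearMap.ext fun _ => rfl

/-- The sequence `L / N → K / N → K / L` for `N ≤ L ≤ K`. -/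
noncomputable def quotSeq {K L N : Subcomplex C} (hL : L ≤ K) (hN : N ≤ L) :
    ShortComplex (RealComplex.{u}) where
  X₁ := L.quot N
  X₂ := K.quot N
  X₃ := K.quot L
  f := quotMap hL N.le_refl'
  g := quotMap K.le_refl' hN
  zero := by
    ext n : 1
    refine ModuleCat.hom_ext <| Submodule.linearMap_qext _ <| LinearMap.ext fun x => ?_
    exact (Submodule.Quotient.mk_eq_zero _).2 x.2

theorem quotSeq_shortExact {K L N : Subcomplex C} (hL : L ≤ K) (hN : N ≤ L) :
    (quotSeq hL hN).ShortExact := by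
  refine HomologicalComplex.shortExact_of_degreewise_shortExact _ fun n => ?_
  refine ModuleCat.shortComplex_shortExact _ (fun y => ⟨fun hy => ?_, ?_⟩) (fun x y hxy => ?_)
    fun y => ?_
  · obtain ⟨x, rfl⟩ := Submodule.Quotient.mk_surjective _ y
    have hx : x.1 ∈ L.carrier n :=
      (Submodule.Quotient.mk_eq_zero ((L.carrier n).submoduleOf (K.carrier n))).1 hy
    exact ⟨Submodule.Quotient.mk ⟨x.1, hx⟩, rfl⟩
  · rintro ⟨x, rfl⟩
    obtain ⟨x, rfl⟩ := Submodule.Quotient.mk_surjective _ x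
    exact (Submodule.Quotient.mk_eq_zero _).2 x.2
  · obtain ⟨x, rfl⟩ := Submodule.Quotient.mk_surjective _ x
    obtain ⟨y, rfl⟩ := Submodule.Quotient.mk_surjective _ y
    refine (Submodule.Quotient.eq _).2 ?_
    exact (Submodule.Quotient.eq ((N.carrier n).submoduleOf (K.carrier n))).1 hxy
  · obtain ⟨x, rfl⟩ := Submodule.Quotient.mk_surjective _ y
    exact ⟨Submodule.Quotient.mk x, rfl⟩

/-- The sequence `K → C → C / K`. -/
noncomputable def subSeq (K : Subcomplex C) : ShortComplex (RealComplex.{u}) where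
  X₁ := K.toCx
  X₂ := C
  X₃ := (⊤ : Subcomplex C).quot K
  f := K.ι
  g := K.πTop
  zero := by
    ext n : 1
    refine ModuleCat.hom_ext <| LinearMap.ext fun x => ?_
    exact (Submodule.Quotient.mk_eq_zero _).2 x.2

theorem subSeq_shortExact (K : Subcomplex C) : K.subSeq.ShortExact := by
  refine HomologicalComplex.shortExact_of_degreewise_shortExact _ fun n => ?_
  refine ModuleCat.shortComplex_shortExact _ (fun y => ⟨fun hy => ?_, ?_⟩) (fun x y hxy => ?_)
    fun y => ?_
  · exact ⟨⟨y, (Submodule.Quotient.mk_eq_zero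
      ((K.carrier n).submoduleOf (⊤ : Submodule ℝ (C.X n)))).1 hy⟩, rfl⟩
  · rintro ⟨x, rfl⟩
    exact (Submodule.Quotient.mk_eq_zero _).2 x.2
  · exact Subtype.ext hxy
  · obtain ⟨x, rfl⟩ := Submodule.Quotient.mk_surjective _ y
    exact ⟨x.1, rfl⟩

/-- The map `Hⁿ(K / L) → Hⁿ(K' / L')` induced by inclusions. -/
noncomputable def hMap {K L K' L' : Subcomplex C} (hK : K ≤ K') (hL : L ≤ L') (n : ℤ) :
    (K.quot L).homology n →ₗ[ℝ] (K'.quot L').homology n :=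
  (HomologicalComplex.homologyMap (quotMap hK hL) n).hom

/-- The boundary operator `∂ : Hⁿ(K / L) → Hⁿ⁺¹(L / N)` of the sequence
`L / N → K / N → K / L`. -/
noncomputable def boundary {K L N : Subcomplex C} (hL : L ≤ K) (hN : N ≤ L) (n n' : ℤ)
    (hn : n + 1 = n') : (K.quot L).homology n →ₗ[ℝ] (L.quot N).homology n' :=
  ((quotSeq_shortExact hL hN).δ n n' hn).hom

theorem hMap_hMap {K L K' L' K'' L'' : Subcomplex C} (hK : K ≤ K') (hL : L ≤ L')
    (hK' : K' ≤ K'') (hL' : L' ≤ L'') (hK'' : K ≤ K'') (hL'' : L ≤ L'') (n : ℤ)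
    (x : (K.quot L).homology n) : hMap hK' hL' n (hMap hK hL n x) = hMap hK'' hL'' n x := by
  rw [hMap, hMap, hMap, ← quotMap_comp hK hL hK' hL' hK'' hL'', HomologicalComplex.homologyMap_comp]
  rfl

theorem boundary_hMap {K L N K' L' N' : Subcomplex C} (hL : L ≤ K) (hN : N ≤ L)
    (hL' : L' ≤ K') (hN' : N' ≤ L') (kK : K ≤ K') (kL : L ≤ L') (kN : N ≤ N') (n n' : ℤ)
    (hn : n + 1 = n') (x : (K.quot L).homology n) :
    boundary hL' hN' n n' hn (hMap kK kL n x) = hMap kL kN n' (boundary hL hN n n' hn x) := by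
  let φ : quotSeq hL hN ⟶ quotSeq hL' hN' :=
    { τ₁ := quotMap kL kN
      τ₂ := quotMap kK kN
      τ₃ := quotMap kK kL
      comm₁₂ := by
        ext n : 1
        exact ModuleCat.hom_ext <| Submodule.linearMap_qext _ <| LinearMap.ext fun _ => rfl
      comm₂₃ := by
        ext n : 1
        exact ModuleCat.hom_ext <| Submodule.linearMap_qext _ <| LinearMap.ext fun _ => rfl }
  have := HomologicalComplex.HomologySequence.δ_naturality φ (quotSeq_shortExact hL hN)
    (quotSeq_shortExact hL' hN') n n' hn
  exact (congrArg (fun g => g.hom x) this).symm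

theorem boundary_hMap_eq_zero {K L N : Subcomplex C} (hL : L ≤ K) (hN : N ≤ L) (n n' : ℤ)
    (hn : n + 1 = n') (x : (K.quot N).homology n) :
    boundary hL hN n n' hn (hMap K.le_refl' hN n x) = 0 :=
  congrArg (fun g => g.hom x) ((quotSeq_shortExact hL hN).comp_δ n n' hn)

theorem exists_of_hMap_eq_zero {K L N : Subcomplex C} (hL : L ≤ K) (hN : N ≤ L) (n : ℤ)
    (x : (K.quot N).homology n) (hx : hMap K.le_refl' hN n x = 0) :
    ∃ y, hMap hL N.le_refl' n y = x :=
  (ShortComplex.moduleCat_exact_iff _).1 ((quotSeq_shortExact hL hN).homology_exact₂ n) x hx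

end Subcomplex

/-- The subquotient `A / B` for subspaces `B ≤ A` of a vector space. -/
abbrev Subquot {V : Type*} [AddCommGroup V] [Module ℝ V] (A B : Submodule ℝ V) : Type _ :=
  A ⧸ B.submoduleOf A

section Subquot

variable {V X Y : Type*} [AddCommGroup V] [Module ℝ V] [AddCommGroup X] [Module ℝ X]
  [AddCommGroup Y] [Module ℝ Y]

/-- A subspace of a Hilbert space with the substructure, and then its quotient with the quotient
structure. -/
noncomputable def HilbertStructure.subquot (h : HilbertStructure V) (A B : Submodule ℝ V) :
    HilbertStructure (Subquot A B) :=
  (h.comap A.subtype A.subtype_injective).map (B.submoduleOf A).mkQ (Submodule.mkQ_surjective _)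

/-- The map `A / B → A' / B'` induced by inclusions `A ≤ A'` and `B ≤ B'`. -/
def subquotMap {A B A' B' : Submodule ℝ V} (hA : A ≤ A') (hB : B ≤ B') :
    Subquot A B →ₗ[ℝ] Subquot A' B' :=
  Submodule.mapQ _ _ (Submodule.inclusion hA) fun _ hx => hB hx

/-- For linear maps `a : V → X`, `b : V → Y` and subspaces `A` of `X` and `B` of `Y`
such that `a v ∈ A` implies `b v ∈ B`, the map `im a / A → im b / B` sending the class of `a v`
to the class of `b v`. -/
noncomputable def imageMap (a : V →ₗ[ℝ] X) (b : V →ₗ[ℝ] Y) (A : Submodule ℝ X)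
    (B : Submodule ℝ Y) (hab : ∀ v, a v ∈ A → b v ∈ B) :
    Subquot (LinearMap.range a) A →ₗ[ℝ] Subquot (LinearMap.range b) B :=
  let a' : V →ₗ[ℝ] Subquot (LinearMap.range a) A := Submodule.mkQ _ ∘ₗ a.rangeRestrict
  let b' : V →ₗ[ℝ] Subquot (LinearMap.range b) B := Submodule.mkQ _ ∘ₗ b.rangeRestrict
  have ha : Function.Surjective a' :=
    (Submodule.mkQ_surjective _).comp a.surjective_rangeRestrict
  (LinearMap.ker a').liftQ b' (fun v hv => by
    have h1 : a v ∈ A := (Submodule.Quotient.mk_eq_zero (A.submoduleOf (LinearMap.range a))).1 hv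
    exact (Submodule.Quotient.mk_eq_zero (B.submoduleOf (LinearMap.range b))).2 (hab v h1)) ∘ₗ
  (a'.quotKerEquivOfSurjective ha).symm.toLinearMap

theorem imageMap_mk (a : V →ₗ[ℝ] X) (b : V →ₗ[ℝ] Y) (A : Submodule ℝ X)
    (B : Submodule ℝ Y) (hab : ∀ v, a v ∈ A → b v ∈ B) (v : V) :
    imageMap a b A B hab (Submodule.Quotient.mk ⟨a v, v, rfl⟩) =
      Submodule.Quotient.mk ⟨b v, v, rfl⟩ := by
  let a' : V →ₗ[ℝ] Subquot (LinearMap.range a) A := Submodule.mkQ _ ∘ₗ a.rangeRestrict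
  have ha : Function.Surjective a' :=
    (Submodule.mkQ_surjective _).comp a.surjective_rangeRestrict
  have h1 : (a'.quotKerEquivOfSurjective ha).symm (Submodule.Quotient.mk ⟨a v, v, rfl⟩) =
      Submodule.Quotient.mk v := by
    rw [LinearEquiv.symm_apply_eq]; rfl
  simp only [imageMap, LinearMap.comp_apply, LinearEquiv.coe_coe]
  erw [h1]
  rfl

end Subquot

/-- A finite descending filtration `C = F₀ ⊇ F₁ ⊇ F₂ ⊇ …` by subcomplexes, extended by
`F_p = C` for negative `p`. -/
structure Filtration (C : RealComplex.{u}) where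
  F : ℤ → Subcomplex C
  anti : ∀ p q, p ≤ q → F q ≤ F p
  eq_top : ∀ p ≤ 0, F p = ⊤
  exists_eq_bot : ∃ l : ℕ, F l = ⊥

namespace Filtration

open Subcomplex

variable {C : RealComplex.{u}} (F : Filtration C)

/-- The filtration quotient `F_p / F_{p+1}`. -/
noncomputable abbrev gr (p : ℤ) : RealComplex.{u} := (F.F p).quot (F.F (p + 1))

/-- The map `Hⁿ(F_p / F_s) → Hⁿ(F_p / F_{p+1})` for `p < s`. -/
noncomputable def zMap (p s n : ℤ) (h : p < s) :
    ((F.F p).quot (F.F s)).homology n →ₗ[ℝ] (F.gr p).homology n :=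
  hMap (F.F p).le_refl' (F.anti _ _ h) n

/-- The boundary operator `∂ : Hⁿ(F_p / F_s) → Hⁿ⁺¹(F_s / F_{s+1})` for `p ≤ s`. -/
noncomputable def bMap (p s n n' : ℤ) (h : p ≤ s) (hn : n + 1 = n') :
    ((F.F p).quot (F.F s)).homology n →ₗ[ℝ] (F.gr s).homology n' :=
  boundary (F.anti _ _ h) (F.anti _ _ (by omega)) n n' hn

/-- The space `Z_r^{p,q}`, where `n = p + q` is the total degree. -/
noncomputable def Z (r : ℕ+) (p n : ℤ) : Submodule ℝ ((F.gr p).homology n) :=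
  LinearMap.range (F.zMap p (p + r) n (by have := r.pos; omega))

/-- The space `B_r^{p,q}`, where `n = p + q`: the image of the boundary operator
`Hⁿ⁻¹(F_{p-r+1} / F_p) → Hⁿ(F_p / F_{p+1})`. -/
noncomputable def B (r : ℕ+) (p n : ℤ) : Submodule ℝ ((F.gr p).homology n) :=
  LinearMap.range (F.bMap (p - r + 1) p (n - 1) n (by have := r.pos; omega) (by omega))

/-- The space `Z_∞^{p,q}`, where `n = p + q`: the image of `Hⁿ(F_p)`. -/
noncomputable def ZInf (p n : ℤ) : Submodule ℝ ((F.gr p).homology n) :=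
  LinearMap.range (HomologicalComplex.homologyMap ((F.F p).π (F.F (p + 1))) n).hom

/-- The space `B_∞^{p,q}`, where `n = p + q`: the image of the boundary operator
`Hⁿ⁻¹(C / F_p) → Hⁿ(F_p / F_{p+1})`. -/
noncomputable def BInf (p n : ℤ) : Submodule ℝ ((F.gr p).homology n) :=
  LinearMap.range (boundary (F.F p).le_top' (F.anti p (p + 1) (by omega)) (n - 1) n (by omega))

/-- The space `F^{p,q}`, where `n = p + q`: the image of `Hⁿ(F_p)` in `Hⁿ(C)`. -/
noncomputable def FH (p n : ℤ) : Submodule ℝ (C.homology n) :=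
  LinearMap.range (HomologicalComplex.homologyMap (F.F p).ι n).hom

/-- The space `E_r^{p,q} = Z_r^{p,q} / B_r^{p,q}`, where `n = p + q`. -/
abbrev E (r : ℕ+) (p n : ℤ) : Type u := Subquot (F.Z r p n) (F.B r p n)

/-- The space `E_∞^{p,q} = Z_∞^{p,q} / B_∞^{p,q}`, where `n = p + q`. -/
abbrev EInf (p n : ℤ) : Type u := Subquot (F.ZInf p n) (F.BInf p n)

theorem range_bMap_le_range_zMap (t p s n n' : ℤ) (h : t ≤ p) (hs : p < s) (hn : n + 1 = n') :
    LinearMap.range (F.bMap t p n n' h hn) ≤ LinearMap.range (F.zMap p s n' hs) := by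
  rintro _ ⟨x, rfl⟩
  have hps : F.F s ≤ F.F p := F.anti _ _ hs.le
  refine ⟨boundary (F.anti _ _ h) hps n n' hn x, ?_⟩
  rw [zMap, ← boundary_hMap (F.anti _ _ h) hps (F.anti _ _ h) (F.anti p (p + 1) (by omega))
    (F.F t).le_refl' (F.F p).le_refl' (F.anti _ _ hs)]
  rw [bMap]
  congr 1
  have : quotMap (F.F t).le_refl' (F.F p).le_refl' = 𝟙 _ := by
    ext k : 1
    exact ModuleCat.hom_ext <| Submodule.linearMap_qext _ <| LinearMap.ext fun _ => rfl
  rw [hMap, this, HomologicalComplex.homologyMap_id]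
  rfl

theorem bMap_mem (p s n n' : ℤ) (h : p < s) (hn : n + 1 = n')
    (x : ((F.F p).quot (F.F s)).homology n)
    (hx : F.zMap p s n h x ∈ LinearMap.range (F.zMap p (s + 1) n (by omega))) :
    F.bMap p s n n' h.le hn x ∈ LinearMap.range (F.bMap (p + 1) s n n' h hn) := by
  obtain ⟨y, hy⟩ := hx
  have hs : F.F (s + 1) ≤ F.F s := F.anti _ _ (by omega)
  have hp : F.F (p + 1) ≤ F.F p := F.anti _ _ (by omega)
  have hsp : F.F s ≤ F.F (p + 1) := F.anti _ _ h
  have h1 : hMap (F.F p).le_refl' hsp n (x - hMap (F.F p).le_refl' hs n y) = 0 := by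
    rw [map_sub, hMap_hMap _ _ _ _ (F.F p).le_refl' (F.anti _ _ (by omega)), sub_eq_zero]
    exact hy.symm
  obtain ⟨w, hw⟩ := exists_of_hMap_eq_zero hp hsp n _ h1
  refine ⟨w, ?_⟩
  have h2 : x = hMap (F.F p).le_refl' hs n y + hMap hp (F.F s).le_refl' n w := by
    rw [hw]; abel
  simp only [bMap]
  rw [h2, map_add, boundary_hMap_eq_zero, zero_add,
    boundary_hMap hsp hs (F.anti _ _ h.le) hs hp (F.F s).le_refl' (F.F (s + 1)).le_refl']
  have : quotMap (F.F s).le_refl' (F.F (s + 1)).le_refl' = 𝟙 _ := by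
    ext k : 1
    exact ModuleCat.hom_ext <| Submodule.linearMap_qext _ <| LinearMap.ext fun _ => rfl
  rw [hMap, this, HomologicalComplex.homologyMap_id]
  rfl

/-- The map `γ_r^{p,q} : Z_r^{p,q} / Z_{r+1}^{p,q} → B_{r+1}^{s,·} / B_r^{s,·}`, where
`s = p + r`, `n = p + q` and `n' = n + 1`: it sends the class of the image of
`x ∈ Hⁿ(F_p / F_s)` to the class of `∂ x`. -/
noncomputable def γ (p s n n' : ℤ) (h : p < s) (hn : n + 1 = n') :
    Subquot (LinearMap.range (F.zMap p s n h)) (LinearMap.range (F.zMap p (s + 1) n (by omega)))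
      →ₗ[ℝ] Subquot (LinearMap.range (F.bMap p s n n' h.le hn))
        (LinearMap.range (F.bMap (p + 1) s n n' h hn)) :=
  imageMap (F.zMap p s n h) (F.bMap p s n n' h.le hn) _ _ (F.bMap_mem p s n n' h hn)

theorem Z_eq (r : ℕ+) (p s n : ℤ) (hs : p + r = s) :
    F.Z r p n = LinearMap.range (F.zMap p s n (by have := r.pos; omega)) := by
  subst hs; rfl

theorem B_eq (r : ℕ+) (t p n n' : ℤ) (ht : t + r = p + 1) (hn : n + 1 = n') :
    F.B r p n' = LinearMap.range (F.bMap t p n n' (by have := r.pos; omega) hn) := by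
  obtain rfl : t = p - r + 1 := by omega
  obtain rfl : n = n' - 1 := by omega
  rfl

/-- The differential `d_r^{p,q} : E_r^{p,q} → E_r^{p+r,q-r+1}`, where `s = p + r`, `n = p + q`
and `n' = n + 1`: the composition
`Z_r / B_r → Z_r / Z_{r+1} → B_{r+1} / B_r → Z_r / B_r` of the projection, `γ_r` and the
inclusion. -/
noncomputable def dE (r : ℕ+) (p s n n' : ℤ) (hs : p + r = s) (hn : n + 1 = n') :
    F.E r p n →ₗ[ℝ] F.E r s n' :=
  have h : p < s := by have := r.pos; omega
  subquotMap (F.range_bMap_le_range_zMap p s (s + r) n n' h.le _ hn)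
      (F.B_eq r (p + 1) s n n' (by omega) hn).ge ∘ₗ
    F.γ p s n n' h hn ∘ₗ
    subquotMap (F.Z_eq r p s n hs).le
      (F.range_bMap_le_range_zMap (p - r + 1) p (s + 1) (n - 1) n _ (by omega) _)

theorem dE_dE (r : ℕ+) (p s t n n' n'' : ℤ) (hs : p + r = s) (ht : s + r = t)
    (hn : n + 1 = n') (hn' : n' + 1 = n'') :
    F.dE r s t n' n'' ht hn' ∘ₗ F.dE r p s n n' hs hn = 0 := by
  have hr := r.pos
  refine LinearMap.ext fun x => ?_
  simp only [dE, LinearMap.comp_apply]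
  generalize F.γ p s n n' _ hn _ = y
  obtain ⟨y, rfl⟩ := Submodule.Quotient.mk_surjective _ y
  have h0 : subquotMap (F.Z_eq r s t n' ht).le
      (F.range_bMap_le_range_zMap (s - r + 1) s (t + 1) (n' - 1) n' (by omega) (by omega)
        (by omega))
      (subquotMap (F.range_bMap_le_range_zMap p s (s + r) n n' (by omega) (by omega) hn)
      (F.B_eq r (p + 1) s n n' (by omega) hn).ge (Submodule.Quotient.mk y)) = 0 :=
    (Submodule.Quotient.mk_eq_zero ((LinearMap.range (F.zMap s (t + 1) n' _)).submoduleOf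
      (LinearMap.range (F.zMap s t n' _)))).2
      (F.range_bMap_le_range_zMap p s (t + 1) n n' (by omega) (by omega) hn y.2)
  exact (congrArg _ (congrArg _ h0)).trans (by rw [map_zero, map_zero]; rfl)

theorem FH_mem (p n : ℤ) (x : (F.F p).toCx.homology n)
    (hx : (HomologicalComplex.homologyMap (F.F p).ι n).hom x ∈ F.FH (p + 1) n) :
    (HomologicalComplex.homologyMap ((F.F p).π (F.F (p + 1))) n).hom x ∈ F.BInf p n := by
  have hp : F.F (p + 1) ≤ F.F p := F.anti _ _ (by omega)
  obtain ⟨y, hy⟩ := hx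
  let y' := (HomologicalComplex.homologyMap (inclusion hp) n).hom y
  have h1 : (HomologicalComplex.homologyMap (F.F p).ι n).hom (x - y') = 0 := by
    rw [map_sub, sub_eq_zero, ← hy]
    have : inclusion hp ≫ (F.F p).ι = (F.F (p + 1)).ι := rfl
    rw [← this, HomologicalComplex.homologyMap_comp]
    rfl
  have h2 : (HomologicalComplex.homologyMap ((F.F p).π (F.F (p + 1))) n).hom y' = 0 := by
    have : inclusion hp ≫ (F.F p).π (F.F (p + 1)) = 0 := by
      ext k : 1
      refine ModuleCat.hom_ext <| LinearMap.ext fun x => ?_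
      exact (Submodule.Quotient.mk_eq_zero _).2 x.2
    change (HomologicalComplex.homologyMap (inclusion hp) n ≫
      HomologicalComplex.homologyMap ((F.F p).π (F.F (p + 1))) n).hom y = 0
    rw [← HomologicalComplex.homologyMap_comp, this, HomologicalComplex.homologyMap_zero]
    rfl
  obtain ⟨z, hz⟩ := (ShortComplex.moduleCat_exact_iff _).1
    ((subSeq_shortExact (F.F p)).homology_exact₁ (n - 1) n (by simp)) (x - y') h1
  let φ : subSeq (F.F p) ⟶ quotSeq (F.F p).le_top' hp :=
    { τ₁ := (F.F p).π (F.F (p + 1))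
      τ₂ := (F.F (p + 1)).πTop
      τ₃ := 𝟙 _ }
  have h3 := HomologicalComplex.HomologySequence.δ_naturality φ (subSeq_shortExact (F.F p))
    (quotSeq_shortExact (F.F p).le_top' hp) (n - 1) n (by simp)
  refine ⟨z, ?_⟩
  have h4 := congrArg (fun g => g.hom z) h3
  have h5 : x = (x - y') + y' := by abel
  rw [h5, map_add, h2, add_zero, ← hz]
  refine Eq.trans ?_ h4.symm
  have h6 : HomologicalComplex.homologyMap φ.τ₃ (n - 1) = 𝟙 _ :=
    HomologicalComplex.homologyMap_id _ _
  rw [h6]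
  rfl

/-- The map `ψ^{p,q} : F^{p,q} / F^{p+1,q-1} → E_∞^{p,q}`, where `n = p + q`: it sends the class
of the image of `x ∈ Hⁿ(F_p)` in `Hⁿ(C)` to the class of the image of `x` in
`Hⁿ(F_p / F_{p+1})`. -/
noncomputable def ψ (p n : ℤ) : Subquot (F.FH p n) (F.FH (p + 1) n) →ₗ[ℝ] F.EInf p n :=
  imageMap (HomologicalComplex.homologyMap (F.F p).ι n).hom
    (HomologicalComplex.homologyMap ((F.F p).π (F.F (p + 1))) n).hom _ _ (F.FH_mem p n)

open Classical in
/-- The cochain complex `(E_r^{p+r*,q-(r-1)*}, d_r)`; its term in degree `k` has filtration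
index `p + r k` and total degree `p + q + k`. -/
noncomputable def pageCx (r : ℕ+) (p q : ℤ) : RealComplex.{u} where
  X k := ModuleCat.of ℝ (F.E r (p + r * k) (p + q + k))
  d k k' := if h : k + 1 = k' then
      ModuleCat.ofHom (F.dE r (p + r * k) (p + r * k') (p + q + k) (p + q + k')
        (by subst h; ring) (by omega))
    else 0
  shape k k' h := dif_neg h
  d_comp_d' i j k hij hjk := by
    have hij' : i + 1 = j := hij
    have hjk' : j + 1 = k := hjk
    rw [dif_pos hij', dif_pos hjk', ← ModuleCat.ofHom_comp]
    rw [F.dE_dE]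
    rfl

theorem subsingleton_homology_gr (p n : ℤ) (h : F.F (p + 1) = F.F p) :
    Subsingleton ((F.gr p).homology n) := by
  have : Subsingleton ((F.gr p).X n) := by
    refine Submodule.Quotient.subsingleton_iff.2 ?_
    rw [h]
    exact Submodule.submoduleOf_self _
  exact ModuleCat.subsingleton_of_isZero (ShortComplex.isZero_homology_of_isZero_X₂ _
    (ModuleCat.isZero_of_subsingleton ((F.gr p).X n)))

theorem eq_bot_of_le (l : ℕ) (hl : F.F l = ⊥) (p : ℤ) (hp : l ≤ p) : F.F p = ⊥ := by
  have h1 : F.F p ≤ ⊥ := hl ▸ F.anti _ _ hp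
  have h2 : ∀ n, (F.F p).carrier n = (⊥ : Subcomplex C).carrier n := fun n =>
    le_antisymm (h1 n) (bot_le : (⊥ : Submodule ℝ (C.X n)) ≤ _)
  cases hF : F.F p with
  | mk c hc =>
    rw [hF] at h2
    obtain rfl : c = fun _ => ⊥ := funext h2
    rfl

/-- The page complex with the Hilbert sub- and quotient structures induced by Hilbert structures
on the spaces `E_1^{p,q} = H^{p+q}(F_p / F_{p+1})`. -/
noncomputable def page (g : ∀ p n, HilbertStructure ((F.gr p).homology n)) (r : ℕ+) (p q : ℤ) :
    HilbertComplex.{u} where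
  cx := F.pageCx r p q
  hilbert k := (g (p + r * k) (p + q + k)).subquot (F.Z r (p + r * k) (p + q + k))
    (F.B r (p + r * k) (p + q + k))
  bounded := by
    obtain ⟨l, hl⟩ := F.exists_eq_bot
    refine ⟨l + p.natAbs + 1, fun k hk => ?_⟩
    have hr : (1 : ℤ) ≤ r := by have := r.pos; omega
    have hp : p + r * k < 0 ∨ l ≤ p + r * k := by
      push_cast at hk
      rcases le_total 0 k with h0 | h0
      · rw [abs_of_nonneg h0] at hk
        have h1 : k ≤ r * k := le_mul_of_one_le_left h0 hr
        have := neg_abs_le p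
        right; omega
      · rw [abs_of_nonpos h0] at hk
        have h1 : r * k ≤ k := by nlinarith
        have := le_abs_self p
        left; omega
    have h2 : F.F (p + r * k + 1) = F.F (p + r * k) := by
      rcases hp with h | h
      · rw [F.eq_top _ h.le, F.eq_top _ (by omega)]
      · rw [F.eq_bot_of_le l hl _ h, F.eq_bot_of_le l hl _ (by omega)]
    have := F.subsingleton_homology_gr (p + r * k) (p + q + k) h2
    exact (Submodule.mkQ_surjective ((F.B r (p + r * k) (p + q + k)).submoduleOf
      (F.Z r (p + r * k) (p + q + k)))).subsingleton

/-- The torsion `ρ(E_r^{p+r*,q-(r-1)*})`, where the cohomology of the page complex carries the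
Hilbert sub- and quotient structure of the page. -/
noncomputable def pageTorsion (g : ∀ p n, HilbertStructure ((F.gr p).homology n)) (r : ℕ+)
    (p q : ℤ) : ℝ :=
  (F.page g r p q).torsion (F.page g r p q).homologyHilbert

/-- The number `[[ψ^{p,q}]]`, where `F^{p,q} / F^{p+1,q-1}` and `E_∞^{p,q}` carry the Hilbert sub-
and quotient structures. -/
noncomputable def ψBracket (g : ∀ p n, HilbertStructure ((F.gr p).homology n))
    (h : ∀ n, HilbertStructure (C.homology n)) (p q : ℤ) : ℝ :=
  bracket ((h (p + q)).subquot (F.FH p (p + q)) (F.FH (p + 1) (p + q)))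
    ((g p (p + q)).subquot (F.ZInf p (p + q)) (F.BInf p (p + q))) (F.ψ p (p + q))

/-- The filtered torsion, for a filtration with `F_l = 0`. -/
noncomputable def filteredTorsion (l : ℕ) (σ : ∀ p, SimpleStructure (F.gr p))
    (g : ∀ p n, HilbertStructure ((F.gr p).homology n))
    (h : ∀ n, HilbertStructure (C.homology n)) : ℝ :=
  ∑ p ∈ Finset.Ico (0 : ℤ) l, (σ p).torsion (g p) +
    ∑ᶠ r : ℕ+, ∑ p ∈ Finset.Ico (0 : ℤ) r, ∑ᶠ q : ℤ, (-1 : ℝ) ^ (p + q) * F.pageTorsion g r p q -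
    ∑ᶠ (p : ℤ) (q : ℤ), (-1 : ℝ) ^ (p + q) * F.ψBracket g h p q

/-- The simple structure on `F_p` determined by descending induction, starting from the trivial
structure on `F_l = 0`, by the condition `ρ(F_{p+1} → F_p → F_p / F_{p+1}) = 0`. -/
inductive IsPreferredAt (l : ℕ) (σ : ∀ p, SimpleStructure (F.gr p)) :
    (p : ℤ) → SimpleStructure (F.F p).toCx → Prop
  | base (τ : SimpleStructure (F.F l).toCx) (u : SimpleRep (F.F l).toCx)
      (hu : ∀ n, Subsingleton (u.source.cx.X n)) (hτ : τ.IsRepresentedBy u) :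
      IsPreferredAt l σ l τ
  | step (p : ℤ) (hp : p < l) (τ' : SimpleStructure (F.F (p + 1)).toCx)
      (τ : SimpleStructure (F.F p).toCx) (hτ' : IsPreferredAt l σ (p + 1) τ')
      (hτ : HasSequenceTorsion (inclusion (F.anti p (p + 1) (by omega)))
        ((F.F p).π (F.F (p + 1))) τ' τ (σ p) 0) :
      IsPreferredAt l σ p τ

/-- The identification `F_0 = C`. -/
noncomputable def isoZero : (F.F 0).toCx ≅ C where
  hom := (F.F 0).ι
  inv :=
    { f := fun n => ModuleCat.ofHom (LinearMap.codRestrict ((F.F 0).carrier n) LinearMap.id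
        fun x => by rw [F.eq_top 0 le_rfl]; trivial) }

/-- The preferred simple structure on `C = F_0`. -/
def IsPreferred (l : ℕ) (σ : ∀ p, SimpleStructure (F.gr p)) (σC : SimpleStructure C) : Prop :=
  ∃ τ, F.IsPreferredAt l σ 0 τ ∧ σC = τ.transport F.isoZero

end Filtration

end FilteredTorsion

/-!
The proof translates every torsion into logarithmic volumes of bases. If a linear isomorphism `f`
maps the basis `v` to the family `f v`, then `[[f]]` is the logarithmic volume of `f v` minus that
of `v` (`bracket_eq`). A finite Hilbert complex has an adapted basis, consisting in each degree of
coboundaries `d y`, of cocycles `e` representing a basis of the cohomology, and of the elements `y`.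
For an acyclic complex, `c + γ` is unipotent and triangular with respect to such a basis; so the
torsion of an arbitrary complex is the alternating sum of the volumes of the classes of `e` minus
the alternating sum of the volumes of the adapted basis (`acyclicTorsion_eq`, `equivTorsion_eq`,
`HilbertComplex.torsion_eq`).

Three facts about simple structures follow. The torsion of `v⁻¹ ∘ u` is the difference of the
torsions computed from `u` and `v`, so a simple structure is determined by its torsion
(`SimpleStructure.ext_of_torsion`). Given a short exact sequence and simple structures on its outer
terms, a twisted sum of representatives yields a simple structure on the middle term for which the
torsion of the sequence vanishes (`exists_extension`). The torsion of the middle term is then given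
by Milnor's formula in terms of bases of the three cohomologies that are adapted to the long exact
sequence (`torsion_additive`); in particular it is unique.

The cohomologies of the subcomplexes `F_p` form a persistence module over a finite chain and thus
decompose into intervals, the bars (`Bars`, `nonempty_bars`). Up to a shift of degree, a bar that is
born at `t` and dies at `a` gives one class in the cohomology of `F_t / F_{t+1}` and one in the
cohomology of `F_a / F_{a+1}`, the second being mapped to the first by `d_{t-a}`. In this way the
bars provide bases of all the spaces `Z_r`, `B_r`, `Z_∞`, `B_∞` and `F^{p,q}` simultaneously, as
well as bases that are adapted to the long exact sequences of the pairs `F_{p+1} ⊂ F_p`. Hence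

* the torsion of the preferred simple structure on `F_p`, minus the volume of the bars in the
  cohomology of `F_p`, is the sum over `p' ≥ p` of the torsions of `F_{p'} / F_{p'+1}` minus the
  volumes of the bases of their cohomologies (`torsion_of_isPreferredAt`);
* the torsion of the `r`-th page is a sum of differences of the volumes of the bases of `Z_{r+1}` and
  `Z_r`, and of `B_r` and `B_{r+1}` (`pageTorsion_eq`);
* the bracket of `ψ` compares the volumes of the bases of `Z_∞`, `B_∞` and `F^{p,q}`
  (`bracket_ψ_eq`).

The second contributions telescope in `r` (`sum_pageTerm`). What remains of them is cancelled by the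
volumes of `Z_∞` and `B_∞`, except for `Z_1`, the full cohomology of `F_p / F_{p+1}`, which accounts
for the difference to the first formula (`filteredTorsion_eq`).
-/

namespace FilteredTorsion

/-! ### Bases of submodules -/

/-- The family `v` is a basis of the submodule `S`. -/
structure BasisOf {V ι : Type*} [AddCommGroup V] [Module ℝ V] (v : ι → V) (S : Submodule ℝ V) :
    Prop where
  li : LinearIndependent ℝ v
  span : Submodule.span ℝ (Set.range v) = S

namespace BasisOf

variable {V W ι κ : Type*} [AddCommGroup V] [Module ℝ V] [AddCommGroup W] [Module ℝ W]

theorem mem {v : ι → V} {S : Submodule ℝ V} (h : BasisOf v S) (i : ι) : v i ∈ S :=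
  h.span ▸ Submodule.subset_span ⟨i, rfl⟩

theorem comp_equiv {v : ι → V} {S : Submodule ℝ V} (h : BasisOf v S) (e : κ ≃ ι) :
    BasisOf (v ∘ e) S :=
  ⟨h.li.comp _ e.injective, by rw [e.surjective.range_comp, h.span]⟩

theorem map {v : ι → V} {S : Submodule ℝ V} (h : BasisOf v S) (f : V →ₗ[ℝ] W)
    (hf : ∀ x ∈ S, f x = 0 → x = 0) : BasisOf (f ∘ v) (S.map f) := by
  refine ⟨h.li.map ?_, by rw [Set.range_comp, Submodule.span_image, h.span]⟩
  rw [h.span, Submodule.disjoint_def]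
  exact fun x hx h0 => hf x hx h0

theorem map_top {v : ι → V} (h : BasisOf v ⊤) (f : V →ₗ[ℝ] W) (hf : Function.Injective f) :
    BasisOf (f ∘ v) (LinearMap.range f) := by
  rw [LinearMap.range_eq_map]
  exact h.map f fun x _ hx => hf (hx.trans (map_zero f).symm)

theorem map_equiv {v : ι → V} (h : BasisOf v ⊤) (f : V →ₗ[ℝ] W) (hf : Function.Bijective f) :
    BasisOf (f ∘ v) ⊤ := by
  rw [← LinearMap.range_eq_top.2 hf.2]
  exact h.map_top f hf.1

theorem of_map {v : ι → V} {S : Submodule ℝ V} (f : V →ₗ[ℝ] W) (hf : Function.Injective f)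
    (h : BasisOf (f ∘ v) (S.map f)) : BasisOf v S := by
  refine ⟨h.li.of_comp f, Submodule.map_injective_of_injective hf ?_⟩
  rw [← h.span, Set.range_comp, Submodule.span_image]

theorem sumElim {v : ι → V} {w : κ → V} (q : V →ₗ[ℝ] W)
    (hv : BasisOf v (LinearMap.ker q)) (hw : BasisOf (q ∘ w) (LinearMap.range q)) :
    BasisOf (Sum.elim v w) ⊤ := by
  constructor
  · refine hv.li.sum_type (hw.li.of_comp q) ?_
    rw [hv.span, Submodule.disjoint_def]
    intro x hx hx'
    have hd : Disjoint (Submodule.span ℝ (Set.range w)) (LinearMap.ker q) :=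
      Submodule.range_ker_disjoint hw.li
    exact Submodule.disjoint_def.1 hd x hx' hx
  · rw [eq_top_iff]
    rintro x -
    have h1 : q x ∈ Submodule.span ℝ (Set.range (q ∘ w)) := by rw [hw.span]; exact ⟨x, rfl⟩
    rw [Set.range_comp, Submodule.span_image] at h1
    obtain ⟨y, hy, hyx⟩ := h1
    have h2 : x - y ∈ Submodule.span ℝ (Set.range v) := by
      rw [hv.span, LinearMap.mem_ker, map_sub, hyx, sub_self]
    rw [Set.Sum.elim_range, Submodule.span_union]
    have : x = (x - y) + y := by abel
    rw [this]
    exact Submodule.add_mem_sup h2 hy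

theorem of_sumElim {v : ι → V} {w : κ → V} (q : V →ₗ[ℝ] W)
    (hv : BasisOf v (LinearMap.ker q)) (h : BasisOf (Sum.elim v w) ⊤) :
    BasisOf (q ∘ w) (LinearMap.range q) := by
  have hli := linearIndependent_sum.1 h.li
  constructor
  · refine LinearIndependent.map hli.2.1 ?_
    have h3 := hli.2.2.symm
    rwa [Sum.elim_comp_inl, Sum.elim_comp_inr, hv.span] at h3
  · have h1 := congrArg (Submodule.map q) h.span
    rw [Set.Sum.elim_range, Submodule.span_union, Submodule.map_sup, hv.span,
      ← Submodule.span_image, ← Set.range_comp, ← LinearMap.range_eq_map] at h1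
    rw [← h1]
    have : Submodule.map q (LinearMap.ker q) = ⊥ := by
      rw [eq_bot_iff]
      rintro _ ⟨x, hx, rfl⟩
      exact hx
    rw [this, bot_sup_eq]

theorem finite [FiniteDimensional ℝ V] {v : ι → V} {S : Submodule ℝ V} (h : BasisOf v S) :
    Finite ι := h.li.finite

end BasisOf

theorem exists_basisOf_top (V : Type u) [AddCommGroup V] [Module ℝ V] :
    ∃ (ι : Type u) (v : ι → V), BasisOf v ⊤ :=
  let b := Module.Basis.ofVectorSpace ℝ V
  ⟨_, b, b.linearIndependent, b.span_eq⟩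

/-! ### Logarithmic volumes -/

namespace HilbertStructure

variable {V W ι κ : Type*} [AddCommGroup V] [Module ℝ V] [AddCommGroup W] [Module ℝ W]

/-- The inner product of a Hilbert structure as a bilinear form. -/
noncomputable def form (h : HilbertStructure V) : V →ₗ[ℝ] V →ₗ[ℝ] ℝ :=
  LinearMap.mk₂ ℝ h.ip h.ip_add h.ip_smul
    (fun x y z => by rw [h.ip_symm, h.ip_add, h.ip_symm, h.ip_symm z])
    (fun r x y => by rw [h.ip_symm, h.ip_smul, h.ip_symm, smul_eq_mul])

theorem form_apply (h : HilbertStructure V) (x y : V) : h.form x y = h.ip x y := rfl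

/-- The Gram matrix of a family of vectors. -/
noncomputable def gram (h : HilbertStructure V) (v : ι → V) : Matrix ι ι ℝ :=
  Matrix.of fun i j => h.ip (v i) (v j)

/-- The logarithm of the volume of the parallelepiped spanned by a finite family. -/
noncomputable def logVol (h : HilbertStructure V) [Finite ι] (v : ι → V) : ℝ :=
  letI := Fintype.ofFinite ι
  letI := Classical.decEq ι
  1 / 2 * Real.log |(h.gram v).det|

theorem logVol_eq (h : HilbertStructure V) [Fintype ι] [DecidableEq ι] (v : ι → V) :
    h.logVol v = 1 / 2 * Real.log |(h.gram v).det| := by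
  unfold logVol
  congr!

theorem det_gram_ne_zero (h : HilbertStructure V) [Fintype ι] [DecidableEq ι] {v : ι → V}
    (hv : LinearIndependent ℝ v) : (h.gram v).det ≠ 0 := by
  intro h0
  obtain ⟨x, hx, hx0⟩ := Matrix.exists_mulVec_eq_zero_iff.2 h0
  have h1 : h.ip (∑ i, x i • v i) (∑ i, x i • v i) = 0 := by
    rw [← form_apply, map_sum]
    refine Finset.sum_eq_zero fun i _ => ?_
    have h2 := congrFun hx0 i
    rw [Matrix.mulVec, dotProduct, Pi.zero_apply] at h2
    rw [map_smul, map_sum, LinearMap.sum_apply, smul_eq_mul]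
    simp only [map_smul, smul_eq_mul, form_apply, LinearMap.smul_apply]
    rw [← mul_zero (x i), ← h2]
    refine congrArg _ (Finset.sum_congr rfl fun j _ => ?_)
    rw [gram, Matrix.of_apply, h.ip_symm, mul_comm]
  exact hx (funext fun i => Fintype.linearIndependent_iff.1 hv x (h.ip_definite _ h1) i)

theorem logVol_of_isEmpty (h : HilbertStructure V) [Finite ι] [IsEmpty ι] (v : ι → V) :
    h.logVol v = 0 := by
  have := Fintype.ofFinite ι
  classical
  rw [logVol_eq, Matrix.det_isEmpty]; simp

theorem logVol_comp_equiv (h : HilbertStructure V) [Finite ι] [Finite κ] (v : ι → V) (e : κ ≃ ι) :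
    h.logVol (v ∘ e) = h.logVol v := by
  have := Fintype.ofFinite ι
  have := Fintype.ofFinite κ
  classical
  rw [logVol_eq, logVol_eq]
  have : h.gram (v ∘ e) = (h.gram v).submatrix e e := rfl
  rw [this, Matrix.det_submatrix_equiv_self]

/-- Volumes do not depend on the way in which a family is indexed. -/
theorem logVol_congr (h : HilbertStructure V) [Finite ι] [Finite κ] {v : ι → V} {w : κ → V}
    (e : κ ≃ ι) (he : ∀ i, w i = v (e i)) : h.logVol w = h.logVol v := by
  rw [← h.logVol_comp_equiv v e]
  congr 1
  exact funext he

theorem gram_of_matrix (h : HilbertStructure V) [Fintype ι] {v w : ι → V} (P : Matrix ι ι ℝ)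
    (hP : ∀ i, v i = ∑ k, P k i • w k) : h.gram v = P.transpose * h.gram w * P := by
  ext i j
  rw [Matrix.mul_apply]
  simp only [Matrix.mul_apply, gram, Matrix.of_apply, Matrix.transpose_apply]
  rw [hP i, hP j, ← form_apply]
  simp only [map_sum, LinearMap.sum_apply, map_smul, LinearMap.smul_apply, smul_eq_mul,
    form_apply, Finset.mul_sum, Finset.sum_mul]
  exact Finset.sum_congr rfl fun x _ => Finset.sum_congr rfl fun y _ => by ring

theorem logVol_of_abs_det_eq_one (h : HilbertStructure V) [Fintype ι] [DecidableEq ι]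
    {v w : ι → V} (P : Matrix ι ι ℝ) (hP : ∀ i, v i = ∑ k, P k i • w k) (hd : |P.det| = 1) :
    h.logVol v = h.logVol w := by
  rw [logVol_eq, logVol_eq, h.gram_of_matrix P hP, Matrix.det_mul, Matrix.det_mul,
    Matrix.det_transpose, abs_mul, abs_mul, hd]
  simp

/-- Changing signs in a family does not change its volume. -/
theorem logVol_sign (h : HilbertStructure V) [Finite ι] (v : ι → V) (s : ι → ℝ)
    (hs : ∀ i, |s i| = 1) : h.logVol (fun i => s i • v i) = h.logVol v := by
  have := Fintype.ofFinite ι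
  classical
  refine h.logVol_of_abs_det_eq_one (Matrix.diagonal s) (fun i => ?_) ?_
  · simp [Matrix.diagonal_apply]
  · rw [Matrix.det_diagonal, Finset.abs_prod]
    simp [hs]

/-- Volumes are invariant under shearing: vectors in the span of the first family can be added
to the members of the second one. -/
theorem logVol_shear (h : HilbertStructure V) [Finite ι] [Finite κ] (v : ι → V) (w w' : κ → V)
    (hw : ∀ j, w' j - w j ∈ Submodule.span ℝ (Set.range v)) :
    h.logVol (Sum.elim v w') = h.logVol (Sum.elim v w) := by
  have := Fintype.ofFinite ι
  have := Fintype.ofFinite κ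
  classical
  choose c hc using fun j => (Submodule.mem_span_range_iff_exists_fun ℝ).1 (hw j)
  refine h.logVol_of_abs_det_eq_one
    (Matrix.fromBlocks 1 (Matrix.of fun i j => c j i) 0 1) (fun i => ?_) ?_
  · rw [Fintype.sum_sum_type]
    rcases i with i | j
    · simp [Matrix.one_apply]
    · simp [Matrix.one_apply, hc]
  · rw [Matrix.det_fromBlocks_zero₂₁]; simp

/-- `q` restricts to an isometry from the orthogonal complement of its kernel. -/
def IsCoisometry (h : HilbertStructure V) (k : HilbertStructure W) (q : V →ₗ[ℝ] W) : Prop :=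
  ∃ s : W →ₗ[ℝ] V, (∀ w, q (s w) = w) ∧ (∀ w x, q x = 0 → h.ip (s w) x = 0) ∧
    ∀ w w', k.ip w w' = h.ip (s w) (s w')

theorem isCoisometry_map (h : HilbertStructure V) (q : V →ₗ[ℝ] W) (hq : Function.Surjective q) :
    h.IsCoisometry (h.map q hq) q :=
  ⟨(h.exists_orthogonal_section q hq).choose, (h.exists_orthogonal_section q hq).choose_spec.1,
    (h.exists_orthogonal_section q hq).choose_spec.2, fun _ _ => rfl⟩

theorem isCoisometry_fst (h : HilbertStructure V) (k : HilbertStructure W) :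
    (h.prod k).IsCoisometry h (LinearMap.fst ℝ V W) :=
  ⟨LinearMap.inl ℝ V W, fun _ => rfl, fun w x hx => by
    have hx' : x.1 = 0 := hx
    change h.ip w x.1 + k.ip 0 x.2 = 0
    rw [hx', ← form_apply, ← form_apply, map_zero, map_zero, LinearMap.zero_apply, add_zero],
    fun w w' => by
    change _ = h.ip w w' + k.ip 0 0
    rw [← form_apply k, map_zero, add_zero]⟩

/-- Volumes are multiplicative in short exact sequences. -/
theorem logVol_sumElim (h : HilbertStructure V) (k : HilbertStructure W) (q : V →ₗ[ℝ] W)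
    (hq : h.IsCoisometry k q) [Finite ι] [Finite κ] (v : ι → V) (w : κ → V)
    (hv : BasisOf v (LinearMap.ker q)) (hw : LinearIndependent ℝ (q ∘ w)) :
    h.logVol (Sum.elim v w) = h.logVol v + k.logVol (q ∘ w) := by
  obtain ⟨s, hs, hs', hk⟩ := hq
  rw [h.logVol_shear v (fun j => s (q (w j))) w fun j => by
    rw [hv.span, LinearMap.mem_ker, map_sub, hs, sub_self]]
  have := Fintype.ofFinite ι
  have := Fintype.ofFinite κ
  classical
  have hv0 : ∀ i, q (v i) = 0 := fun i => hv.mem i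
  have h1 : h.gram (Sum.elim v fun j => s (q (w j))) =
      Matrix.fromBlocks (h.gram v) 0 0 (k.gram (q ∘ w)) := by
    ext i j
    rcases i with i | i <;> rcases j with j | j
    · rfl
    · change h.ip (v i) (s (q (w j))) = 0
      rw [h.ip_symm, hs' _ _ (hv0 i)]
    · exact hs' _ _ (hv0 j)
    · exact (hk _ _).symm
  rw [logVol_eq, logVol_eq, logVol_eq, h1, Matrix.det_fromBlocks_zero₂₁, abs_mul,
    Real.log_mul (abs_ne_zero.2 (h.det_gram_ne_zero hv.li)) (abs_ne_zero.2 (k.det_gram_ne_zero hw))]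
  ring

end HilbertStructure

theorem bracket_eq {V W ι : Type*} [AddCommGroup V] [Module ℝ V] [AddCommGroup W] [Module ℝ W]
    (h : HilbertStructure V) (k : HilbertStructure W) (f : V →ₗ[ℝ] W)
    (hf : Function.Injective f) [Finite ι] {v : ι → V} (hv : BasisOf v ⊤) :
    bracket h k f = k.logVol (f ∘ v) - h.logVol v := by
  have := Fintype.ofFinite ι
  classical
  let : NormedAddCommGroup V := h.core.toNormedAddCommGroup
  let : InnerProductSpace ℝ V := InnerProductSpace.ofCore h.core.toCore
  let : NormedAddCommGroup W := k.core.toNormedAddCommGroup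
  let : InnerProductSpace ℝ W := InnerProductSpace.ofCore k.core.toCore
  have : FiniteDimensional ℝ V := h.finite
  have : FiniteDimensional ℝ W := k.finite
  let b : Module.Basis ι ℝ V := Module.Basis.mk hv.li hv.span.ge
  have hb : ∀ i, b i = v i := fun i => Module.Basis.mk_apply _ _ i
  set A : V →ₗ[ℝ] V := LinearMap.adjoint f ∘ₗ f with hA
  have h1 : k.gram (f ∘ v) = h.gram v * LinearMap.toMatrix b b A := by
    ext i j
    have h2 : k.ip (f (v i)) (f (v j)) = h.ip (v i) (A (v j)) := by
      exact (LinearMap.adjoint_inner_right f (v i) (f (v j))).symm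
    rw [Matrix.mul_apply]
    simp only [HilbertStructure.gram, Matrix.of_apply, Function.comp_apply]
    rw [h2, ← b.sum_repr (A (v j)), ← HilbertStructure.form_apply, map_sum]
    refine Finset.sum_congr rfl fun x _ => ?_
    rw [LinearMap.toMatrix_apply, map_smul, hb, hb, smul_eq_mul, HilbertStructure.form_apply,
      mul_comm]
  have h2 : bracket h k f = 1 / 2 * Real.log |LinearMap.det A| := rfl
  have h3 := k.det_gram_ne_zero (hv.map_top f hf).li
  rw [h1, Matrix.det_mul, LinearMap.det_toMatrix] at h3
  rw [h2, HilbertStructure.logVol_eq, HilbertStructure.logVol_eq, h1, Matrix.det_mul,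
    LinearMap.det_toMatrix, abs_mul, Real.log_mul (abs_ne_zero.2 (left_ne_zero_of_mul h3))
    (abs_ne_zero.2 (right_ne_zero_of_mul h3))]
  ring

/-! ### Cocycles and their classes -/

/-- The element `x` of a complex is a cocycle representing the cohomology class `ξ`. -/
def IsClass (K : RealComplex.{u}) (n : ℤ) (x : K.X n) (ξ : K.homology n) : Prop :=
  ∃ z : K.cycles n, (K.iCycles n).hom z = x ∧ (K.homologyπ n).hom z = ξ

namespace IsClass

variable {K L : RealComplex.{u}} {n : ℤ}

theorem iCycles_injective (K : RealComplex.{u}) (n : ℤ) :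
    Function.Injective (K.iCycles n).hom :=
  (ModuleCat.mono_iff_injective _).1 inferInstance

theorem homologyπ_surjective (K : RealComplex.{u}) (n : ℤ) :
    Function.Surjective (K.homologyπ n).hom :=
  (ModuleCat.epi_iff_surjective _).1 inferInstance

/-- Representing cocycles can be chosen linearly. -/
theorem exists_linear (K : RealComplex.{u}) (n : ℤ) :
    ∃ s : K.homology n →ₗ[ℝ] K.X n, ∀ ξ, IsClass K n (s ξ) ξ := by
  obtain ⟨t, ht⟩ := exists_section (K.homologyπ n).hom (homologyπ_surjective K n)
  exact ⟨(K.iCycles n).hom ∘ₗ t, fun ξ => ⟨t ξ, rfl, LinearMap.congr_fun ht ξ⟩⟩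

theorem exists_rep (ξ : K.homology n) : ∃ x, IsClass K n x ξ :=
  let ⟨s, hs⟩ := exists_linear K n
  ⟨s ξ, hs ξ⟩

theorem sub {x y : K.X n} {ξ η : K.homology n} (h : IsClass K n x ξ) (h' : IsClass K n y η) :
    IsClass K n (x - y) (ξ - η) := by
  obtain ⟨z, rfl, rfl⟩ := h
  obtain ⟨w, rfl, rfl⟩ := h'
  exact ⟨z - w, map_sub _ _ _, map_sub _ _ _⟩

theorem unique {x : K.X n} {ξ η : K.homology n} (h : IsClass K n x ξ) (h' : IsClass K n x η) :
    ξ = η := by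
  obtain ⟨z, rfl, rfl⟩ := h
  obtain ⟨w, hw, rfl⟩ := h'
  rw [iCycles_injective K n hw]

theorem d_eq_zero {x : K.X n} {ξ : K.homology n} (h : IsClass K n x ξ) (m : ℤ) :
    (K.d n m).hom x = 0 := by
  obtain ⟨z, rfl, rfl⟩ := h
  exact congrArg (fun g => g.hom z) (K.iCycles_d n m)

theorem of_d_eq_zero {m : ℤ} (hm : n + 1 = m) {x : K.X n} (hx : (K.d n m).hom x = 0) :
    ∃ ξ, IsClass K n x ξ := by
  let f : ModuleCat.of ℝ (LinearMap.ker (K.d n m).hom) ⟶ K.X n :=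
    ModuleCat.ofHom (Submodule.subtype _)
  have hf : f ≫ K.d n m = 0 := ModuleCat.hom_ext (LinearMap.ext fun y => y.2)
  refine ⟨(K.homologyπ n).hom ((K.liftCycles f m (by simp [← hm]) hf).hom ⟨x, hx⟩), _, ?_, rfl⟩
  exact congrArg (fun g => g.hom ⟨x, hx⟩) (K.liftCycles_i f m (by simp [← hm]) hf)

theorem of_d {k : ℤ} (y : K.X k) : IsClass K n ((K.d k n).hom y) 0 :=
  ⟨(K.toCycles k n).hom y, congrArg (fun g => g.hom y) (K.toCycles_i k n),
    congrArg (fun g => g.hom y) (K.toCycles_comp_homologyπ k n)⟩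

theorem exists_of_zero {k : ℤ} (hk : k + 1 = n) {x : K.X n} (h : IsClass K n x 0) :
    ∃ y, (K.d k n).hom y = x := by
  obtain ⟨z, rfl, hz⟩ := h
  have hex : (ShortComplex.mk (K.toCycles k n) (K.homologyπ n)
      (K.toCycles_comp_homologyπ k n)).Exact :=
    ShortComplex.exact_of_g_is_cokernel _ (K.homologyIsCokernel k n (by simp [← hk]))
  obtain ⟨y, hy⟩ := (ShortComplex.moduleCat_exact_iff _).1 hex z hz
  refine ⟨y, ?_⟩
  rw [← hy]
  exact (congrArg (fun g => g.hom y) (K.toCycles_i k n)).symm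

theorem map (f : K ⟶ L) {x : K.X n} {ξ : K.homology n} (h : IsClass K n x ξ) :
    IsClass L n ((f.f n).hom x) ((HomologicalComplex.homologyMap f n).hom ξ) := by
  obtain ⟨z, rfl, rfl⟩ := h
  refine ⟨(HomologicalComplex.cyclesMap f n).hom z, ?_, ?_⟩
  · exact congrArg (fun g => g.hom z) (HomologicalComplex.cyclesMap_i f n)
  · exact congrArg (fun g => g.hom z) (HomologicalComplex.homologyπ_naturality f n).symm

/-- The connecting homomorphism in terms of representing cocycles. -/
theorem δ {S : ShortComplex RealComplex.{u}} (hS : S.ShortExact) {m : ℤ} (hm : n + 1 = m)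
    {x : S.X₃.X n} {ξ : S.X₃.homology n} (h : IsClass S.X₃ n x ξ) (y : S.X₂.X n)
    (hy : (S.g.f n).hom y = x) (w : S.X₁.X m) (hw : (S.f.f m).hom w = (S.X₂.d n m).hom y) :
    IsClass S.X₁ m w ((hS.δ n m hm).hom ξ) := by
  have hx := h.d_eq_zero m
  have h1 := hS.δ_apply n m hm x hx y hy w hw (m + 1) (by simp)
  have hw' : (S.X₁.d m (m + 1)).hom w = 0 :=
    ShortComplex.ShortExact.d_eq_zero_of_f_eq_d_apply hS n m y w hw (m + 1)
  have key : ∀ (K : RealComplex.{u}) (n m : ℤ) (hm : (ComplexShape.up ℤ).next n = m) (x : K.X n)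
      (hx : (K.d n m).hom x = 0),
      IsClass K n x ((K.homologyπ n).hom (K.cyclesMk x m hm hx)) := fun K n m hm x hx =>
    ⟨_, K.i_cyclesMk x m hm hx, rfl⟩
  have h2 := key _ n m (by simp [← hm]) x hx
  have h3 := key _ m (m + 1) (by simp) w hw'
  have h4 := h.unique h2
  rw [h4]
  exact (congrArg (IsClass S.X₁ m w) h1).mpr h3

end IsClass

/-! ### Contractions of acyclic complexes of vector spaces -/

theorem exists_generalized_inverse {V W : Type*} [AddCommGroup V] [Module ℝ V] [AddCommGroup W]
    [Module ℝ W] (f : V →ₗ[ℝ] W) : ∃ g : W →ₗ[ℝ] V, ∀ x, f (g (f x)) = f x := by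
  obtain ⟨s, hs⟩ := exists_section f.rangeRestrict f.surjective_rangeRestrict
  obtain ⟨p, hp⟩ := LinearMap.exists_leftInverse_of_injective (LinearMap.range f).subtype
    (Submodule.ker_subtype _)
  refine ⟨s ∘ₗ p, fun x => ?_⟩
  have h1 : p (f x) = f.rangeRestrict x := LinearMap.congr_fun hp (f.rangeRestrict x)
  have h2 := LinearMap.congr_fun hs (f.rangeRestrict x)
  rw [LinearMap.comp_apply, h1]
  exact congrArg Subtype.val h2

/-- An acyclic complex of vector spaces is contractible. -/
theorem nonempty_contraction (K : RealComplex.{u})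
    (hK : ∀ l n m : ℤ, l + 1 = n → n + 1 = m → ∀ x, (K.d n m).hom x = 0 →
      ∃ y, (K.d l n).hom y = x) : Nonempty (Homotopy (𝟙 K) 0) := by
  classical
  choose t ht using fun n m : ℤ => exists_generalized_inverse (K.d n m).hom
  refine ⟨
    { hom := fun n l => if l + 1 = n then
          ModuleCat.ofHom (t l n ∘ₗ (LinearMap.id - t n (n + 1) ∘ₗ (K.d n (n + 1)).hom)) else 0
      zero := fun n l h => if_neg h
      comm := fun n => ?_ }⟩
  rw [dNext_eq _ (show (ComplexShape.up ℤ).Rel n (n + 1) from rfl),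
    prevD_eq _ (show (ComplexShape.up ℤ).Rel (n - 1) n from sub_add_cancel n 1),
    if_pos rfl, if_pos (sub_add_cancel n 1)]
  refine ModuleCat.hom_ext (LinearMap.ext fun x => ?_)
  have h0 : (K.d n (n + 1)).hom (x - t n (n + 1) ((K.d n (n + 1)).hom x)) = 0 := by
    rw [map_sub, ht, sub_self]
  obtain ⟨y, hy⟩ := hK (n - 1) n (n + 1) (sub_add_cancel n 1) rfl _ h0
  have h1 : (K.d (n + 1) (n + 1 + 1)).hom ((K.d n (n + 1)).hom x) = 0 :=
    congrArg (fun g => g.hom x) (K.d_comp_d n (n + 1) (n + 1 + 1))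
  change x = t n (n + 1) ((K.d n (n + 1)).hom x -
      t (n + 1) (n + 1 + 1) ((K.d (n + 1) (n + 1 + 1)).hom ((K.d n (n + 1)).hom x))) +
    (K.d (n - 1) n).hom (t (n - 1) n (x - t n (n + 1) ((K.d n (n + 1)).hom x))) + 0
  rw [h1, map_zero, sub_zero, ← hy, ht, hy]
  abel

theorem contraction_apply {K : RealComplex.{u}} (γ : Homotopy (𝟙 K) 0) {l n m : ℤ}
    (hl : l + 1 = n) (hm : n + 1 = m) (x : K.X n) :
    (K.d l n).hom ((γ.hom n l).hom x) + (γ.hom m n).hom ((K.d n m).hom x) = x := by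
  have h := γ.comm n
  rw [dNext_eq _ (show (ComplexShape.up ℤ).Rel n m from hm),
    prevD_eq _ (show (ComplexShape.up ℤ).Rel l n from hl)] at h
  have h1 : x = (γ.hom m n).hom ((K.d n m).hom x) + (K.d l n).hom ((γ.hom n l).hom x) + 0 :=
    congrArg (fun g => g.hom x) h
  rw [add_zero, add_comm] at h1
  exact h1.symm

/-! ### Volumes in finite products -/

section Pi

variable {I : Type*} {E : I → Type*} [∀ i, AddCommGroup (E i)] [∀ i, Module ℝ (E i)]
  {κ : I → Type*}

theorem BasisOf.isEmpty {V ι : Type*} [AddCommGroup V] [Module ℝ V] [Subsingleton V] {v : ι → V}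
    {S : Submodule ℝ V} (h : BasisOf v S) : IsEmpty ι :=
  ⟨fun i => h.li.ne_zero i (Subsingleton.elim _ _)⟩

theorem basisOf_pi [DecidableEq I] (hfin : {i | ¬ Subsingleton (E i)}.Finite)
    (v : ∀ i, κ i → E i) (hv : ∀ i, BasisOf (v i) ⊤) :
    BasisOf (fun x : Σ i, κ i => (Pi.single x.1 (v x.1 x.2) : ∀ i, E i)) ⊤ := by
  refine ⟨Pi.linearIndependent_single v fun i => (hv i).li, eq_top_iff.2 fun x _ => ?_⟩
  have h1 : x = ∑ i ∈ hfin.toFinset, Pi.single i (x i) := by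
    funext j
    rw [Finset.sum_apply]
    by_cases hj : Subsingleton (E j)
    · exact Subsingleton.elim _ _
    · rw [Finset.sum_eq_single_of_mem j (hfin.mem_toFinset.2 hj)
        fun i _ hi => Pi.single_eq_of_ne hi.symm _, Pi.single_eq_same]
  rw [h1]
  refine Submodule.sum_mem _ fun i _ => ?_
  have h2 : x i ∈ Submodule.span ℝ (Set.range (v i)) := by rw [(hv i).span]; trivial
  have h3 := Submodule.mem_map_of_mem (f := LinearMap.single ℝ E i) h2
  rw [← Submodule.span_image] at h3
  refine Submodule.span_mono ?_ h3
  rintro _ ⟨_, ⟨j, rfl⟩, rfl⟩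
  exact ⟨⟨i, j⟩, rfl⟩

theorem det_blockDiagonal_sigma {o : Type*} [Fintype o] [DecidableEq o] [LinearOrder o]
    {m : o → Type*}
    [∀ i, Fintype (m i)] [∀ i, DecidableEq (m i)] (M : ∀ i, Matrix (m i) (m i) ℝ) :
    (Matrix.blockDiagonal' M).det = ∏ i, (M i).det := by
  rw [(Matrix.blockTriangular_blockDiagonal' M).det_fintype]
  refine Finset.prod_congr rfl fun k _ => ?_
  let e : m k ≃ {x : Σ i, m i // x.1 = k} :=
    { toFun := fun a => ⟨⟨k, a⟩, rfl⟩
      invFun := fun x => x.2 ▸ x.1.2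
      left_inv := fun _ => rfl
      right_inv := by rintro ⟨⟨i, a⟩, rfl⟩; rfl }
  rw [← Matrix.det_submatrix_equiv_self e]
  congr 1
  ext a b
  exact Matrix.blockDiagonal'_apply_eq M k a b

/-- The volume of a family assembled from bases of the factors of a product. -/
theorem logVol_pi [DecidableEq I] [LinearOrder I] (h : ∀ i, HilbertStructure (E i))
    (hfin : {i | ¬ Subsingleton (E i)}.Finite) [∀ i, Finite (κ i)] [Finite (Σ i, κ i)]
    (v : ∀ i, κ i → E i) (hv : ∀ i, BasisOf (v i) ⊤) :
    (HilbertStructure.pi h hfin).logVol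
        (fun x : Σ i, κ i => (Pi.single x.1 (v x.1 x.2) : ∀ i, E i)) =
      ∑ᶠ i, (h i).logVol (v i) := by
  let s := hfin.toFinset
  have hs : ∀ i, i ∉ s → IsEmpty (κ i) := fun i hi => by
    have : Subsingleton (E i) := by
      by_contra h0
      exact hi (hfin.mem_toFinset.2 h0)
    exact (hv i).isEmpty
  have hsum : ∑ᶠ i, (h i).logVol (v i) = ∑ i ∈ s, (h i).logVol (v i) := by
    refine finsum_eq_sum_of_support_subset _ fun i hi => ?_
    by_contra h0
    have := hs i h0
    exact hi ((h i).logVol_of_isEmpty _)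
  have := fun i => Fintype.ofFinite (κ i)
  have := fun i => Classical.decEq (κ i)
  let e' : (Σ i : s, κ i.1) → Σ i, κ i := fun x => ⟨x.1.1, x.2⟩
  have he' : Function.Bijective e' := by
    constructor
    · rintro ⟨⟨i, hi⟩, a⟩ ⟨⟨j, hj⟩, b⟩ hab
      simp only [e', Sigma.mk.injEq] at hab
      obtain ⟨rfl, hab⟩ := hab
      rw [eq_of_heq hab]
    · rintro ⟨i, a⟩
      have hi : i ∈ s := by
        by_contra h0
        exact (hs i h0).false a
      exact ⟨⟨⟨i, hi⟩, a⟩, rfl⟩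
  rw [hsum, ← HilbertStructure.logVol_comp_equiv _ _ (Equiv.ofBijective e' he'),
    HilbertStructure.logVol_eq]
  have h1 : (HilbertStructure.pi h hfin).gram ((fun x : Σ i, κ i =>
        (Pi.single x.1 (v x.1 x.2) : ∀ i, E i)) ∘ (Equiv.ofBijective e' he')) =
      Matrix.blockDiagonal' fun i : s => (h i.1).gram (v i.1) := by
    ext ⟨i, a⟩ ⟨j, b⟩
    change ∑ᶠ k, (h k).ip ((Pi.single i.1 (v i.1 a) : ∀ i, E i) k)
      ((Pi.single j.1 (v j.1 b) : ∀ i, E i) k) = _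
    rw [finsum_eq_single _ i.1 fun k hk => by
      rw [Pi.single_eq_of_ne hk, ← HilbertStructure.form_apply, map_zero, LinearMap.zero_apply],
      Pi.single_eq_same, Matrix.blockDiagonal'_apply]
    by_cases hij : i = j
    · subst hij
      rw [Pi.single_eq_same, dif_pos rfl]
      rfl
    · rw [dif_neg hij, Pi.single_eq_of_ne fun h0 => hij (Subtype.ext h0),
        ← HilbertStructure.form_apply, map_zero]
  rw [h1, det_blockDiagonal_sigma, Finset.abs_prod, Real.log_prod fun i _ =>
    abs_ne_zero.2 ((h i.1).det_gram_ne_zero (hv i.1).li), Finset.mul_sum,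
    ← Finset.sum_coe_sort s]
  exact Finset.sum_congr rfl fun i _ => ((h i.1).logVol_eq _).symm

end Pi

theorem exists_triangular_matrix {V ι : Type*} [AddCommGroup V] [Module ℝ V]
    [Fintype ι] [DecidableEq ι] (v w : ι → V) (wt : ι → ℤ)
    (hvw : ∀ i, v i - w i ∈ Submodule.span ℝ (w '' {j | wt j < wt i})) :
    ∃ P : Matrix ι ι ℝ, (∀ i, v i = ∑ k, P k i • w k) ∧ P.det = 1 := by
  have h1 : ∀ i, ∃ c : ι → ℝ, (∀ j, c j ≠ 0 → wt j < wt i) ∧ ∑ j, c j • w j = v i - w i := by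
    intro i
    obtain ⟨c, hc, hci⟩ := (Finsupp.mem_span_image_iff_linearCombination ℝ).1 (hvw i)
    refine ⟨c, fun j hj => (Finsupp.mem_supported ℝ c).1 hc (by simpa using hj), ?_⟩
    rw [← hci, Finsupp.linearCombination_apply, Finsupp.sum_fintype _ _ fun i => zero_smul ℝ (w i)]
  choose c hc hci using h1
  let P : Matrix ι ι ℝ := 1 + Matrix.of fun k i => c i k
  have hP : P.BlockTriangular wt := by
    intro k i hki
    have hne : k ≠ i := fun h0 => by subst h0; exact lt_irrefl _ hki
    have h0 : c i k = 0 := by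
      by_contra h0
      exact lt_asymm hki (hc i k h0)
    simp [P, Matrix.one_apply_ne hne, h0]
  refine ⟨P, fun i => ?_, ?_⟩
  · simp only [P, Matrix.add_apply, Matrix.of_apply, add_smul, Finset.sum_add_distrib, hci,
      Matrix.one_apply, ite_smul, one_smul, zero_smul, Finset.sum_ite_eq', Finset.mem_univ, if_true]
    abel
  · rw [hP.det, Finset.prod_eq_one]
    intro a _
    have : P.toSquareBlock wt a = 1 := by
      ext ⟨k, hk⟩ ⟨i, hi⟩
      have h0 : c i k = 0 := by
        by_contra h0
        have := hc i k h0
        rw [hk, hi] at this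
        exact lt_irrefl _ this
      simp [P, Matrix.toSquareBlock_def, Matrix.one_apply, h0]
    rw [this, Matrix.det_one]

/-- A family obtained from another one by a unipotent triangular change of coordinates has the
same volume. -/
theorem HilbertStructure.logVol_triangular {V ι : Type*} [AddCommGroup V] [Module ℝ V]
    (h : HilbertStructure V) [Finite ι] (v w : ι → V) (wt : ι → ℤ)
    (hvw : ∀ i, v i - w i ∈ Submodule.span ℝ (w '' {j | wt j < wt i})) :
    h.logVol v = h.logVol w := by
  have := Fintype.ofFinite ι
  classical
  obtain ⟨P, hP, hd⟩ := exists_triangular_matrix v w wt hvw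
  exact h.logVol_of_abs_det_eq_one P hP (by rw [hd, abs_one])

theorem linearIndependent_triangular {V ι : Type*} [AddCommGroup V] [Module ℝ V] [Finite ι]
    {v w : ι → V} (wt : ι → ℤ)
    (hvw : ∀ i, v i - w i ∈ Submodule.span ℝ (w '' {j | wt j < wt i}))
    (hw : LinearIndependent ℝ w) : LinearIndependent ℝ v := by
  have := Fintype.ofFinite ι
  classical
  obtain ⟨P, hP, hd⟩ := exists_triangular_matrix v w wt hvw
  rw [Fintype.linearIndependent_iff] at hw ⊢
  intro g hg
  have h1 : ∑ k, (P.mulVec g) k • w k = 0 := by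
    rw [← hg]
    simp only [hP, Matrix.mulVec, dotProduct, Finset.sum_smul, Finset.smul_sum, smul_smul]
    rw [Finset.sum_comm]
    exact Finset.sum_congr rfl fun i _ => Finset.sum_congr rfl fun k _ => by rw [mul_comm]
  have h2 : P.mulVec g = 0 := funext fun k => hw _ h1 k
  exact congrFun (Matrix.eq_zero_of_mulVec_eq_zero (by rw [hd]; exact one_ne_zero) h2)

/-! ### Adapted bases and the torsion of an acyclic complex -/

section Adapted

variable {ι ε : ℤ → Type*}

/-- The family in degree `m` consisting of the coboundaries `d y` for `y` in degree `m - 1`, the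
elements `e` and the elements `y`. -/
def adaptedFamily (X : RealComplex.{u}) (y : ∀ n, ι n → X.X n) (e : ∀ n, ε n → X.X n) (m : ℤ) :
    ι (m - 1) ⊕ (ε m ⊕ ι m) → X.X m :=
  Sum.elim (fun i => (X.d (m - 1) m).hom (y (m - 1) i)) (Sum.elim (e m) (y m))

/-- A basis adapted to the differential: the elements `e` are cocycles, and together with the
elements `y` and their coboundaries they form bases in all degrees. -/
structure IsAdapted (X : RealComplex.{u}) (y : ∀ n, ι n → X.X n) (e : ∀ n, ε n → X.X n) :
    Prop where
  d_e : ∀ n m j, (X.d n m).hom (e n j) = 0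
  basis : ∀ m, BasisOf (adaptedFamily X y e m) ⊤

/-- The alternating sum of the logarithmic volumes of an adapted basis. -/
noncomputable def adaptedVol (X : HilbertComplex.{u}) [∀ n, Finite (ι n)] [∀ n, Finite (ε n)]
    (y : ∀ n, ι n → X.cx.X n) (e : ∀ n, ε n → X.cx.X n) : ℝ :=
  ∑ᶠ n : ℤ, (-1 : ℝ) ^ n * (X.hilbert n).logVol (adaptedFamily X.cx y e n)

variable {X : RealComplex.{u}} {y : ∀ n, ι n → X.X n} {e : ∀ n, ε n → X.X n}

theorem d_d_apply (X : RealComplex.{u}) (l n m : ℤ) (x : X.X l) :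
    (X.d n m).hom ((X.d l n).hom x) = 0 :=
  congrArg (fun g => g.hom x) (X.d_comp_d l n m)

namespace IsAdapted

theorem range_d_le (h : IsAdapted X y e) (m n : ℤ) (x : X.X m) :
    (X.d m n).hom x ∈ Submodule.span ℝ (Set.range fun i => (X.d m n).hom (y m i)) := by
  have h1 : x ∈ Submodule.span ℝ (Set.range (adaptedFamily X y e m)) := by
    rw [(h.basis m).span]; trivial
  have h2 := Submodule.mem_map_of_mem (f := (X.d m n).hom) h1
  rw [← Submodule.span_image] at h2
  refine Submodule.span_le.2 ?_ h2
  rintro _ ⟨_, ⟨i | i | i, rfl⟩, rfl⟩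
  · change (X.d m n).hom ((X.d (m - 1) m).hom _) ∈ _
    rw [d_d_apply]; exact zero_mem _
  · change (X.d m n).hom (e m i) ∈ _
    rw [h.d_e]; exact zero_mem _
  · exact Submodule.subset_span ⟨i, rfl⟩

theorem li_d (h : IsAdapted X y e) {m n : ℤ} (hmn : m + 1 = n) :
    LinearIndependent ℝ fun i => (X.d m n).hom (y m i) := by
  obtain rfl : m = n - 1 := by omega
  exact (linearIndependent_sum.1 (h.basis n).li).1

theorem acyclic [∀ n, IsEmpty (ε n)] (h : IsAdapted X y e) (l n m : ℤ) (hl : l + 1 = n)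
    (hm : n + 1 = m) (x : X.X n) (hx : (X.d n m).hom x = 0) : ∃ z, (X.d l n).hom z = x := by
  obtain rfl : l = n - 1 := by omega
  have h1 : x ∈ Submodule.span ℝ (Set.range (adaptedFamily X y e n)) := by
    rw [(h.basis n).span]; trivial
  rw [adaptedFamily, Set.Sum.elim_range, Set.Sum.elim_range, Set.range_eq_empty (e n),
    Set.empty_union, Submodule.span_union, Submodule.mem_sup] at h1
  obtain ⟨a, ha, b, hb, rfl⟩ := h1
  obtain ⟨z, rfl⟩ : ∃ z, (X.d (n - 1) n).hom z = a := by
    have : Submodule.span ℝ (Set.range fun i => (X.d (n - 1) n).hom (y (n - 1) i)) ≤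
        LinearMap.range (X.d (n - 1) n).hom := by
      rw [Submodule.span_le]
      rintro _ ⟨i, rfl⟩
      exact ⟨_, rfl⟩
    exact this ha
  rw [map_add, d_d_apply, zero_add] at hx
  have h2 : b = 0 :=
    Submodule.disjoint_def.1 (Submodule.range_ker_disjoint (f := (X.d n m).hom) (h.li_d hm))
      b hb hx
  exact ⟨z, by rw [h2, add_zero]⟩

end IsAdapted

open Classical in
/-- The members of an adapted basis of an acyclic complex that lie in degrees with a given parity,
indexed by the elements `y`: if `y` itself does not have the right degree, then `d y` does. -/
noncomputable def parityFamily (X : RealComplex.{u}) (y : ∀ n, ι n → X.X n) (P : ℤ → Prop)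
    (hP : ∀ m, P (m + 1) ↔ ¬ P m) (x : Σ m, ι m) (n : {n // P n}) : X.X n.1 :=
  if h : P x.1 then (Pi.single ⟨x.1, h⟩ (y x.1 x.2) : ∀ n : {n // P n}, X.X n.1) n
  else (Pi.single ⟨x.1 + 1, (hP _).2 h⟩ ((X.d x.1 (x.1 + 1)).hom (y x.1 x.2)) :
    ∀ n : {n // P n}, X.X n.1) n

theorem parityFamily_of_pos {P : ℤ → Prop} (hP : ∀ m, P (m + 1) ↔ ¬ P m) (m : ℤ) (h : P m)
    (j : ι m) : parityFamily X y P hP ⟨m, j⟩ =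
      (Pi.single ⟨m, h⟩ (y m j) : ∀ n : {n // P n}, X.X n.1) := by
  funext n
  unfold parityFamily
  rw [dif_pos h]

theorem parityFamily_of_neg {P : ℤ → Prop} (hP : ∀ m, P (m + 1) ↔ ¬ P m) (m n : ℤ)
    (hn : m + 1 = n) (h : P n) (j : ι m) : parityFamily X y P hP ⟨m, j⟩ =
      (Pi.single ⟨n, h⟩ ((X.d m n).hom (y m j)) : ∀ n : {n // P n}, X.X n.1) := by
  subst hn
  funext n
  unfold parityFamily
  rw [dif_neg ((hP m).1 h)]

/-- The bijection between the adapted bases in the degrees of a given parity and the set of all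
elements `y`. -/
theorem exists_parityEquiv [∀ n, IsEmpty (ε n)] {P : ℤ → Prop} (hP : ∀ m, P (m + 1) ↔ ¬ P m) :
    ∃ f : (Σ n : {n // P n}, ι (n.1 - 1) ⊕ (ε n.1 ⊕ ι n.1)) ≃ (Σ m, ι m),
      ∀ (X : RealComplex.{u}) (y : ∀ n, ι n → X.X n) (e : ∀ n, ε n → X.X n) x,
        (Pi.single x.1 (adaptedFamily X y e x.1.1 x.2) : ∀ n : {n // P n}, X.X n.1) =
          parityFamily X y P hP (f x) := by
  have hP' : ∀ n, P n → ¬ P (n - 1) := fun n hn => (hP (n - 1)).1 (by rwa [sub_add_cancel])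
  let f : (Σ n : {n // P n}, ι (n.1 - 1) ⊕ (ε n.1 ⊕ ι n.1)) → (Σ m, ι m) := fun x =>
    Sum.elim (fun j => ⟨x.1.1 - 1, j⟩) (Sum.elim isEmptyElim fun j => ⟨x.1.1, j⟩) x.2
  have hf : Function.Bijective f := by
    constructor
    · rintro ⟨⟨n, hn⟩, i | i | i⟩ ⟨⟨m, hm⟩, j | j | j⟩ hij
      · simp only [f, Sum.elim_inl, Sigma.mk.injEq] at hij
        obtain ⟨h1, h2⟩ := hij
        obtain rfl : n = m := by omega
        rw [eq_of_heq h2]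
      · exact isEmptyElim j
      · simp only [f, Sum.elim_inl, Sum.elim_inr, Sigma.mk.injEq] at hij
        exact absurd (hij.1 ▸ hm) (hP' n hn)
      · exact isEmptyElim i
      · exact isEmptyElim i
      · exact isEmptyElim i
      · simp only [f, Sum.elim_inl, Sum.elim_inr, Sigma.mk.injEq] at hij
        exact absurd (hij.1 ▸ hn) (hP' m hm)
      · exact isEmptyElim j
      · simp only [f, Sum.elim_inr, Sigma.mk.injEq] at hij
        obtain ⟨rfl, h2⟩ := hij
        rw [eq_of_heq h2]
    · rintro ⟨m, j⟩
      by_cases h : P m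
      · exact ⟨⟨⟨m, h⟩, Sum.inr (Sum.inr j)⟩, rfl⟩
      · obtain ⟨n, rfl⟩ : ∃ n, m = n - 1 := ⟨m + 1, by omega⟩
        exact ⟨⟨⟨n, by simpa using (hP (n - 1)).2 h⟩, Sum.inl j⟩, rfl⟩
  refine ⟨Equiv.ofBijective f hf, fun X y e x => ?_⟩
  obtain ⟨⟨n, hn⟩, i | i | i⟩ := x
  · exact (parityFamily_of_neg hP (n - 1) n (sub_add_cancel n 1) hn i).symm
  · exact isEmptyElim i
  · exact (parityFamily_of_pos hP n hn i).symm

theorem finite_sigma (X : HilbertComplex.{u}) [∀ n, Finite (ι n)]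
    {y : ∀ n, ι n → X.cx.X n} {e : ∀ n, ε n → X.cx.X n} (h : IsAdapted X.cx y e) :
    Finite (Σ m, ι m) := by
  obtain ⟨N, hN⟩ := X.bounded
  have hfin : {m : ℤ | ¬ (N : ℤ) ≤ |m|}.Finite :=
    (Set.finite_Icc (-(N : ℤ)) N).subset fun n hn => abs_le.1 (not_le.1 hn).le
  have : Finite {m : ℤ | ¬ (N : ℤ) ≤ |m|} := hfin
  refine Finite.of_injective (β := Σ m : {m : ℤ | ¬ (N : ℤ) ≤ |m|}, ι m.1)
    (fun x => ⟨⟨x.1, fun h0 => ?_⟩, x.2⟩) fun x x' hx => ?_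
  · have := hN x.1 h0
    have h1 := (h.basis x.1).isEmpty
    exact h1.false (Sum.inr (Sum.inr x.2))
  · obtain ⟨m, j⟩ := x
    obtain ⟨m', j'⟩ := x'
    simp only [Sigma.mk.injEq, Subtype.mk.injEq] at hx
    obtain ⟨rfl, hx⟩ := hx
    rw [eq_of_heq hx]

/-- The parity family is an adapted basis of the sum of the degrees of the given parity, up to
reindexing, so its volume is the sum of the volumes in these degrees. -/
theorem parityFamily_basis [∀ n, IsEmpty (ε n)] (X : HilbertComplex.{u}) [∀ n, Finite (ι n)]
    {y : ∀ n, ι n → X.cx.X n} {e : ∀ n, ε n → X.cx.X n} (h : IsAdapted X.cx y e)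
    [Finite (Σ m, ι m)]
    {P : ℤ → Prop} (hP : ∀ m, P (m + 1) ↔ ¬ P m) :
    BasisOf (parityFamily X.cx y P hP) ⊤ ∧
      (HilbertStructure.pi (fun n : {n // P n} => X.hilbert n.1) X.finite_nonzero).logVol
        (parityFamily X.cx y P hP) =
      ∑ᶠ n : {n // P n}, (X.hilbert n.1).logVol (adaptedFamily X.cx y e n.1) := by
  obtain ⟨f, hf⟩ := exists_parityEquiv (ι := ι) (ε := ε) hP
  have hfin : Finite (Σ n : {n // P n}, ι (n.1 - 1) ⊕ (ε n.1 ⊕ ι n.1)) := Finite.of_equiv _ f.symm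
  have h1 := basisOf_pi (X.finite_nonzero (P := P)) (fun n => adaptedFamily X.cx y e n.1)
    fun n => h.basis n.1
  have h2 : (fun x : Σ n : {n // P n}, ι (n.1 - 1) ⊕ (ε n.1 ⊕ ι n.1) =>
      (Pi.single x.1 (adaptedFamily X.cx y e x.1.1 x.2) : ∀ n : {n // P n}, X.cx.X n.1)) =
      parityFamily X.cx y P hP ∘ f := funext (hf X.cx y e)
  refine ⟨?_, ?_⟩
  · rw [h2] at h1
    have h3 := h1.comp_equiv f.symm
    rwa [Function.comp_assoc, Equiv.self_comp_symm, Function.comp_id] at h3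
  · rw [← logVol_pi (fun n : {n // P n} => X.hilbert n.1) X.finite_nonzero
      (fun n => adaptedFamily X.cx y e n.1) fun n => h.basis n.1, h2,
      HilbertStructure.logVol_comp_equiv]

end Adapted

theorem evenToOdd_single (X : HilbertComplex.{u}) (γ : Homotopy (𝟙 X.cx) 0) {l n m : ℤ}
    (hl : l + 1 = n) (hm : n + 1 = m) (hn : Even n) (hlo : Odd l) (hmo : Odd m) (v : X.cx.X n) :
    X.evenToOdd γ (Pi.single ⟨n, hn⟩ v : X.EvenPart) =
      (Pi.single ⟨m, hmo⟩ ((X.cx.d n m).hom v) + Pi.single ⟨l, hlo⟩ ((γ.hom n l).hom v) :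
        X.OddPart) := by
  funext ⟨k, hk⟩
  change (X.cx.d (k - 1) k).hom ((Pi.single ⟨n, hn⟩ v : X.EvenPart) ⟨k - 1, _⟩) +
    (γ.hom (k + 1) k).hom ((Pi.single ⟨n, hn⟩ v : X.EvenPart) ⟨k + 1, _⟩) =
    (Pi.single ⟨m, hmo⟩ ((X.cx.d n m).hom v) : X.OddPart) ⟨k, hk⟩ +
    (Pi.single ⟨l, hlo⟩ ((γ.hom n l).hom v) : X.OddPart) ⟨k, hk⟩
  congr 1
  · by_cases h : k = m
    · subst h
      obtain rfl : n = k - 1 := by omega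
      rw [Pi.single_eq_same, Pi.single_eq_same]
    · rw [Pi.single_eq_of_ne (i' := ⟨k, hk⟩) fun h0 => h (congrArg Subtype.val h0),
        Pi.single_eq_of_ne, map_zero]
      intro h0
      have : k - 1 = n := congrArg Subtype.val h0
      omega
  · by_cases h : k = l
    · subst h
      subst hl
      rw [Pi.single_eq_same, Pi.single_eq_same]
    · rw [Pi.single_eq_of_ne (i' := ⟨k, hk⟩) fun h0 => h (congrArg Subtype.val h0),
        Pi.single_eq_of_ne, map_zero]
      intro h0
      have : k + 1 = n := congrArg Subtype.val h0
      omega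

theorem finsum_even_sub_odd (f : ℤ → ℝ) (hf : (Function.support f).Finite) :
    ∑ᶠ n : ℤ, (-1 : ℝ) ^ n * f n =
      ∑ᶠ n : {n : ℤ // Even n}, f n.1 - ∑ᶠ n : {n : ℤ // Odd n}, f n.1 := by
  have h1 : ∑ᶠ n : {n : ℤ // Even n}, f n.1 = ∑ᶠ n : ℤ, Set.indicator {n | Even n} f n :=
    (finsum_mem_def {n : ℤ | Even n} f).symm ▸ finsum_subtype_eq_finsum_cond Even
  have h2 : ∑ᶠ n : {n : ℤ // Odd n}, f n.1 = ∑ᶠ n : ℤ, Set.indicator {n | Odd n} f n :=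
    (finsum_mem_def {n : ℤ | Odd n} f).symm ▸ finsum_subtype_eq_finsum_cond Odd
  rw [h1, h2, ← finsum_sub_distrib]
  · refine finsum_congr fun n => ?_
    rcases Int.even_or_odd n with h | h
    · have : ¬ Odd n := by simpa using h
      simp [Set.indicator, h, this, h.neg_one_zpow]
    · have : ¬ Even n := by simpa using h
      simp [Set.indicator, h, this, h.neg_one_zpow]
  · exact hf.subset fun n hn => by
      simp only [Function.mem_support, Set.indicator_apply_ne_zero] at hn; exact hn.2
  · exact hf.subset fun n hn => by
      simp only [Function.mem_support, Set.indicator_apply_ne_zero] at hn; exact hn.2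

theorem finite_support_logVol {ι ε : ℤ → Type*} (X : HilbertComplex.{u}) [∀ n, Finite (ι n)]
    [∀ n, Finite (ε n)] {y : ∀ n, ι n → X.cx.X n} {e : ∀ n, ε n → X.cx.X n}
    (h : IsAdapted X.cx y e) :
    (Function.support fun n => (X.hilbert n).logVol (adaptedFamily X.cx y e n)).Finite := by
  obtain ⟨N, hN⟩ := X.bounded
  refine (Set.finite_Icc (-(N : ℤ)) N).subset fun n hn => ?_
  by_contra h0
  have h1 : (N : ℤ) ≤ |n| := by
    by_contra h2
    exact h0 (abs_le.1 (not_le.1 h2).le)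
  have := hN n h1
  have := (h.basis n).isEmpty
  exact hn ((X.hilbert n).logVol_of_isEmpty _)

section AcyclicTorsion

variable {ι ε : ℤ → Type*}

/-- The map `c + γ` sends every member of the even parity family to the member of the odd one with
the same index, up to members with an index of smaller degree. Indeed, for `y` of even degree,
`(c + γ) y = d y + γ y`, and for `y` of odd degree, `(c + γ) (d y) = γ d y = y - d γ y`. -/
theorem evenToOdd_triangular [∀ n, IsEmpty (ε n)] (X : HilbertComplex.{u})
    {y : ∀ n, ι n → X.cx.X n} {e : ∀ n, ε n → X.cx.X n} (h : IsAdapted X.cx y e)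
    (γ : Homotopy (𝟙 X.cx) 0) (hE : ∀ m : ℤ, Even (m + 1) ↔ ¬ Even m)
    (hO : ∀ m : ℤ, Odd (m + 1) ↔ ¬ Odd m) (x : Σ m, ι m) :
    X.evenToOdd γ (parityFamily X.cx y Even hE x) - parityFamily X.cx y Odd hO x ∈
      Submodule.span ℝ (parityFamily X.cx y Odd hO '' {x' | x'.1 < x.1}) := by
  obtain ⟨m, j⟩ := x
  by_cases hm : Even m
  · have hl : Odd (m - 1) := hm.sub_odd odd_one
    have hmo : Odd (m + 1) := hm.add_odd odd_one
    rw [parityFamily_of_pos hE m hm, evenToOdd_single X γ (sub_add_cancel m 1) rfl hm hl hmo,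
      parityFamily_of_neg hO m (m + 1) rfl hmo, add_sub_cancel_left]
    generalize (γ.hom m (m - 1)).hom (y m j) = v
    have hv : v ∈ Submodule.span ℝ (Set.range (adaptedFamily X.cx y e (m - 1))) := by
      rw [(h.basis (m - 1)).span]; trivial
    have h2 := Submodule.mem_map_of_mem
      (f := LinearMap.single ℝ (fun n : {n : ℤ // Odd n} => X.cx.X n.1) ⟨m - 1, hl⟩) hv
    rw [← Submodule.span_image] at h2
    refine Submodule.span_mono ?_ h2
    rintro _ ⟨_, ⟨i | i | i, rfl⟩, rfl⟩
    · refine ⟨⟨m - 1 - 1, i⟩, ?_, ?_⟩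
      · change m - 1 - 1 < m
        omega
      · exact parityFamily_of_neg hO _ (m - 1) (by omega) hl i
    · exact isEmptyElim i
    · refine ⟨⟨m - 1, i⟩, ?_, ?_⟩
      · change m - 1 < m
        omega
      · exact parityFamily_of_pos hO _ hl i
  · have hm' : Odd m := by simpa using hm
    have hm1 : Even (m + 1) := (hE m).2 hm
    have hm2 : Odd (m + 1 + 1) := hm1.add_odd odd_one
    rw [parityFamily_of_neg hE m (m + 1) rfl hm1,
      evenToOdd_single X γ rfl rfl hm1 hm' hm2, d_d_apply, Pi.single_zero, zero_add,
      parityFamily_of_pos hO m hm', ← Pi.single_sub]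
    have h1 := contraction_apply γ (sub_add_cancel m 1) rfl (y m j)
    have h2 : (γ.hom (m + 1) m).hom ((X.cx.d m (m + 1)).hom (y m j)) - y m j =
        - (X.cx.d (m - 1) m).hom ((γ.hom m (m - 1)).hom (y m j)) := by
      rw [sub_eq_iff_eq_add, neg_add_eq_sub, eq_sub_iff_add_eq, add_comm]; exact h1
    rw [h2, Pi.single_neg]
    refine neg_mem ?_
    have h3 := Submodule.mem_map_of_mem
      (f := LinearMap.single ℝ (fun n : {n : ℤ // Odd n} => X.cx.X n.1) ⟨m, hm'⟩)
      (h.range_d_le (m - 1) m ((γ.hom m (m - 1)).hom (y m j)))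
    rw [← Submodule.span_image] at h3
    refine Submodule.span_mono ?_ h3
    rintro _ ⟨_, ⟨i, rfl⟩, rfl⟩
    refine ⟨⟨m - 1, i⟩, ?_, ?_⟩
    · change m - 1 < m
      omega
    · exact parityFamily_of_neg hO _ m (by omega) hm' i

/-- The torsion of an acyclic complex is the alternating sum of the volumes of an adapted basis:
with respect to this basis, `c + γ` is unipotent and triangular. -/
theorem acyclicTorsion_eq [∀ n, IsEmpty (ε n)] [∀ n, Finite (ι n)] (X : HilbertComplex.{u})
    {y : ∀ n, ι n → X.cx.X n} {e : ∀ n, ε n → X.cx.X n} (h : IsAdapted X.cx y e) :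
    X.acyclicTorsion = - adaptedVol X y e := by
  have hE : ∀ m : ℤ, Even (m + 1) ↔ ¬ Even m := fun m => by
    rw [Int.even_add_one]
  have hO : ∀ m : ℤ, Odd (m + 1) ↔ ¬ Odd m := fun m => by
    rw [← Int.not_even_iff_odd, ← Int.not_even_iff_odd, Int.even_add_one]
  have hne : Nonempty (Homotopy (𝟙 X.cx) 0) := nonempty_contraction X.cx h.acyclic
  have := finite_sigma X h
  rw [HilbertComplex.acyclicTorsion, dif_pos hne]
  generalize hne.some = γ
  obtain ⟨h1, h2⟩ := parityFamily_basis X h hE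
  obtain ⟨h3, h4⟩ := parityFamily_basis X h hO
  have h5 : X.oddHilbert.logVol (X.evenToOdd γ ∘ parityFamily X.cx y Even hE) =
      X.oddHilbert.logVol (parityFamily X.cx y Odd hO) :=
    X.oddHilbert.logVol_triangular _ _ (fun x => x.1) (evenToOdd_triangular X h γ hE hO)
  have h6 : LinearIndependent ℝ (X.evenToOdd γ ∘ parityFamily X.cx y Even hE) :=
    linearIndependent_triangular (fun x => x.1) (evenToOdd_triangular X h γ hE hO) h3.li
  have h7 : Function.Injective (X.evenToOdd γ) := by
    rw [← LinearMap.ker_eq_bot, ← top_disjoint, ← h1.span]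
    exact Submodule.range_ker_disjoint h6
  rw [bracket_eq _ _ _ h7 h1, h5]
  have h8 := finsum_even_sub_odd _ (finite_support_logVol X h)
  rw [adaptedVol, h8, ← h2, ← h4, neg_sub]
  rfl

end AcyclicTorsion

/-! ### The torsion of a chain homotopy equivalence -/

theorem BasisOf.sign {V ι : Type*} [AddCommGroup V] [Module ℝ V] {v : ι → V} {S : Submodule ℝ V}
    (h : BasisOf v S) (s : ι → ℝ) (hs : ∀ i, |s i| = 1) : BasisOf (fun i => s i • v i) S := by
  have h0 : ∀ i, s i ≠ 0 := fun i h0 => by simpa [h0] using hs i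
  constructor
  · exact h.li.units_smul fun i => Units.mk0 (s i) (h0 i)
  · rw [← h.span]
    refine le_antisymm (Submodule.span_le.2 ?_) (Submodule.span_le.2 ?_)
    · rintro _ ⟨i, rfl⟩
      exact Submodule.smul_mem _ _ (Submodule.subset_span ⟨i, rfl⟩)
    · rintro _ ⟨i, rfl⟩
      have h1 := Submodule.smul_mem _ (s i)⁻¹
        (Submodule.subset_span (R := ℝ) (s := Set.range fun i => s i • v i) ⟨i, rfl⟩)
      rwa [smul_smul, inv_mul_cancel₀ (h0 i), one_smul] at h1

theorem BasisOf.sup {V ι κ : Type*} [AddCommGroup V] [Module ℝ V] {v : ι → V} {w : κ → V}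
    {A B : Submodule ℝ V} (hv : BasisOf v A) (hw : BasisOf w B) (hAB : Disjoint A B) :
    BasisOf (Sum.elim v w) (A ⊔ B) := by
  refine ⟨hv.li.sum_type hw.li (by rwa [hv.span, hw.span]), ?_⟩
  rw [Set.Sum.elim_range, Submodule.span_union, hv.span, hw.span]

section Cone

variable {ιC ιD ε : ℤ → Type*} {C D : HilbertComplex.{u}} (f : C.cx ⟶ D.cx)
  (yC : ∀ n, ιC n → C.cx.X n) (eC : ∀ n, ε n → C.cx.X n) (yD : ∀ n, ιD n → D.cx.X n)
  (eD : ∀ n, ε n → D.cx.X n) (w : ∀ n, ε n → D.cx.X (n - 1))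

/-- The adapted basis of the cone of `f` obtained from adapted bases of `C` and `D` for which
`f e_C = e_D + d w`. -/
def coneFamily (n : ℤ) : ιC n ⊕ (ε n ⊕ ιD (n - 1)) → (HilbertComplex.coneCx f).X n :=
  Sum.elim (fun j => ((yC n j, 0) : C.cx.X n × D.cx.X (n - 1)))
    (Sum.elim (fun j => ((eC n j, w n j) : C.cx.X n × D.cx.X (n - 1)))
      fun j => ((0, yD (n - 1) j) : C.cx.X n × D.cx.X (n - 1)))

theorem coneCx_d_apply (m : ℤ) (x : C.cx.X (m - 1)) (z : D.cx.X (m - 1 - 1)) :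
    ((HilbertComplex.coneCx f).d (m - 1) m).hom ((x, z) : C.cx.X (m - 1) × D.cx.X (m - 1 - 1)) =
      (((C.cx.d (m - 1) m).hom x, (f.f (m - 1)).hom x - (D.cx.d (m - 1 - 1) (m - 1)).hom z) :
        C.cx.X m × D.cx.X (m - 1)) := by
  have h1 : (HilbertComplex.coneCx f).d (m - 1) m = ModuleCat.ofHom
      (LinearMap.prod ((C.cx.d (m - 1) m).hom ∘ₗ LinearMap.fst ℝ _ _)
        ((HilbertComplex.component f (m - 1) (m - 1) rfl).hom ∘ₗ LinearMap.fst ℝ _ _ -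
          (D.cx.d (m - 1 - 1) (m - 1)).hom ∘ₗ LinearMap.snd ℝ _ _)) :=
    dif_pos (sub_add_cancel m 1)
  have h2 : HilbertComplex.component f (m - 1) (m - 1) rfl = f.f (m - 1) :=
    Category.comp_id _
  rw [h1, h2]
  rfl

/-- The bijection between the index types of the adapted bases of a cone and its two summands. -/
def coneIndexEquiv (A A' B B' E E' : Type*) :
    (B ⊕ (E ⊕ B')) ⊕ (A ⊕ (E' ⊕ A')) ≃ (A ⊕ (E ⊕ B)) ⊕ (PEmpty.{1} ⊕ (A' ⊕ (E' ⊕ B'))) where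
  toFun := Sum.elim
    (Sum.elim (fun b => .inl (.inr (.inr b)))
      (Sum.elim (fun e => .inl (.inr (.inl e))) fun b => .inr (.inr (.inr (.inr b)))))
    (Sum.elim (fun a => .inl (.inl a))
      (Sum.elim (fun e => .inr (.inr (.inr (.inl e)))) fun a => .inr (.inr (.inl a))))
  invFun := Sum.elim
    (Sum.elim (fun a => .inr (.inl a))
      (Sum.elim (fun e => .inl (.inr (.inl e))) fun b => .inl (.inl b)))
    (Sum.elim (fun x => x.elim)
      (Sum.elim (fun a => .inr (.inr (.inr a)))
        (Sum.elim (fun e => .inr (.inr (.inl e))) fun b => .inl (.inr (.inr b)))))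
  left_inv := by rintro ((b | e | b) | (a | e | a)) <;> rfl
  right_inv := by rintro ((a | e | b) | (x | a | e | b)) <;> first | rfl | exact x.elim

theorem pempty_finite (_ : ℤ) : Finite PEmpty.{1} := inferInstance

variable {f yC eC yD eD w}

theorem coneFamily_isAdapted (hC : IsAdapted C.cx yC eC) (hD : IsAdapted D.cx yD eD)
    (hw : ∀ n j, (f.f n).hom (eC n j) = eD n j + (D.cx.d (n - 1) n).hom (w n j)) (m : ℤ) :
    BasisOf (adaptedFamily (HilbertComplex.coneCx f) (ε := fun _ => PEmpty.{1})
      (coneFamily f yC eC yD w) (fun _ x => x.elim) m) ⊤ ∧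
    ∀ [∀ n, Finite (ιC n)] [∀ n, Finite (ιD n)] [∀ n, Finite (ε n)],
      ((HilbertComplex.cone f).hilbert m).logVol
          (adaptedFamily (HilbertComplex.coneCx f) (ε := fun _ => PEmpty.{1})
            (coneFamily f yC eC yD w) (fun _ x => x.elim) m) =
        (C.hilbert m).logVol (adaptedFamily C.cx yC eC m) +
          (D.hilbert (m - 1)).logVol (adaptedFamily D.cx yD eD (m - 1)) := by
  let X := C.cx.X m
  let Y := D.cx.X (m - 1)
  let s : ιD (m - 1 - 1) ⊕ (ε (m - 1) ⊕ ιD (m - 1)) → ℝ := Sum.elim (fun _ => -1) fun _ => 1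
  have hs : ∀ i, |s i| = 1 := by rintro (i | i) <;> simp [s]
  let v : ιD (m - 1 - 1) ⊕ (ε (m - 1) ⊕ ιD (m - 1)) → X × Y := fun i =>
    LinearMap.inr ℝ X Y (s i • adaptedFamily D.cx yD eD (m - 1) i)
  let u : ιC (m - 1) ⊕ (ε m ⊕ ιC m) → X × Y :=
    Sum.elim (fun i => ((C.cx.d (m - 1) m).hom (yC (m - 1) i), (f.f (m - 1)).hom (yC (m - 1) i)))
      (Sum.elim (fun j => (eC m j, w m j)) fun j => (yC m j, 0))
  let e := coneIndexEquiv (ιC (m - 1)) (ιC m) (ιD (m - 1 - 1)) (ιD (m - 1)) (ε (m - 1)) (ε m)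
  have he : ∀ i, Sum.elim v u i = adaptedFamily (HilbertComplex.coneCx f) (ε := fun _ => PEmpty.{1})
      (coneFamily f yC eC yD w) (fun _ x => x.elim) m (e i) := by
    rintro ((b | j | b) | (a | j | a))
    · refine Eq.trans ?_ (coneCx_d_apply f m 0 (yD (m - 1 - 1) b)).symm
      rw [map_zero, map_zero, zero_sub]
      change (0, (-1 : ℝ) • (D.cx.d (m - 1 - 1) (m - 1)).hom (yD (m - 1 - 1) b)) = _
      rw [neg_one_smul]
    · refine Eq.trans ?_ (coneCx_d_apply f m (eC (m - 1) j) (w (m - 1) j)).symm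
      rw [hC.d_e, hw, add_sub_cancel_right]
      change (0, (1 : ℝ) • eD (m - 1) j) = _
      rw [one_smul]
    · change (0, (1 : ℝ) • yD (m - 1) b) = _
      rw [one_smul]
      rfl
    · refine Eq.trans ?_ (coneCx_d_apply f m (yC (m - 1) a) 0).symm
      rw [map_zero, sub_zero]
      rfl
    · rfl
    · rfl
  have hu : LinearMap.fst ℝ X Y ∘ u = adaptedFamily C.cx yC eC m := by
    funext i
    rcases i with i | i | i <;> rfl
  have hker : LinearMap.ker (LinearMap.fst ℝ X Y) = LinearMap.range (LinearMap.inr ℝ X Y) :=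
    LinearMap.ker_fst ℝ X Y
  have hv : BasisOf v (LinearMap.ker (LinearMap.fst ℝ X Y)) := by
    rw [hker]
    exact ((hD.basis (m - 1)).sign s hs).map_top _ LinearMap.inr_injective
  have hu' : BasisOf (LinearMap.fst ℝ X Y ∘ u) (LinearMap.range (LinearMap.fst ℝ X Y)) := by
    rw [hu, LinearMap.range_eq_top.2 LinearMap.fst_surjective]
    exact hC.basis m
  constructor
  · have h1 := (hv.sumElim _ hu').comp_equiv e.symm
    have h2 : Sum.elim v u ∘ e.symm =
        adaptedFamily (HilbertComplex.coneCx f) (ε := fun _ => PEmpty.{1})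
      (coneFamily f yC eC yD w) (fun _ x => x.elim) m := by
      funext i
      rw [Function.comp_apply, he, e.apply_symm_apply]
    rwa [h2] at h1
  · intro _ _ _
    have h1 := ((C.hilbert m).prod (D.hilbert (m - 1))).logVol_sumElim (C.hilbert m)
      (LinearMap.fst ℝ X Y) (HilbertStructure.isCoisometry_fst _ _) v u hv hu'.li
    rw [hu] at h1
    have h2 := HilbertStructure.logVol_congr ((HilbertComplex.cone f).hilbert m) e he
    rw [← h2]
    refine h1.trans ?_
    rw [add_comm]
    congr 1
    have h3 : ∀ x y : Y, ((C.hilbert m).prod (D.hilbert (m - 1))).ip (LinearMap.inr ℝ X Y x)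
        (LinearMap.inr ℝ X Y y) = (D.hilbert (m - 1)).ip x y := fun x y => by
      change (C.hilbert m).ip 0 0 + _ = _
      rw [← HilbertStructure.form_apply, map_zero, zero_add]
      rfl
    refine Eq.trans ?_ ((D.hilbert (m - 1)).logVol_sign _ s hs)
    have h4 : ((C.hilbert m).prod (D.hilbert (m - 1))).gram v = (D.hilbert (m - 1)).gram
        (fun i => s i • adaptedFamily D.cx yD eD (m - 1) i) := by
      ext i j
      exact h3 _ _
    unfold HilbertStructure.logVol
    rw [h4]

theorem finsum_neg_one_shift (φ : ℤ → ℝ) :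
    ∑ᶠ n : ℤ, (-1 : ℝ) ^ n * φ (n - 1) = - ∑ᶠ n : ℤ, (-1 : ℝ) ^ n * φ n := by
  rw [← finsum_comp_equiv (Equiv.addRight (1 : ℤ)), ← finsum_neg_distrib]
  refine finsum_congr fun n => ?_
  rw [Equiv.coe_addRight, add_sub_cancel_right, zpow_add_one₀ (by norm_num)]
  ring

theorem finsum_neg_one_add {φ ψ : ℤ → ℝ} (hφ : (Function.support φ).Finite)
    (hψ : (Function.support ψ).Finite) :
    ∑ᶠ n : ℤ, (-1 : ℝ) ^ n * (φ n + ψ n) =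
      ∑ᶠ n : ℤ, (-1 : ℝ) ^ n * φ n + ∑ᶠ n : ℤ, (-1 : ℝ) ^ n * ψ n := by
  rw [← finsum_add_distrib]
  · exact finsum_congr fun n => mul_add _ _ _
  · exact hφ.subset fun n hn h0 => hn (by simp only [h0, mul_zero])
  · exact hψ.subset fun n hn h0 => hn (by simp only [h0, mul_zero])

/-- The torsion of a map which matches the cohomology parts of adapted bases of source and target
up to coboundaries. -/
theorem equivTorsion_eq [∀ n, Finite (ιC n)] [∀ n, Finite (ιD n)] [∀ n, Finite (ε n)]
    (hC : IsAdapted C.cx yC eC) (hD : IsAdapted D.cx yD eD)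
    (hw : ∀ n j, ∃ w, (f.f n).hom (eC n j) = eD n j + (D.cx.d (n - 1) n).hom w) :
    HilbertComplex.equivTorsion f = adaptedVol D yD eD - adaptedVol C yC eC := by
  choose w hw using hw
  have h1 := coneFamily_isAdapted hC hD hw
  have : ∀ n, Finite ((fun _ : ℤ => PEmpty.{1}) n) := pempty_finite
  have : ∀ n, IsEmpty ((fun _ : ℤ => PEmpty.{1}) n) := fun _ => inferInstanceAs (IsEmpty PEmpty)
  have h2 : IsAdapted (HilbertComplex.cone f).cx (ε := fun _ => PEmpty.{1})
      (coneFamily f yC eC yD w) (fun _ x => x.elim) :=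
    ⟨fun n m j => j.elim, fun m => (h1 m).1⟩
  have h3 : (Function.support fun n => (D.hilbert (n - 1)).logVol
      (adaptedFamily D.cx yD eD (n - 1))).Finite :=
    (finite_support_logVol D hD).preimage (sub_left_injective (b := (1 : ℤ))).injOn
  have h4 : adaptedVol (HilbertComplex.cone f) (ε := fun _ => PEmpty.{1})
      (coneFamily f yC eC yD w) (fun _ x => x.elim) = ∑ᶠ n : ℤ, (-1 : ℝ) ^ n *
        ((C.hilbert n).logVol (adaptedFamily C.cx yC eC n) +
          (D.hilbert (n - 1)).logVol (adaptedFamily D.cx yD eD (n - 1))) :=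
    finsum_congr fun n => congrArg ((-1 : ℝ) ^ n * ·) ((h1 n).2)
  rw [HilbertComplex.equivTorsion, acyclicTorsion_eq _ h2, h4,
    finsum_neg_one_add (finite_support_logVol C hC) h3,
    finsum_neg_one_shift fun n => (D.hilbert n).logVol (adaptedFamily D.cx yD eD n)]
  simp only [adaptedVol]
  ring

end Cone

/-! ### Adapted bases and cohomology -/

/-- Every basis of the cohomology can be completed to an adapted basis. -/
theorem exists_isAdapted (X : RealComplex.{u}) {ε : ℤ → Type*} (η : ∀ n, ε n → X.homology n)
    (hη : ∀ n, BasisOf (η n) ⊤) :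
    ∃ (ι : ℤ → Type u) (y : ∀ n, ι n → X.X n) (e : ∀ n, ε n → X.X n), IsAdapted X y e ∧
      ∀ n j, IsClass X n (e n j) (η n j) := by
  have h1 : ∀ n, ∃ (ι : Type u) (y : ι → X.X n), ∀ m, n + 1 = m →
      BasisOf ((X.d n m).hom ∘ y) (LinearMap.range (X.d n m).hom) := by
    intro n
    obtain ⟨ι, r, hr⟩ := exists_basisOf_top (LinearMap.range (X.d n (n + 1)).hom)
    choose y hy using fun i => (r i).2
    refine ⟨ι, y, ?_⟩
    rintro _ rfl
    have h2 := hr.map_top (LinearMap.range (X.d n (n + 1)).hom).subtype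
      (Submodule.subtype_injective _)
    rw [Submodule.range_subtype] at h2
    exact (funext hy : (X.d n (n + 1)).hom ∘ y = _) ▸ h2
  choose ι y hy using h1
  choose s hs using IsClass.exists_linear X
  refine ⟨ι, y, fun n j => s n (η n j), ⟨fun n m j => (hs n _).d_eq_zero m, fun m => ?_⟩,
    fun n j => hs n _⟩
  have hsi : Function.Injective (s m) := fun a b hab => (hs m a).unique (hab ▸ hs m b)
  have h2 : BasisOf (fun j => s m (η m j)) (LinearMap.range (s m)) := (hη m).map_top _ hsi
  have h3 : Disjoint (LinearMap.range (X.d (m - 1) m).hom) (LinearMap.range (s m)) := by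
    rw [Submodule.disjoint_def]
    rintro _ ⟨a, rfl⟩ ⟨ξ, hξ⟩
    rw [← hξ, (hs m ξ).unique (hξ ▸ IsClass.of_d a), map_zero]
  have h4 := (hy (m - 1) m (by omega)).sup h2 h3
  have h5 : LinearMap.range (X.d (m - 1) m).hom ⊔ LinearMap.range (s m) =
      LinearMap.ker (X.d m (m + 1)).hom := by
    refine le_antisymm (sup_le ?_ ?_) fun x hx => ?_
    · rintro _ ⟨a, rfl⟩
      exact d_d_apply X _ _ _ a
    · rintro _ ⟨ξ, rfl⟩
      exact (hs m ξ).d_eq_zero _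
    · obtain ⟨ξ, hξ⟩ := IsClass.of_d_eq_zero rfl hx
      have h6 := hξ.sub (hs m ξ)
      rw [sub_self] at h6
      obtain ⟨a, ha⟩ := h6.exists_of_zero (sub_add_cancel m 1)
      have : x = (X.d (m - 1) m).hom a + s m ξ := by rw [ha]; abel
      rw [this]
      exact Submodule.add_mem_sup ⟨a, rfl⟩ ⟨ξ, rfl⟩
  rw [h5] at h4
  have h6 := (h4.sumElim _ (hy m (m + 1) rfl)).comp_equiv (Equiv.sumAssoc _ _ _).symm
  have h7 : Sum.elim (Sum.elim ((X.d (m - 1) m).hom ∘ y (m - 1)) fun j => s m (η m j)) (y m) ∘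
      (Equiv.sumAssoc _ _ _).symm = adaptedFamily X y (fun n j => s n (η n j)) m := by
    funext i
    rcases i with i | i | i <;> rfl
  rwa [h7] at h6

theorem IsAdapted.finite {X : HilbertComplex.{u}} {ι ε : ℤ → Type*} {y : ∀ n, ι n → X.cx.X n}
    {e : ∀ n, ε n → X.cx.X n} (h : IsAdapted X.cx y e) (n : ℤ) : Finite (ι n) ∧ Finite (ε n) := by
  have := (X.hilbert n).finite
  have := (h.basis n).finite
  exact ⟨Finite.of_injective (fun i => (Sum.inr (Sum.inr i) : ι (n - 1) ⊕ (ε n ⊕ ι n)))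
    fun a b hab => by simpa using hab,
    Finite.of_injective (fun i => (Sum.inr (Sum.inl i) : ι (n - 1) ⊕ (ε n ⊕ ι n)))
    fun a b hab => by simpa using hab⟩

/-- The alternating sum of the volumes of bases of the cohomology. -/
noncomputable def cohomologyVol {X : RealComplex.{u}} (h : ∀ n, HilbertStructure (X.homology n))
    {ε : ℤ → Type*} [∀ n, Finite (ε n)] (η : ∀ n, ε n → X.homology n) : ℝ :=
  ∑ᶠ n : ℤ, (-1 : ℝ) ^ n * (h n).logVol (η n)

/-- The torsion of a finite Hilbert complex in terms of an adapted basis. -/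
theorem HilbertComplex.torsion_eq (X : HilbertComplex.{u}) {ι ε : ℤ → Type*} [∀ n, Finite (ι n)]
    [∀ n, Finite (ε n)] {y : ∀ n, ι n → X.cx.X n} {e : ∀ n, ε n → X.cx.X n}
    (hX : IsAdapted X.cx y e) (h : ∀ n, HilbertStructure (X.cx.homology n))
    (η : ∀ n, ε n → X.cx.homology n) (hη : ∀ n, BasisOf (η n) ⊤)
    (he : ∀ n j, IsClass X.cx n (e n j) (η n j)) :
    X.torsion h = cohomologyVol h η - adaptedVol X y e := by
  have : ∀ n, Finite ((fun _ : ℤ => PEmpty.{1}) n) := pempty_finite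
  let y' : ∀ n, (fun _ : ℤ => PEmpty.{1}) n → (X.cohomology h).cx.X n := fun _ => PEmpty.elim
  let eq (n : ℤ) : ε n ≃ PEmpty.{1} ⊕ (ε n ⊕ PEmpty.{1}) :=
    ((Equiv.emptySum PEmpty _).trans (Equiv.sumEmpty _ PEmpty)).symm
  have heq : ∀ n (i : ε n), η n i = adaptedFamily (X.cohomology h).cx y' η n (eq n i) :=
    fun n i => rfl
  have h1 : IsAdapted (X.cohomology h).cx y' η := by
    refine ⟨fun n m j => rfl, fun n => ?_⟩
    have h2 := (hη n).comp_equiv (eq n).symm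
    have h3 : adaptedFamily (X.cohomology h).cx y' η n = η n ∘ (eq n).symm := by
      funext i
      rw [Function.comp_apply, heq, Equiv.apply_symm_apply]
    rw [h3]
    exact h2
  have h2 : adaptedVol (X.cohomology h) y' η = cohomologyVol h η :=
    finsum_congr fun n => congrArg _ ((h n).logVol_congr (eq n) (heq n)).symm
  rw [HilbertComplex.torsion, equivTorsion_eq h1 hX, h2, neg_sub]
  intro n j
  have h3 : IsClass X.cx n (((X.cohomologyInclusion h).f n).hom (η n j)) (η n j) :=
    ⟨_, rfl, congrArg (fun g => g.hom (η n j)) (X.exists_cycles_section n).choose_spec⟩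
  have h4 := h3.sub (he n j)
  rw [sub_self] at h4
  obtain ⟨w, hw⟩ := h4.exists_of_zero (sub_add_cancel n 1)
  exact ⟨w, by rw [hw]; abel⟩

/-! ### Simple structures are determined by their torsion -/

theorem homologyMap_injective {C D : RealComplex.{u}} (f : HomotopyEquiv C D) (n : ℤ) :
    Function.Injective (HomologicalComplex.homologyMap f.hom n).hom :=
  (ModuleCat.mono_iff_injective (f.toHomologyIso n).hom).1 inferInstance

theorem homologyMap_surjective {C D : RealComplex.{u}} (f : HomotopyEquiv C D) (n : ℤ) :
    Function.Surjective (HomologicalComplex.homologyMap f.hom n).hom :=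
  (ModuleCat.epi_iff_surjective (f.toHomologyIso n).hom).1 inferInstance

/-- A homotopy equivalence reflects the classes of cocycles. -/
theorem IsClass.of_map {C D : RealComplex.{u}} (f : HomotopyEquiv C D) {n m : ℤ}
    (hm : n + 1 = m) {x : C.X n} (hx : (C.d n m).hom x = 0) {ξ : C.homology n}
    (h : IsClass D n ((f.hom.f n).hom x) ((HomologicalComplex.homologyMap f.hom n).hom ξ)) :
    IsClass C n x ξ := by
  obtain ⟨ξ', hξ'⟩ := IsClass.of_d_eq_zero hm hx
  rwa [← homologyMap_injective f n ((hξ'.map f.hom).unique h)]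

namespace SimpleRep

variable {C : RealComplex.{u}}

/-- The source of a representative has an adapted basis whose cocycles `e` represent a given basis
of `H(C)`. -/
theorem exists_isAdapted (u : SimpleRep C) {ε : ℤ → Type*} (η : ∀ n, ε n → C.homology n)
    (hη : ∀ n, BasisOf (η n) ⊤) :
    ∃ (ι : ℤ → Type u) (y : ∀ n, ι n → u.source.cx.X n) (e : ∀ n, ε n → u.source.cx.X n),
      IsAdapted u.source.cx y e ∧
      ∀ n j, IsClass C n ((u.equiv.hom.f n).hom (e n j)) (η n j) := by
  have h1 : ∀ n, Function.Bijective (u.equiv.toHomologyIso n).inv.hom := fun n =>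
    ⟨(ModuleCat.mono_iff_injective _).1 inferInstance,
      (ModuleCat.epi_iff_surjective _).1 inferInstance⟩
  obtain ⟨ι, y, e, hye, he⟩ := FilteredTorsion.exists_isAdapted u.source.cx
    (fun n j => (u.equiv.toHomologyIso n).inv.hom (η n j))
    fun n => (hη n).map_equiv _ (h1 n)
  refine ⟨ι, y, e, hye, fun n j => ?_⟩
  have h2 := (he n j).map u.equiv.hom
  have h3 : (HomologicalComplex.homologyMap u.equiv.hom n).hom
      ((u.equiv.toHomologyIso n).inv.hom (η n j)) = η n j :=
    congrArg (fun g => g.hom (η n j)) (u.equiv.toHomologyIso n).inv_hom_id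
  rwa [h3] at h2

theorem torsion_eq (u : SimpleRep C) {ι ε : ℤ → Type*} [∀ n, Finite (ι n)] [∀ n, Finite (ε n)]
    {y : ∀ n, ι n → u.source.cx.X n} {e : ∀ n, ε n → u.source.cx.X n}
    (hye : IsAdapted u.source.cx y e) (h : ∀ n, HilbertStructure (C.homology n))
    (η : ∀ n, ε n → C.homology n) (hη : ∀ n, BasisOf (η n) ⊤)
    (he : ∀ n j, IsClass C n ((u.equiv.hom.f n).hom (e n j)) (η n j)) :
    u.torsion h = cohomologyVol h η - adaptedVol u.source y e := by
  have h1 : ∀ n, Function.Bijective (u.equiv.toHomologyIso n).inv.hom := fun n =>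
    ⟨(ModuleCat.mono_iff_injective _).1 inferInstance,
      (ModuleCat.epi_iff_surjective _).1 inferInstance⟩
  have h3 : ∀ n j, (HomologicalComplex.homologyMap u.equiv.hom n).hom
      ((u.equiv.toHomologyIso n).inv.hom (η n j)) = η n j := fun n j =>
    congrArg (fun g => g.hom (η n j)) (u.equiv.toHomologyIso n).inv_hom_id
  rw [SimpleRep.torsion, HilbertComplex.torsion_eq _ hye _
    (fun n j => (u.equiv.toHomologyIso n).inv.hom (η n j)) (fun n => (hη n).map_equiv _ (h1 n))]
  · congr 1
    refine finsum_congr fun n => congrArg ((-1 : ℝ) ^ n * ·) ?_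
    change (h n).logVol (fun j => (HomologicalComplex.homologyMap u.equiv.hom n).hom
      ((u.equiv.toHomologyIso n).inv.hom (η n j))) = _
    simp only [h3]
  · intro n j
    refine IsClass.of_map u.equiv rfl (hye.d_e n _ j) ?_
    rw [h3]
    exact he n j

theorem finite_homology (u : SimpleRep C) (n : ℤ) : Module.Finite ℝ (C.homology n) := by
  have := (u.source.hilbert n).finite
  have h1 : Module.Finite ℝ (u.source.cx.homology n) := by
    obtain ⟨s, hs⟩ := IsClass.exists_linear u.source.cx n
    exact Module.Finite.of_injective s fun a b hab => (hs a).unique (hab ▸ hs b)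
  exact Module.Finite.of_surjective _ (homologyMap_surjective u.equiv n)

theorem bounded_homology (u : SimpleRep C) :
    ∃ N : ℕ, ∀ n : ℤ, (N : ℤ) ≤ |n| → Subsingleton (C.homology n) := by
  obtain ⟨N, hN⟩ := u.source.bounded
  refine ⟨N, fun n hn => ?_⟩
  have := hN n hn
  have h1 : Subsingleton (u.source.cx.homology n) :=
    have := (IsClass.iCycles_injective u.source.cx n).subsingleton
    (IsClass.homologyπ_surjective u.source.cx n).subsingleton
  exact (homologyMap_surjective u.equiv n).subsingleton

/-- The torsion of `v⁻¹ ∘ u` is the difference of the torsions computed from `u` and `v`. -/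
theorem equivTorsion_comp_inv (u v : SimpleRep C) (h : ∀ n, HilbertStructure (C.homology n)) :
    HilbertComplex.equivTorsion (u.equiv.hom ≫ v.equiv.inv) = u.torsion h - v.torsion h := by
  choose ε η hη using fun n => exists_basisOf_top (C.homology n)
  obtain ⟨ι, y, e, hye, he⟩ := u.exists_isAdapted η hη
  obtain ⟨ι', y', e', hye', he'⟩ := v.exists_isAdapted η hη
  have := fun n => (hye.finite n).1
  have := fun n => (hye.finite n).2
  have := fun n => (hye'.finite n).1
  rw [u.torsion_eq hye h η hη he, v.torsion_eq hye' h η hη he', equivTorsion_eq hye hye']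
  · ring
  · intro n j
    obtain ⟨ξ, hξ⟩ := IsClass.of_d_eq_zero rfl (hye'.d_e n (n + 1) j)
    have h1 := (hξ.map v.equiv.hom).unique (he' n j)
    have h2 : (HomologicalComplex.homologyMap v.equiv.inv n).hom (η n j) = ξ := by
      rw [← h1]
      exact congrArg (fun g => g.hom ξ) (v.equiv.toHomologyIso n).hom_inv_id
    have h3 := (he n j).map v.equiv.inv
    rw [h2] at h3
    have h4 := h3.sub hξ
    rw [sub_self] at h4
    obtain ⟨w, hw⟩ := h4.exists_of_zero (sub_add_cancel n 1)
    refine ⟨w, ?_⟩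
    rw [hw, add_sub_cancel]
    rfl

end SimpleRep

namespace SimpleStructure

variable {C : RealComplex.{u}}

theorem torsion_eq {σ : SimpleStructure C} {u : SimpleRep C} (hu : σ.IsRepresentedBy u)
    (h : ∀ n, HilbertStructure (C.homology n)) : σ.torsion h = u.torsion h := by
  let T : SimpleStructure C → ℝ := Quot.lift (fun u => u.torsion h) fun u v huv => by
    have h1 := u.equivTorsion_comp_inv v h
    rw [huv] at h1
    exact (sub_eq_zero.1 h1.symm)
  have h1 : (Quot.mk _ (Quot.out σ) : SimpleStructure C) = σ := Quot.out_eq σ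
  exact (congrArg T h1).trans (congrArg T hu)

theorem exists_rep (σ : SimpleStructure C) : ∃ u, σ.IsRepresentedBy u :=
  ⟨Quot.out σ, (Quot.out_eq σ).symm⟩

/-- A simple structure is determined by its torsion. -/
theorem ext_of_torsion {σ τ : SimpleStructure C} (h : ∀ n, HilbertStructure (C.homology n))
    (hστ : σ.torsion h = τ.torsion h) : σ = τ := by
  obtain ⟨u, hu⟩ := σ.exists_rep
  obtain ⟨v, hv⟩ := τ.exists_rep
  rw [torsion_eq hu, torsion_eq hv] at hστ
  rw [hu, hv]
  exact Quot.sound (by rw [u.equivTorsion_comp_inv v h, hστ, sub_self])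

theorem transport_torsion {D : RealComplex.{u}} (e : C ≅ D) (σ : SimpleStructure C)
    (h : ∀ n, HilbertStructure (D.homology n)) (h' : ∀ n, HilbertStructure (C.homology n))
    {ε : ℤ → Type*} [∀ n, Finite (ε n)] (η : ∀ n, ε n → C.homology n) (hη : ∀ n, BasisOf (η n) ⊤) :
    (σ.transport e).torsion h - cohomologyVol h
      (fun n j => (HomologicalComplex.homologyMap e.hom n).hom (η n j)) =
      σ.torsion h' - cohomologyVol h' η := by
  obtain ⟨u, rfl⟩ := σ.exists_rep
  let u' : SimpleRep D := ⟨u.source, u.equiv.trans (HomotopyEquiv.ofIso e)⟩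
  have h1 : (SimpleStructure.transport e (Quot.mk _ u)).IsRepresentedBy u' := rfl
  have h2 : SimpleStructure.IsRepresentedBy (Quot.mk _ u) u := rfl
  obtain ⟨ι, y, e', hye, he⟩ := u.exists_isAdapted η hη
  have := fun n => (hye.finite n).1
  have hbij : ∀ n, Function.Bijective (HomologicalComplex.homologyMap e.hom n).hom := fun n =>
    ⟨homologyMap_injective (HomotopyEquiv.ofIso e) n,
      homologyMap_surjective (HomotopyEquiv.ofIso e) n⟩
  rw [torsion_eq h1, torsion_eq h2, u.torsion_eq hye h' η hη he, u'.torsion_eq hye h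
    (fun n j => (HomologicalComplex.homologyMap e.hom n).hom (η n j))
    (fun n => (hη n).map_equiv _ (hbij n)) fun n j => (he n j).map e.hom]
  ring

end SimpleStructure

/-! ### Additivity of the torsion in short exact sequences -/

theorem hom_d_apply {K L : RealComplex.{u}} (f : K ⟶ L) (n m : ℤ) (x : K.X n) :
    (f.f m).hom ((K.d n m).hom x) = (L.d n m).hom ((f.f n).hom x) :=
  (congrArg (fun g => g.hom x) (f.comm n m)).symm

/-- The bijection between the index types of the adapted bases of the middle term of a short exact
sequence and its two outer terms. -/
def extensionIndexEquiv (A A' B B' K K' L M : Type*) :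
    (A ⊕ ((K ⊕ L) ⊕ A')) ⊕ (B ⊕ ((M ⊕ K') ⊕ B')) ≃
      (A ⊕ (K ⊕ B)) ⊕ ((L ⊕ M) ⊕ (A' ⊕ (K' ⊕ B'))) where
  toFun := Sum.elim
    (Sum.elim (fun a => .inl (.inl a)) (Sum.elim
      (Sum.elim (fun k => .inl (.inr (.inl k))) fun l => .inr (.inl (.inl l)))
      fun a => .inr (.inr (.inl a))))
    (Sum.elim (fun b => .inl (.inr (.inr b))) (Sum.elim
      (Sum.elim (fun m => .inr (.inl (.inr m))) fun k => .inr (.inr (.inr (.inl k))))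
      fun b => .inr (.inr (.inr (.inr b)))))
  invFun := Sum.elim
    (Sum.elim (fun a => .inl (.inl a))
      (Sum.elim (fun k => .inl (.inr (.inl (.inl k)))) fun b => .inr (.inl b)))
    (Sum.elim (Sum.elim (fun l => .inl (.inr (.inl (.inr l)))) fun m => .inr (.inr (.inl (.inl m))))
      (Sum.elim (fun a => .inl (.inr (.inr a)))
        (Sum.elim (fun k => .inr (.inr (.inl (.inr k)))) fun b => .inr (.inr (.inr b)))))
  left_inv := by rintro ((a | (k | l) | a) | (b | (m | k) | b)) <;> rfl
  right_inv := by rintro ((a | k | b) | ((l | m) | (a | k | b))) <;> rfl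

theorem BasisOf.inl_inr {A E ι κ : Type*} [AddCommGroup A] [Module ℝ A] [AddCommGroup E]
    [Module ℝ E] {v : ι → A} {w : κ → E} (hv : BasisOf v ⊤) (hw : BasisOf w ⊤) :
    BasisOf (Sum.elim (LinearMap.inl ℝ A E ∘ v) (LinearMap.inr ℝ A E ∘ w)) ⊤ := by
  refine BasisOf.sumElim (LinearMap.snd ℝ A E) ?_ ?_
  · rw [LinearMap.ker_snd]
    exact hv.map_top _ LinearMap.inl_injective
  · rw [LinearMap.range_eq_top.2 LinearMap.snd_surjective]
    exact hw

theorem HilbertStructure.logVol_inl_inr {A E ι κ : Type*} [AddCommGroup A] [Module ℝ A]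
    [AddCommGroup E] [Module ℝ E] (hA : HilbertStructure A) (hE : HilbertStructure E)
    [Finite ι] [Finite κ] {v : ι → A} {w : κ → E} (hv : BasisOf v ⊤) (hw : BasisOf w ⊤) :
    (hA.prod hE).logVol (Sum.elim (LinearMap.inl ℝ A E ∘ v) (LinearMap.inr ℝ A E ∘ w)) =
      hA.logVol v + hE.logVol w := by
  have hk : BasisOf (LinearMap.inr ℝ A E ∘ w) (LinearMap.ker (LinearMap.fst ℝ A E)) := by
    rw [LinearMap.ker_fst]
    exact hw.map_top _ LinearMap.inr_injective
  have h2 : (hA.prod hE).gram (LinearMap.inr ℝ A E ∘ w) = hE.gram w := by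
    ext i j
    change hA.ip 0 0 + _ = _
    rw [← HilbertStructure.form_apply, map_zero, zero_add]
    rfl
  have h3 : (hA.prod hE).logVol (LinearMap.inr ℝ A E ∘ w) = hE.logVol w := by
    unfold HilbertStructure.logVol
    rw [h2]
  rw [← HilbertStructure.logVol_comp_equiv _ _ (Equiv.sumComm κ ι), ← h3, add_comm]
  refine Eq.trans ?_ (HilbertStructure.logVol_sumElim (hA.prod hE) hA
    (LinearMap.fst ℝ A E) (HilbertStructure.isCoisometry_fst _ _) _ (LinearMap.inl ℝ A E ∘ v) hk
    (show LinearIndependent ℝ (LinearMap.fst ℝ A E ∘ (LinearMap.inl ℝ A E ∘ v)) from hv.li))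
  congr 1
  funext i
  rcases i with i | i <;> rfl

/-- The bracket of `Cⁿ ⊕ Eⁿ → Dⁿ` in terms of a basis of `Cⁿ` and a basis of `Eⁿ` lifted to
`Dⁿ`. -/
theorem bracket_coprod_eq {A D E ι κ : Type*} [AddCommGroup A] [Module ℝ A] [AddCommGroup D]
    [Module ℝ D] [AddCommGroup E] [Module ℝ E] (hA : HilbertStructure A) (hD : HilbertStructure D)
    (hE : HilbertStructure E) (a : A →ₗ[ℝ] D) (b : D →ₗ[ℝ] E) (ha : Function.Injective a)
    (hab : Function.Exact a b) (s : E →ₗ[ℝ] D) (hs : b ∘ₗ s = LinearMap.id)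
    [Finite ι] [Finite κ] {v : ι → A} (hv : BasisOf v ⊤) {w : κ → D} (hw : BasisOf (b ∘ w) ⊤) :
    bracket (hA.prod hE) hD (LinearMap.coprod a s) =
      hD.logVol (Sum.elim (a ∘ v) w) - hA.logVol v - hE.logVol (b ∘ w) := by
  have hs' : ∀ x, b (s x) = x := fun x => LinearMap.congr_fun hs x
  have hba : ∀ x, b (a x) = 0 := fun x => (hab (a x)).2 ⟨x, rfl⟩
  have hinj : Function.Injective (LinearMap.coprod a s) := by
    rw [← LinearMap.ker_eq_bot, LinearMap.ker_eq_bot']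
    rintro ⟨x, z⟩ hxz
    rw [LinearMap.coprod_apply] at hxz
    have h3 := congrArg b hxz
    rw [map_add, hba, hs', zero_add, map_zero] at h3
    subst h3
    rw [map_zero, add_zero] at hxz
    have h4 : a x = a 0 := hxz.trans (map_zero a).symm
    rw [ha h4]
    rfl
  rw [bracket_eq _ _ _ hinj (hv.inl_inr hw), HilbertStructure.logVol_inl_inr _ _ hv hw, ← sub_sub]
  congr 2
  have h3 : LinearMap.coprod a s ∘ Sum.elim (LinearMap.inl ℝ A E ∘ v)
      (LinearMap.inr ℝ A E ∘ (b ∘ w)) = Sum.elim (a ∘ v) fun j => s (b (w j)) := by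
    funext i
    rcases i with i | i <;> simp
  rw [h3]
  refine hD.logVol_shear _ _ _ fun j => ?_
  have h4 : s (b (w j)) - w j ∈ LinearMap.range a :=
    (hab _).1 (by rw [map_sub, hs', sub_self])
  rw [Set.range_comp, Submodule.span_image, hv.span]
  obtain ⟨x, hx⟩ := h4
  exact ⟨x, trivial, hx⟩

section Additivity

variable {S : ShortComplex RealComplex.{u}} (hS : S.ShortExact)
  {f : SimpleRep S.X₁} {g : SimpleRep S.X₂} {h : SimpleRep S.X₃}
  {a : f.source.cx ⟶ g.source.cx} {b : g.source.cx ⟶ h.source.cx}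
  {L K M : ℤ → Type*}

theorem square_apply {C D C' D' : RealComplex.{u}} {p : C ⟶ D} {q : D ⟶ D'} {r : C ⟶ C'}
    {s : C' ⟶ D'} (h : p ≫ q = r ≫ s) (n : ℤ) (x : C.X n) :
    (q.f n).hom ((p.f n).hom x) = (s.f n).hom ((r.f n).hom x) :=
  congrArg (fun g => (g.f n).hom x) h

/-- A lift of a cocycle of the quotient whose differential is a prescribed representative of
the image under the connecting homomorphism. -/
theorem exists_lift_with_differential (ha : ∀ n, Function.Injective (a.f n))
    (hab : ∀ n, Function.Exact (a.f n) (b.f n)) (hb : ∀ n, Function.Surjective (b.f n))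
    (haf : a ≫ g.equiv.hom = f.equiv.hom ≫ S.f) (hbg : b ≫ h.equiv.hom = g.equiv.hom ≫ S.g)
    {k n : ℤ} (hkn : k + 1 = n) (z : h.source.cx.X k) (hz : (h.source.cx.d k n).hom z = 0)
    (κ : S.X₃.homology k) (hκ : IsClass S.X₃ k ((h.equiv.hom.f k).hom z) κ)
    (c : f.source.cx.X n) (hc : (f.source.cx.d n (n + 1)).hom c = 0)
    (hcκ : IsClass S.X₁ n ((f.equiv.hom.f n).hom c) ((hS.δ k n hkn).hom κ)) :
    ∃ t : g.source.cx.X k, (b.f k).hom t = z ∧ (g.source.cx.d k n).hom t = (a.f n).hom c := by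
  obtain ⟨t, ht⟩ := hb k z
  obtain ⟨x, hx⟩ := (hab n ((g.source.cx.d k n).hom t)).1 (by
    refine (hom_d_apply b k n t).trans ?_
    rw [show (b.f k).hom t = z from ht, hz])
  have hx' : (a.f n).hom x = (g.source.cx.d k n).hom t := hx
  have hdx : (f.source.cx.d n (n + 1)).hom x = 0 := by
    refine ha (n + 1) ?_
    refine (hom_d_apply a n (n + 1) x).trans ?_
    rw [hx', d_d_apply]
    exact (map_zero (a.f (n + 1)).hom).symm
  have h1 : IsClass S.X₁ n ((f.equiv.hom.f n).hom x) ((hS.δ k n hkn).hom κ) := by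
    refine hκ.δ hS hkn ((g.equiv.hom.f k).hom t) ?_ _ ?_
    · rw [← square_apply hbg k t]
      exact congrArg (h.equiv.hom.f k).hom ht
    · rw [← square_apply haf n x, hx', hom_d_apply]
  have h2 := h1.sub hcκ
  rw [sub_self, ← map_sub, ← map_zero (HomologicalComplex.homologyMap f.equiv.hom n).hom] at h2
  have h3 := IsClass.of_map f.equiv rfl (by rw [map_sub, hdx, hc, sub_zero]) h2
  obtain ⟨w, hw⟩ := h3.exists_of_zero hkn
  refine ⟨t - (a.f k).hom w, ?_, ?_⟩
  · have h4 : (b.f k).hom ((a.f k).hom w) = 0 := (hab k _).2 ⟨w, rfl⟩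
    rw [map_sub, h4, sub_zero]
    exact ht
  · rw [map_sub, ← hom_d_apply a, hw, map_sub, ← hx']
    abel

/-- A lift of a cocycle of the quotient to a cocycle in a prescribed cohomology class. -/
theorem exists_lift_with_class (hb : ∀ n, Function.Surjective (b.f n))
    (hbg : b ≫ h.equiv.hom = g.equiv.hom ≫ S.g)
    {n : ℤ} (z : h.source.cx.X n) (hz : (h.source.cx.d n (n + 1)).hom z = 0)
    (μ : S.X₂.homology n) (hμ : IsClass S.X₃ n ((h.equiv.hom.f n).hom z)
      ((HomologicalComplex.homologyMap S.g n).hom μ)) :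
    ∃ t : g.source.cx.X n, (b.f n).hom t = z ∧ (∀ m, (g.source.cx.d n m).hom t = 0) ∧
      IsClass S.X₂ n ((g.equiv.hom.f n).hom t) μ := by
  obtain ⟨ξ, hξ⟩ := homologyMap_surjective g.equiv n μ
  obtain ⟨t, ht⟩ := IsClass.exists_rep ξ
  have h1 := (ht.map g.equiv.hom)
  rw [hξ] at h1
  have h2 := h1.map S.g
  rw [← square_apply hbg] at h2
  have h3 := h2.sub hμ
  rw [sub_self, ← map_sub, ← map_zero (HomologicalComplex.homologyMap h.equiv.hom n).hom] at h3
  have h4 := IsClass.of_map h.equiv rfl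
    (by rw [map_sub, hz, sub_zero]; exact (ht.map b).d_eq_zero _) h3
  obtain ⟨w, hw⟩ := h4.exists_of_zero (sub_add_cancel n 1)
  obtain ⟨w', hw'⟩ := hb (n - 1) w
  have hw'' : (b.f (n - 1)).hom w' = w := hw'
  refine ⟨t - (g.source.cx.d (n - 1) n).hom w', ?_, fun m => ?_, ?_⟩
  · rw [map_sub, hom_d_apply, hw'', hw]
    abel
  · rw [map_sub, ht.d_eq_zero, d_d_apply, sub_zero]
  · have h5 := h1.sub (IsClass.of_d (n := n) ((g.equiv.hom.f (n - 1)).hom w'))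
    rwa [sub_zero, ← hom_d_apply, ← map_sub] at h5

/-- Additivity of the torsion (Milnor's formula). The long exact cohomology sequence enters through
bases `(∂κ, λ)`, `(iλ, μ)` and `(pμ, κ)` of the three cohomologies. -/
theorem torsion_additive (ha : ∀ n, Function.Injective (a.f n))
    (hab : ∀ n, Function.Exact (a.f n) (b.f n)) (hb : ∀ n, Function.Surjective (b.f n))
    (haf : a ≫ g.equiv.hom = f.equiv.hom ≫ S.f) (hbg : b ≫ h.equiv.hom = g.equiv.hom ≫ S.g)
    [∀ n, Finite (L n)] [∀ n, Finite (K n)] [∀ n, Finite (M n)]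
    (lam : ∀ n, L n → S.X₁.homology n) (kap : ∀ n, K n → S.X₃.homology n)
    (mu : ∀ n, M n → S.X₂.homology n)
    (h₁ : ∀ n, BasisOf (Sum.elim
      (fun j : K (n - 1) => (hS.δ (n - 1) n (sub_add_cancel n 1)).hom (kap (n - 1) j)) (lam n)) ⊤)
    (h₂ : ∀ n, BasisOf (Sum.elim
      (fun j => (HomologicalComplex.homologyMap S.f n).hom (lam n j)) (mu n)) ⊤)
    (h₃ : ∀ n, BasisOf (Sum.elim
      (fun j => (HomologicalComplex.homologyMap S.g n).hom (mu n j)) (kap n)) ⊤)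
    (hh₁ : ∀ n, HilbertStructure (S.X₁.homology n))
    (hh₂ : ∀ n, HilbertStructure (S.X₂.homology n))
    (hh₃ : ∀ n, HilbertStructure (S.X₃.homology n)) :
    g.torsion hh₂ - cohomologyVol hh₂ (fun n => Sum.elim
        (fun j => (HomologicalComplex.homologyMap S.f n).hom (lam n j)) (mu n)) =
      (f.torsion hh₁ - cohomologyVol hh₁ (fun n => Sum.elim
        (fun j : K (n - 1) => (hS.δ (n - 1) n (sub_add_cancel n 1)).hom (kap (n - 1) j)) (lam n))) +
      (h.torsion hh₃ - cohomologyVol hh₃ (fun n => Sum.elim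
        (fun j => (HomologicalComplex.homologyMap S.g n).hom (mu n j)) (kap n))) -
      sequenceTorsion a b hb := by
  obtain ⟨ιC, yC, eC, hC, heC⟩ := f.exists_isAdapted _ h₁
  obtain ⟨ιE, yE, eE, hE, heE⟩ := h.exists_isAdapted _ h₃
  have hl : ∀ k, ∃ t : K k → g.source.cx.X k, ∀ j, (b.f k).hom (t j) = eE k (.inr j) ∧
      ∀ (n : ℤ) (hn : n - 1 = k), (g.source.cx.d k n).hom (t j) =
        (a.f n).hom (eC n (.inl (cast (by rw [hn]) j))) := by
    intro k
    obtain ⟨n, rfl⟩ : ∃ n, k = n - 1 := ⟨k + 1, by omega⟩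
    choose t ht ht' using fun j : K (n - 1) => exists_lift_with_differential hS ha hab hb haf hbg
      (sub_add_cancel n 1) (eE (n - 1) (.inr j)) (hE.d_e _ _ _) (kap (n - 1) j) (heE _ _)
      (eC n (.inl j)) (hC.d_e _ _ _) (heC _ _)
    refine ⟨t, fun j => ⟨ht j, fun n' hn' => ?_⟩⟩
    obtain rfl : n' = n := by omega
    exact ht' j
  choose t ht ht' using hl
  choose m hm hm' hmc using fun n (j : M n) => exists_lift_with_class hb hbg
    (eE n (.inl j)) (hE.d_e _ _ _) (mu n j) (heE _ _)
  choose y hy using fun n (j : ιE n) => hb n (yE n j)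
  let yD : ∀ n, ιC n ⊕ (K n ⊕ ιE n) → g.source.cx.X n := fun n =>
    Sum.elim (fun j => (a.f n).hom (yC n j)) (Sum.elim (t n) (y n))
  let eD : ∀ n, L n ⊕ M n → g.source.cx.X n := fun n =>
    Sum.elim (fun j => (a.f n).hom (eC n (.inr j))) (m n)
  let w : ∀ n, ιE (n - 1) ⊕ ((M n ⊕ K n) ⊕ ιE n) → g.source.cx.X n := fun n =>
    Sum.elim (fun j => (g.source.cx.d (n - 1) n).hom (y (n - 1) j))
      (Sum.elim (Sum.elim (m n) (t n)) (y n))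
  let e (n : ℤ) := extensionIndexEquiv (ιC (n - 1)) (ιC n) (ιE (n - 1)) (ιE n) (K (n - 1)) (K n)
    (L n) (M n)
  have he : ∀ n i, Sum.elim ((a.f n).hom ∘ adaptedFamily f.source.cx yC eC n) (w n) i =
      adaptedFamily g.source.cx yD eD n (e n i) := by
    rintro n ((j | (j | j) | j) | (j | (j | j) | j))
    · exact hom_d_apply a (n - 1) n (yC (n - 1) j)
    · exact (ht' (n - 1) j n rfl).symm
    all_goals rfl
  have hw : ∀ n, (b.f n).hom ∘ w n = adaptedFamily h.source.cx yE eE n := by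
    intro n
    funext i
    rcases i with j | (j | j) | j
    · refine (hom_d_apply b (n - 1) n (y (n - 1) j)).trans ?_
      exact congrArg _ (hy (n - 1) j)
    · exact hm n j
    · exact ht n j
    · exact hy n j
  have hker : ∀ n, LinearMap.ker (b.f n).hom = LinearMap.range (a.f n).hom := fun n =>
    LinearMap.exact_iff.1 (hab n)
  have hwb : ∀ n, BasisOf ((b.f n).hom ∘ w n) ⊤ := fun n => (hw n).symm ▸ hE.basis n
  have hD : IsAdapted g.source.cx yD eD := by
    refine ⟨?_, fun n => ?_⟩
    · rintro n k (j | j)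
      · change (g.source.cx.d n k).hom ((a.f n).hom _) = 0
        rw [← hom_d_apply, hC.d_e, map_zero]
      · exact hm' n j k
    · have h1 := BasisOf.sumElim (b.f n).hom (v := (a.f n).hom ∘ adaptedFamily f.source.cx yC eC n)
        (w := w n) (by rw [hker]; exact (hC.basis n).map_top _ (ha n))
        (by rw [LinearMap.range_eq_top.2 (hb n)]; exact hwb n)
      have h2 := h1.comp_equiv (e n).symm
      have h3 : Sum.elim ((a.f n).hom ∘ adaptedFamily f.source.cx yC eC n) (w n) ∘ (e n).symm =
          adaptedFamily g.source.cx yD eD n := by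
        funext i
        rw [Function.comp_apply, he, (e n).apply_symm_apply]
      rwa [h3] at h2
  have := fun n => (hC.finite n).1
  have := fun n => (hE.finite n).1
  rw [f.torsion_eq hC hh₁ _ h₁ heC, h.torsion_eq hE hh₃ _ h₃ heE, g.torsion_eq hD hh₂ _ h₂]
  · have h1 : ∀ n, bracket ((f.source.hilbert n).prod (h.source.hilbert n)) (g.source.hilbert n)
        (LinearMap.coprod (a.f n).hom (exists_section (b.f n).hom (hb n)).choose) =
        (g.source.hilbert n).logVol (adaptedFamily g.source.cx yD eD n) +
          ((- (f.source.hilbert n).logVol (adaptedFamily f.source.cx yC eC n)) +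
          - (h.source.hilbert n).logVol (adaptedFamily h.source.cx yE eE n)) := by
      intro n
      rw [bracket_coprod_eq (f.source.hilbert n) (g.source.hilbert n) (h.source.hilbert n)
        (a.f n).hom (b.f n).hom (ha n) (hab n) _ (exists_section (b.f n).hom (hb n)).choose_spec
        (hC.basis n) (hwb n), hw n,
        HilbertStructure.logVol_congr (g.source.hilbert n) (e n) (he n)]
      ring
    have h2 : sequenceTorsion a b hb = adaptedVol g.source yD eD - adaptedVol f.source yC eC -
        adaptedVol h.source yE eE := by
      have h3 : (Function.support fun n =>
          - (f.source.hilbert n).logVol (adaptedFamily f.source.cx yC eC n)).Finite := by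
        rw [Function.support_fun_neg]
        exact finite_support_logVol f.source hC
      have h4 : (Function.support fun n =>
          - (h.source.hilbert n).logVol (adaptedFamily h.source.cx yE eE n)).Finite := by
        rw [Function.support_fun_neg]
        exact finite_support_logVol h.source hE
      have h5 := (h3.union h4).subset (Function.support_add _ _)
      rw [sequenceTorsion, finsum_congr fun n => congrArg ((-1 : ℝ) ^ n * ·) (h1 n),
        finsum_neg_one_add (finite_support_logVol g.source hD) h5, finsum_neg_one_add h3 h4]
      simp only [mul_neg, finsum_neg_distrib, adaptedVol]
      ring
    rw [h2]
    ring
  · rintro n (j | j)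
    · change IsClass S.X₂ n ((g.equiv.hom.f n).hom ((a.f n).hom _)) _
      rw [square_apply haf]
      exact (heC n (.inr j)).map S.f
    · exact hmc n j

end Additivity

/-! ### Extensions of simple structures -/

/-- A quasi-isomorphism of complexes of vector spaces is a homotopy equivalence. -/
theorem exists_homotopyEquiv {K L : RealComplex.{u}} (f : K ⟶ L)
    (hf : ∀ n, Function.Bijective (HomologicalComplex.homologyMap f n).hom) :
    ∃ e : HomotopyEquiv K L, e.hom = f := by
  have h1 : HomologicalComplex.quasiIso (ModuleCat.{u} ℝ) (ComplexShape.up ℤ) f := by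
    rw [HomologicalComplex.mem_quasiIso_iff, quasiIso_iff]
    intro n
    rw [quasiIsoAt_iff_isIso_homologyMap]
    exact (ConcreteCategory.isIso_iff_bijective _).2 (hf n)
  rw [← HomotopyCategory.quotient_map_mem_quasiIso_iff,
    HomotopyCategory.quasiIso_eq_trW_subcategoryAcyclic, ObjectProperty.trW_iff] at h1
  obtain ⟨Z, a, b, hT, hZ⟩ := h1
  obtain ⟨Z, rfl⟩ := HomotopyCategory.quotient_obj_surjective Z
  rw [HomotopyCategory.quotient_obj_mem_subcategoryAcyclic_iff_exactAt] at hZ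
  have h2 : Nonempty (Homotopy (𝟙 Z) 0) := by
    refine nonempty_contraction Z fun l n m hl hm x hx => ?_
    have h3 := hZ n
    rw [Z.exactAt_iff' l n m (by simp [← hl]) (by simp [← hm])] at h3
    exact (ShortComplex.moduleCat_exact_iff _).1 h3 x hx
  have h3 : IsIso ((HomotopyCategory.quotient _ _).map f) :=
    (Pretriangulated.Triangle.isZero₃_iff_isIso₁ _ hT).1
      ((HomotopyCategory.isZero_quotient_obj_iff Z).2 h2)
  have h4 : ((MorphismProperty.isomorphisms _).inverseImage
      (HomotopyCategory.quotient (ModuleCat.{u} ℝ) (ComplexShape.up ℤ))) f := h3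
  rw [HomotopyCategory.inverseImage_quotient_isomorphisms] at h4
  obtain ⟨e, he⟩ := h4
  exact ⟨e, he⟩

theorem homologyMap_bijective_of_shortExact {S T : ShortComplex RealComplex.{u}}
    (hS : S.ShortExact) (hT : T.ShortExact) (φ : S ⟶ T)
    (h₁ : ∀ n, Function.Bijective (HomologicalComplex.homologyMap φ.τ₁ n).hom)
    (h₃ : ∀ n, Function.Bijective (HomologicalComplex.homologyMap φ.τ₃ n).hom) (n : ℤ) :
    Function.Bijective (HomologicalComplex.homologyMap φ.τ₂ n).hom := by
  have hn : n - 1 + 1 = n := sub_add_cancel n 1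
  have ex : ∀ {U : ShortComplex RealComplex.{u}} (hU : U.ShortExact),
      Function.Exact (hU.δ (n - 1) n hn).hom (HomologicalComplex.homologyMap U.f n).hom ∧
      Function.Exact (HomologicalComplex.homologyMap U.f n).hom
        (HomologicalComplex.homologyMap U.g n).hom ∧
      Function.Exact (HomologicalComplex.homologyMap U.g n).hom (hU.δ n (n + 1) rfl).hom :=
    fun hU => ⟨(ShortComplex.ShortExact.moduleCat_exact_iff_function_exact _).1
      (hU.homology_exact₁ (n - 1) n hn),
      (ShortComplex.ShortExact.moduleCat_exact_iff_function_exact _).1 (hU.homology_exact₂ n),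
      (ShortComplex.ShortExact.moduleCat_exact_iff_function_exact _).1
        (hU.homology_exact₃ n (n + 1) rfl)⟩
  have hδ := fun (a b : ℤ) (hab : a + 1 = b) => congrArg ModuleCat.Hom.hom
    (HomologicalComplex.HomologySequence.δ_naturality φ hS hT a b hab)
  have hm₁ : HomologicalComplex.homologyMap S.f n ≫ HomologicalComplex.homologyMap φ.τ₂ n =
      HomologicalComplex.homologyMap φ.τ₁ n ≫ HomologicalComplex.homologyMap T.f n := by
    rw [← HomologicalComplex.homologyMap_comp, ← HomologicalComplex.homologyMap_comp, φ.comm₁₂]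
  have hm₂ : HomologicalComplex.homologyMap S.g n ≫ HomologicalComplex.homologyMap φ.τ₃ n =
      HomologicalComplex.homologyMap φ.τ₂ n ≫ HomologicalComplex.homologyMap T.g n := by
    rw [← HomologicalComplex.homologyMap_comp, ← HomologicalComplex.homologyMap_comp, φ.comm₂₃]
  exact LinearMap.bijective_of_surjective_of_bijective_of_bijective_of_injective
    _ _ _ _ _ _ _ _ (HomologicalComplex.homologyMap φ.τ₃ (n - 1)).hom
    (HomologicalComplex.homologyMap φ.τ₁ n).hom _ (HomologicalComplex.homologyMap φ.τ₃ n).hom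
    (HomologicalComplex.homologyMap φ.τ₁ (n + 1)).hom
    (hδ _ _ hn).symm (congrArg ModuleCat.Hom.hom hm₁).symm (congrArg ModuleCat.Hom.hom hm₂).symm
    (hδ _ _ rfl).symm (ex hS).1 (ex hS).2.1 (ex hS).2.2 (ex hT).1 (ex hT).2.1 (ex hT).2.2
    (h₃ _).2 (h₁ n) (h₃ n) (h₁ _).1

/-- The extension of the complex `E` by the complex `A` with twisting cocycle `θ`. -/
noncomputable def twistedSum (A E : RealComplex.{u}) (θ : ∀ n m, E.X n →ₗ[ℝ] A.X m)
    (h0 : ∀ n m, n + 1 ≠ m → θ n m = 0)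
    (hθ : ∀ n m k, n + 1 = m → m + 1 = k → ∀ e,
      (A.d m k).hom (θ n m e) + θ m k ((E.d n m).hom e) = 0) :
    RealComplex.{u} where
  X n := ModuleCat.of ℝ (A.X n × E.X n)
  d n m := ModuleCat.ofHom (LinearMap.prod
    (LinearMap.coprod (A.d n m).hom (θ n m)) ((E.d n m).hom ∘ₗ LinearMap.snd ℝ _ _))
  shape n m h := by
    refine ModuleCat.hom_ext (LinearMap.ext fun x => Prod.ext ?_ ?_)
    · change (A.d n m).hom x.1 + θ n m x.2 = 0
      rw [A.shape n m h, h0 n m h, LinearMap.zero_apply, add_zero]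
      rfl
    · change (E.d n m).hom x.2 = 0
      rw [E.shape n m h]
      rfl
  d_comp_d' n m k hn hm := by
    refine ModuleCat.hom_ext (LinearMap.ext fun x => Prod.ext ?_ ?_)
    · change (A.d m k).hom ((A.d n m).hom x.1 + θ n m x.2) + θ m k ((E.d n m).hom x.2) = 0
      rw [map_add, d_d_apply, zero_add]
      exact hθ n m k hn hm x.2
    · exact d_d_apply E n m k x.2

theorem exact_f {S : ShortComplex RealComplex.{u}} (hS : S.ShortExact) (n : ℤ) :
    Function.Injective (S.f.f n).hom ∧ Function.Exact (S.f.f n).hom (S.g.f n).hom ∧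
      Function.Surjective (S.g.f n).hom := by
  have h1 := hS.map_of_exact (HomologicalComplex.eval (ModuleCat.{u} ℝ) (ComplexShape.up ℤ) n)
  exact ⟨h1.moduleCat_injective_f, (ShortComplex.ShortExact.moduleCat_exact_iff_function_exact _).1
    h1.exact, h1.moduleCat_surjective_g⟩

/-- Representatives of simple structures on the outer terms of a short exact sequence extend to a
strictly commuting diagram whose upper row has vanishing torsion. The middle term is a twisted
sum of the outer terms. -/
theorem exists_extension {S : ShortComplex RealComplex.{u}} (hS : S.ShortExact)
    (f : SimpleRep S.X₁) (h : SimpleRep S.X₃) :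
    ∃ (g : SimpleRep S.X₂) (a : f.source.cx ⟶ g.source.cx) (b : g.source.cx ⟶ h.source.cx)
      (_ : ∀ n, Function.Injective (a.f n)) (_ : ∀ n, Function.Exact (a.f n) (b.f n))
      (hb : ∀ n, Function.Surjective (b.f n)),
      a ≫ g.equiv.hom = f.equiv.hom ≫ S.f ∧ b ≫ h.equiv.hom = g.equiv.hom ≫ S.g ∧
      sequenceTorsion a b hb = 0 := by
  let A := f.source.cx
  let E := h.source.cx
  let i (n : ℤ) : S.X₁.X n →ₗ[ℝ] S.X₂.X n := (S.f.f n).hom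
  let p (n : ℤ) : S.X₂.X n →ₗ[ℝ] S.X₃.X n := (S.g.f n).hom
  have hi : ∀ n, Function.Injective (i n) := fun n => (exact_f hS n).1
  have hip : ∀ n, Function.Exact (i n) (p n) := fun n => (exact_f hS n).2.1
  choose σ hσ using fun n => exists_section (p n) (exact_f hS n).2.2
  choose ρ hρ using fun n => (i n).exists_leftInverse_of_injective
    (LinearMap.ker_eq_bot.2 (hi n))
  let s (n : ℤ) : E.X n →ₗ[ℝ] S.X₂.X n := σ n ∘ₗ (h.equiv.hom.f n).hom
  have hps : ∀ n e, p n (s n e) = (h.equiv.hom.f n).hom e := fun n e =>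
    LinearMap.congr_fun (hσ n) _
  let η (n m : ℤ) : E.X n →ₗ[ℝ] S.X₁.X m :=
    ρ m ∘ₗ ((S.X₂.d n m).hom ∘ₗ s n - s m ∘ₗ (E.d n m).hom)
  have hη : ∀ n m e, i m (η n m e) = (S.X₂.d n m).hom (s n e) - s m ((E.d n m).hom e) := by
    intro n m e
    obtain ⟨x, hx⟩ := (hip m ((S.X₂.d n m).hom (s n e) - s m ((E.d n m).hom e))).1 (by
      rw [map_sub, hps, hom_d_apply h.equiv.hom, ← hps, sub_eq_zero]
      exact hom_d_apply S.g n m (s n e))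
    change i m (ρ m ((S.X₂.d n m).hom (s n e) - s m ((E.d n m).hom e))) = _
    rw [← hx]
    exact congrArg (i m) (LinearMap.congr_fun (hρ m) x)
  have hη0 : ∀ n m, n + 1 ≠ m → η n m = 0 := by
    intro n m hnm
    refine LinearMap.ext fun e => hi m ?_
    rw [hη, S.X₂.shape n m hnm, E.shape n m hnm, LinearMap.zero_apply, map_zero]
    change 0 - s m 0 = 0
    rw [map_zero, sub_zero]
  have hid : ∀ n m x, i m ((S.X₁.d n m).hom x) = (S.X₂.d n m).hom (i n x) := fun n m x =>
    hom_d_apply S.f n m x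
  have hdη : ∀ n m k e, (S.X₁.d m k).hom (η n m e) + η m k ((E.d n m).hom e) = 0 := by
    intro n m k e
    refine hi k ?_
    rw [map_add, hid, hη, hη, map_sub, d_d_apply, d_d_apply, map_zero, map_zero]
    abel
  let θ (n m : ℤ) : E.X n →ₗ[ℝ] A.X m := (f.equiv.inv.f m).hom ∘ₗ η n m
  let D : RealComplex.{u} := twistedSum A E θ
    (fun n m hnm => by change _ ∘ₗ η n m = 0; rw [hη0 n m hnm, LinearMap.comp_zero])
    fun n m k _ _ e => by
      change (A.d m k).hom ((f.equiv.inv.f m).hom (η n m e)) +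
        (f.equiv.inv.f k).hom (η m k ((E.d n m).hom e)) = 0
      rw [← hom_d_apply f.equiv.inv, ← map_add, hdη, map_zero]
  let H := f.equiv.homotopyInvHomId
  have hH : ∀ n x, (f.equiv.hom.f n).hom ((f.equiv.inv.f n).hom x) =
      (H.hom (n + 1) n).hom ((S.X₁.d n (n + 1)).hom x) +
        (S.X₁.d (n - 1) n).hom ((H.hom n (n - 1)).hom x) + x := by
    intro n x
    have h1 := congrArg (fun g => g.hom x) (H.comm n)
    rw [dNext_eq H.hom (show (ComplexShape.up ℤ).Rel n (n + 1) from rfl),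
      prevD_eq H.hom (show (ComplexShape.up ℤ).Rel (n - 1) n from sub_add_cancel n 1)] at h1
    exact h1
  let φ (n : ℤ) : E.X n →ₗ[ℝ] S.X₂.X n :=
    s n + i n ∘ₗ (H.hom (n + 1) n).hom ∘ₗ η n (n + 1)
  have hφ : ∀ n m e, n + 1 = m → i m ((f.equiv.hom.f m).hom (θ n m e)) + φ m ((E.d n m).hom e) =
      (S.X₂.d n m).hom (φ n e) := by
    rintro n m e rfl
    change i (n + 1) ((f.equiv.hom.f _).hom ((f.equiv.inv.f _).hom (η n (n + 1) e))) +
      (s (n + 1) _ + i (n + 1) ((H.hom _ _).hom (η (n + 1) (n + 1 + 1) _))) =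
      (S.X₂.d n (n + 1)).hom (s n e + i n ((H.hom (n + 1) n).hom (η n (n + 1) e)))
    have h1 : (S.X₁.d (n + 1 - 1) (n + 1)).hom ((H.hom (n + 1) (n + 1 - 1)).hom (η n (n + 1) e)) =
        (S.X₁.d n (n + 1)).hom ((H.hom (n + 1) n).hom (η n (n + 1) e)) := by
      rw [add_sub_cancel_right]
    have h2 : η (n + 1) (n + 1 + 1) ((E.d n (n + 1)).hom e) =
        - (S.X₁.d (n + 1) (n + 1 + 1)).hom (η n (n + 1) e) :=
      eq_neg_of_add_eq_zero_right (hdη n (n + 1) (n + 1 + 1) e)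
    rw [hH, h1, h2, map_add, map_add, map_add, hη, ← hid, map_neg, map_neg]
    abel
  let g : D ⟶ S.X₂ :=
    { f := fun n => ModuleCat.ofHom (LinearMap.coprod (i n ∘ₗ (f.equiv.hom.f n).hom) (φ n))
      comm' := fun n m hnm => by
        refine ModuleCat.hom_ext (LinearMap.ext fun x => ?_)
        change (S.X₂.d n m).hom (i n ((f.equiv.hom.f n).hom x.1) + φ n x.2) =
          i m ((f.equiv.hom.f m).hom ((A.d n m).hom x.1 + θ n m x.2)) + φ m ((E.d n m).hom x.2)
        rw [map_add, map_add, map_add, add_assoc, hφ n m x.2 hnm, ← hid, ← hom_d_apply] }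
  let a : A ⟶ D :=
    { f := fun n => ModuleCat.ofHom (LinearMap.inl ℝ _ _)
      comm' := fun n m _ => by
        refine ModuleCat.hom_ext (LinearMap.ext fun x => Prod.ext ?_ ?_)
        · change (A.d n m).hom x + θ n m 0 = (A.d n m).hom x
          rw [map_zero, add_zero]
        · exact map_zero (E.d n m).hom }
  let b : D ⟶ E :=
    { f := fun n => ModuleCat.ofHom (LinearMap.snd ℝ _ _)
      comm' := fun n m _ => rfl }
  have ha : ∀ n, Function.Injective (a.f n) := fun n => LinearMap.inl_injective
  have hab : ∀ n, Function.Exact (a.f n) (b.f n) := fun n x =>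
    ⟨fun hx => ⟨x.1, Prod.ext rfl (Eq.symm hx)⟩, by rintro ⟨y, rfl⟩; rfl⟩
  have hb : ∀ n, Function.Surjective (b.f n) := fun n => LinearMap.snd_surjective
  have hag : a ≫ g = f.equiv.hom ≫ S.f := by
    ext n : 1
    refine ModuleCat.hom_ext (LinearMap.ext fun x => ?_)
    change i n ((f.equiv.hom.f n).hom x) + φ n 0 = i n ((f.equiv.hom.f n).hom x)
    rw [map_zero, add_zero]
  have hbg : b ≫ h.equiv.hom = g ≫ S.g := by
    ext n : 1
    refine ModuleCat.hom_ext (LinearMap.ext fun x => ?_)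
    change (h.equiv.hom.f n).hom x.2 = p n (i n _ + (s n x.2 + i n _))
    have h0 : ∀ y, p n (i n y) = 0 := fun y => (hip n _).2 ⟨y, rfl⟩
    rw [map_add, map_add, h0, h0, hps, zero_add, add_zero]
  let T : ShortComplex RealComplex.{u} :=
    { X₁ := A, X₂ := D, X₃ := E, f := a, g := b
      zero := by
        ext n : 1
        exact ModuleCat.hom_ext (LinearMap.ext fun x => rfl) }
  have hT : T.ShortExact := HomologicalComplex.shortExact_of_degreewise_shortExact _ fun n =>
    ModuleCat.shortComplex_shortExact _ (hab n) (ha n) (hb n)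
  let Φ : T ⟶ S :=
    { τ₁ := f.equiv.hom, τ₂ := g, τ₃ := h.equiv.hom, comm₁₂ := hag.symm, comm₂₃ := hbg.symm }
  obtain ⟨e, he⟩ := exists_homotopyEquiv g (homologyMap_bijective_of_shortExact hT hS Φ
    (fun n => ⟨homologyMap_injective f.equiv n, homologyMap_surjective f.equiv n⟩)
    fun n => ⟨homologyMap_injective h.equiv n, homologyMap_surjective h.equiv n⟩)
  let G : HilbertComplex.{u} :=
    { cx := D
      hilbert := fun n => (f.source.hilbert n).prod (h.source.hilbert n)
      bounded := by
        obtain ⟨N, hN⟩ := f.source.bounded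
        obtain ⟨M, hM⟩ := h.source.bounded
        refine ⟨N + M, fun n hn => ?_⟩
        push_cast at hn
        have h1 := hN n (by omega)
        have h2 := hM n (by omega)
        exact inferInstanceAs (Subsingleton (f.source.cx.X n × h.source.cx.X n)) }
  refine ⟨⟨G, e⟩, a, b, ha, hab, hb, by rw [he]; exact hag, by rw [he]; exact hbg, ?_⟩
  refine (finsum_congr fun n => ?_).trans finsum_zero
  obtain ⟨ι, v, hv⟩ := exists_basisOf_top (f.source.cx.X n)
  obtain ⟨κ, w, hw⟩ := exists_basisOf_top (h.source.cx.X n)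
  have := (f.source.hilbert n).finite
  have := (h.source.hilbert n).finite
  have := hv.finite
  have := hw.finite
  have h1 := bracket_coprod_eq (f.source.hilbert n) (G.hilbert n) (h.source.hilbert n)
    (a.f n).hom (b.f n).hom (ha n) (hab n) _ (exists_section (b.f n).hom (hb n)).choose_spec
    hv (w := LinearMap.inr ℝ _ _ ∘ w) hw
  rw [h1]
  have h2 := HilbertStructure.logVol_inl_inr (f.source.hilbert n) (h.source.hilbert n) hv hw
  have h3 : (G.hilbert n).logVol (Sum.elim ((a.f n).hom ∘ v) (LinearMap.inr ℝ _ _ ∘ w)) =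
    (f.source.hilbert n).logVol v + (h.source.hilbert n).logVol w := h2
  rw [h3]
  change _ * (_ - _ - (h.source.hilbert n).logVol w) = 0
  ring

namespace Subcomplex

variable {C : RealComplex.{u}}

/-- The sequence `L → K → K / L` for `L ≤ K`. -/
noncomputable def pairSeq {K L : Subcomplex C} (hL : L ≤ K) : ShortComplex RealComplex.{u} where
  X₁ := L.toCx
  X₂ := K.toCx
  X₃ := K.quot L
  f := inclusion hL
  g := K.π L
  zero := by
    ext n : 1
    refine ModuleCat.hom_ext <| LinearMap.ext fun x => ?_
    exact (Submodule.Quotient.mk_eq_zero _).2 x.2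

theorem pairSeq_shortExact {K L : Subcomplex C} (hL : L ≤ K) : (pairSeq hL).ShortExact := by
  refine HomologicalComplex.shortExact_of_degreewise_shortExact _ fun n => ?_
  refine ModuleCat.shortComplex_shortExact _ (fun y => ⟨fun hy => ?_, ?_⟩) (fun x y hxy => ?_)
    fun y => ?_
  · exact ⟨⟨y.1, (Submodule.Quotient.mk_eq_zero ((L.carrier n).submoduleOf (K.carrier n))).1 hy⟩,
      rfl⟩
  · rintro ⟨x, rfl⟩
    exact (Submodule.Quotient.mk_eq_zero _).2 x.2
  · exact Submodule.inclusion_injective (hL n) hxy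
  · obtain ⟨x, rfl⟩ := Submodule.Quotient.mk_surjective _ y
    exact ⟨x, rfl⟩

end Subcomplex

namespace Filtration

variable {C : RealComplex.{u}} (F : Filtration C)

/-- The trivial simple structure on a zero complex has a representative with zero source. -/
theorem exists_trivial_rep (K : RealComplex.{u}) (hK : ∀ n, Subsingleton (K.X n)) :
    ∃ u : SimpleRep K, ∀ n, Subsingleton (u.source.cx.X n) :=
  ⟨⟨⟨K, fun n => HilbertStructure.mk' (Module.Finite.of_surjective (0 : ℝ →ₗ[ℝ] K.X n)
    fun x => ⟨0, Subsingleton.elim _ _⟩) (fun _ _ => 0) (fun _ _ => rfl) (fun _ => le_rfl)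
    (fun _ _ _ => by simp) (fun _ _ _ => by simp) fun _ _ => Subsingleton.elim _ _,
    0, fun n _ => hK n⟩, HomotopyEquiv.refl K⟩, hK⟩

theorem exists_isPreferredAt (l : ℕ) (hl : F.F l = ⊥) (σ : ∀ p, SimpleStructure (F.gr p)) (p : ℤ)
    (hp : p ≤ l) : ∃ τ, F.IsPreferredAt l σ p τ := by
  obtain ⟨k, rfl⟩ : ∃ k : ℕ, p = l - k := ⟨(l - p).toNat, by omega⟩
  clear hp
  induction k with
  | zero =>
    have h0 : ∀ n, Subsingleton ((F.F l).toCx.X n) := fun n => by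
      rw [hl]
      exact inferInstanceAs (Subsingleton (⊥ : Submodule ℝ (C.X n)))
    obtain ⟨u, hu⟩ := exists_trivial_rep _ h0
    rw [Nat.cast_zero, sub_zero]
    exact ⟨Quot.mk _ u, .base _ u hu rfl⟩
  | succ k ih =>
    have h1 : (l - (k + 1 : ℕ) : ℤ) + 1 = l - k := by push_cast; ring
    rw [← h1] at ih
    obtain ⟨τ', hτ'⟩ := ih
    obtain ⟨f, hf⟩ := τ'.exists_rep
    obtain ⟨h, hh⟩ := (σ (l - (k + 1 : ℕ))).exists_rep
    obtain ⟨g, a, b, ha, hab, hb, hag, hbg, h0⟩ := exists_extension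
      (Subcomplex.pairSeq_shortExact (F.anti (l - (k + 1 : ℕ)) (l - (k + 1 : ℕ) + 1) (by omega)))
      f h
    exact ⟨Quot.mk _ g, .step _ (by omega) τ' _ hτ'
      ⟨f, g, h, a, b, ha, hab, hb, hf, rfl, hh, hag, hbg, h0⟩⟩

end Filtration

/-! ### Interval decomposition of persistence modules -/

namespace BasisOf

variable {V W ι : Type*} [AddCommGroup V] [Module ℝ V] [AddCommGroup W] [Module ℝ W]

theorem on_iff {f : ι → V} {s : Set ι} {S : Submodule ℝ V} :
    BasisOf (fun i : s => f i) S ↔ LinearIndepOn ℝ f s ∧ Submodule.span ℝ (f '' s) = S := by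
  rw [Set.image_eq_range]
  exact ⟨fun h => ⟨h.li, h.span⟩, fun h => ⟨h.1, h.2⟩⟩

theorem union {f : ι → V} {s t : Set ι} {S T : Submodule ℝ V}
    (hs : BasisOf (fun i : s => f i) S) (ht : BasisOf (fun i : t => f i) T) (hd : Disjoint S T) :
    BasisOf (fun i : ↥(s ∪ t) => f i) (S ⊔ T) := by
  rw [on_iff] at hs ht ⊢
  refine ⟨hs.1.union ht.1 (by rwa [hs.2, ht.2]), ?_⟩
  rw [Set.image_union, Submodule.span_union, hs.2, ht.2]

/-- If a subfamily of a basis is a basis of the kernel of a linear map, then the images of the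
other members form a basis of the image. -/
theorem image_of_ker {f : ι → V} {s t u : Set ι} {S : Submodule ℝ V} (g : V →ₗ[ℝ] W)
    (h : BasisOf (fun i : u => f i) S) (hs : BasisOf (fun i : s => f i) (S ⊓ LinearMap.ker g))
    (hu : u = s ∪ t) (hst : Disjoint s t) : BasisOf (fun i : t => g (f i)) (S.map g) := by
  subst hu
  rw [on_iff] at h hs
  obtain ⟨h1, h2⟩ := h
  have h3 := (linearIndepOn_union_iff hst).1 h1
  have h4 : Disjoint (Submodule.span ℝ (f '' t)) (LinearMap.ker g) := by
    rw [Submodule.disjoint_def]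
    intro x hx hx'
    refine Submodule.disjoint_def.1 h3.2.2 x ?_ hx
    rw [hs.2]
    refine ⟨?_, hx'⟩
    rw [← h2]
    exact Submodule.span_mono (Set.image_mono Set.subset_union_right) hx
  refine (on_iff (f := fun i => g (f i))).2 ⟨?_, ?_⟩
  · refine LinearIndependent.map (v := fun i : t => f i) h3.2.1 ?_
    rwa [Set.image_eq_range] at h4
  · rw [← h2, Set.image_union, Submodule.span_union, Submodule.map_sup, hs.2]
    have h5 : Submodule.map g (S ⊓ LinearMap.ker g) = ⊥ := by
      rw [eq_bot_iff]
      rintro _ ⟨x, hx, rfl⟩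
      exact hx.2
    rw [h5, bot_sup_eq, ← Submodule.span_image, Set.image_image]

theorem of_isEmpty {f : ι → V} [IsEmpty ι] : BasisOf f ⊥ :=
  ⟨linearIndependent_empty_type, by rw [Set.range_eq_empty, Submodule.span_empty]⟩

end BasisOf

/-- A basis of a complement of `I` that is adapted to a descending filtration `K`. -/
theorem exists_filtered_complement {V : Type u} [AddCommGroup V] [Module ℝ V]
    [Module.Finite ℝ V] (I : Submodule ℝ V) (K : ℤ → Submodule ℝ V) (hK : Antitone K) (b : ℤ)
    (hb : K b = ⊥) :
    ∃ (W : Type u) (_ : Finite W) (α : W → ℤ) (v : W → V), (∀ w, -1 ≤ α w ∧ α w < b) ∧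
      ∀ a, -1 ≤ a → a ≤ b → ∃ X ≤ K a, BasisOf (fun w : {w | a ≤ α w} => v w) X ∧
        Disjoint I X ∧ I ⊔ X = I ⊔ K a := by
  have h1 : ∀ a, ∃ U ≤ K a, Disjoint (I ⊔ K (a + 1)) U ∧ I ⊔ K (a + 1) ⊔ U = I ⊔ K a := by
    intro a
    obtain ⟨T, hT⟩ := exists_isCompl ((I ⊔ K (a + 1)) ⊓ K a)
    refine ⟨T ⊓ K a, inf_le_right, ?_, le_antisymm ?_ ?_⟩
    · rw [disjoint_iff, eq_bot_iff]
      rintro x ⟨h1, h2, h3⟩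
      rw [← hT.inf_eq_bot]
      exact ⟨⟨h1, h3⟩, h2⟩
    · exact sup_le (sup_le_sup_left (hK (by omega)) _) (inf_le_right.trans le_sup_right)
    · refine sup_le (le_sup_left.trans le_sup_left) ?_
      have h2 : K a = (I ⊔ K (a + 1)) ⊓ K a ⊔ T ⊓ K a := by
        rw [← sup_inf_assoc_of_le T (inf_le_right : (I ⊔ K (a + 1)) ⊓ K a ≤ K a), hT.sup_eq_top,
          top_inf_eq]
      conv_lhs => rw [h2]
      exact sup_le_sup_right inf_le_left _
  choose U hU hU' hU'' using h1
  choose J v hv using fun a => exists_basisOf_top (U a)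
  have hv' : ∀ a, BasisOf (fun j => (v a j : V)) (U a) := fun a => by
    have := (hv a).map_top (U a).subtype (U a).subtype_injective
    rwa [Submodule.range_subtype] at this
  have := fun a => (hv a).finite
  let W := Σ a : Finset.Ico (-1 : ℤ) b, J a
  let α : W → ℤ := fun w => w.1
  let f : W → V := fun w => v w.1 w.2
  have hα : ∀ w, -1 ≤ α w ∧ α w < b := fun w => Finset.mem_Ico.1 w.1.2
  have hfib : ∀ a, -1 ≤ a → a < b → BasisOf (fun w : {w | α w = a} => f w) (U a) := by
    intro a ha ha'
    let e : J a ≃ {w | α w = a} := Equiv.ofBijective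
      (fun j => ⟨⟨⟨a, Finset.mem_Ico.2 ⟨ha, ha'⟩⟩, j⟩, rfl⟩) (by
        constructor
        · intro j j' h
          have h1 := congrArg Subtype.val h
          exact eq_of_heq (Sigma.mk.inj h1).2
        · rintro ⟨⟨⟨a', h'⟩, j⟩, rfl⟩
          exact ⟨j, rfl⟩)
    have h2 := (hv' a).comp_equiv e.symm
    have h3 : (fun j => (v a j : V)) ∘ e.symm = fun w : {w | α w = a} => f w := by
      funext w
      obtain ⟨j, rfl⟩ := e.surjective w
      rw [Function.comp_apply, e.symm_apply_apply]
      rfl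
    rwa [h3] at h2
  refine ⟨W, inferInstance, α, f, hα, fun a ha hab => ?_⟩
  obtain ⟨k, rfl⟩ : ∃ k : ℕ, a = b - k := ⟨(b - a).toNat, by omega⟩
  clear hab
  induction k with
  | zero =>
    rw [Nat.cast_zero, sub_zero]
    have : IsEmpty {w | b ≤ α w} := ⟨fun w => (hα w.1).2.not_ge w.2⟩
    exact ⟨⊥, bot_le, BasisOf.of_isEmpty, disjoint_bot_right, by rw [hb]⟩
  | succ k ih =>
    obtain ⟨a, ha'⟩ : ∃ a : ℤ, a = b - (k + 1 : ℕ) := ⟨_, rfl⟩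
    have h2 : b - k = a + 1 := by push_cast at ha'; omega
    rw [h2] at ih
    rw [← ha'] at ha ⊢
    obtain ⟨X, hX, hX', hX'', hX3⟩ := ih (by omega)
    have h4 : Disjoint (I ⊔ X) (U a) := by rw [hX3]; exact hU' a
    refine ⟨X ⊔ U a, sup_le (hX.trans (hK (by omega))) (hU a), ?_,
      hX''.disjoint_sup_right_of_disjoint_sup_left h4, ?_⟩
    · have h5 : {w | a ≤ α w} = {w | a + 1 ≤ α w} ∪ {w | α w = a} := by
        ext w
        simp only [Set.mem_ofPred_eq, Set.mem_union]
        omega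
      rw [h5]
      exact hX'.union (hfib a ha (by push_cast at ha'; omega))
        (h4.mono_left le_sup_right)
    · rw [← sup_assoc, hX3, hU'']

/-- The interval decomposition of a finite persistence module `V l → V (l - 1) → ⋯ → V 0` with
`V l = 0`. The bar `w` is born at `t w` and dies at `a w`; the value `a w = -1` means that it
survives to `V 0`. The members `ω w s` of a bar are related by the structure maps, and at each
index the members of the bars that are alive form a basis; those of the bars that die on the way to
an index `c` form a basis of the kernel of the map to `V c`. -/
theorem exists_bars {V : ℤ → Type u} [∀ s, AddCommGroup (V s)] [∀ s, Module ℝ (V s)]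
    [∀ s, Module.Finite ℝ (V s)] (i : ∀ s t, s ≤ t → V t →ₗ[ℝ] V s)
    (hi : ∀ s h x, i s s h x = x)
    (hi' : ∀ r s t hrs hst hrt x, i r s hrs (i s t hst x) = i r t hrt x) (l : ℕ)
    [Subsingleton (V l)] :
    ∃ (W : Type u) (_ : Finite W) (t a : W → ℤ) (ω : W → ∀ s, V s),
      (∀ w, -1 ≤ a w ∧ a w < t w ∧ 0 ≤ t w ∧ t w < l) ∧
      (∀ w s s' (h : s ≤ s'), s' ≤ t w → i s s' h (ω w s') = ω w s) ∧
      (∀ w s, 0 ≤ s → s ≤ a w → ω w s = 0) ∧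
      (∀ b : ℤ, 0 ≤ b → b ≤ l → BasisOf (fun w : {w | a w < b ∧ b ≤ t w} => ω w b) ⊤) ∧
      ∀ (c b : ℤ) (h : c ≤ b), 0 ≤ c → b ≤ l →
        BasisOf (fun w : {w | c ≤ a w ∧ a w < b ∧ b ≤ t w} => ω w b) (LinearMap.ker (i c b h)) := by
  classical
  let K : ∀ b : ℤ, ℤ → Submodule ℝ (V b) := fun b a =>
    if h : 0 ≤ a then (if h' : a ≤ b then LinearMap.ker (i a b h') else ⊥) else ⊤
  have hK0 : ∀ b a h, 0 ≤ a → K b a = LinearMap.ker (i a b h) := fun b a h h0 => by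
    simp only [K]
    rw [dif_pos h0, dif_pos h]
  have hKneg : ∀ b a, a < 0 → K b a = ⊤ := fun b a h => dif_neg (by omega)
  have hKanti : ∀ b, 0 ≤ b → Antitone (K b) := by
    intro b hb a a' haa
    rcases lt_or_ge a 0 with h | h
    · rw [hKneg b a h]
      exact le_top
    rcases le_or_gt a' b with h' | h'
    · rw [hK0 b a (haa.trans h') h, hK0 b a' h' (h.trans haa)]
      intro x hx
      rw [LinearMap.mem_ker, ← hi' a a' b haa h', (LinearMap.mem_ker.1 hx), map_zero]
    · have : K b a' = ⊥ := by
        simp only [K]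
        rw [dif_pos (h.trans haa), dif_neg (by omega)]
      rw [this]
      exact bot_le
  have hKb : ∀ b, 0 ≤ b → K b b = ⊥ := fun b hb => by
    rw [hK0 b b le_rfl hb, LinearMap.ker_eq_bot']
    exact fun x hx => by rwa [hi] at hx
  let I : ∀ b : ℤ, Submodule ℝ (V b) := fun b => LinearMap.range (i b (b + 1) (by omega))
  choose J hJ α v hα hv using fun b : {b : ℤ // 0 ≤ b} =>
    exists_filtered_complement (I b) (K b) (hKanti b b.2) b (hKb b b.2)
  let W := Σ b : Finset.Ico (0 : ℤ) l, J ⟨b, (Finset.mem_Ico.1 b.2).1⟩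
  let t : W → ℤ := fun w => w.1
  let a : W → ℤ := fun w => α _ w.2
  let ω : W → ∀ s, V s := fun w s => if h : s ≤ t w then i s (t w) h (v _ w.2) else 0
  have hω : ∀ w s h, ω w s = i s (t w) h (v _ w.2) := fun w s h => dif_pos h
  have hbd : ∀ w, -1 ≤ a w ∧ a w < t w ∧ 0 ≤ t w ∧ t w < l := fun w =>
    ⟨(hα _ w.2).1, (hα _ w.2).2, Finset.mem_Ico.1 w.1.2⟩
  have hcomp : ∀ w s s' (h : s ≤ s'), s' ≤ t w → i s s' h (ω w s') = ω w s := fun w s s' h h' => by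
    rw [hω w s' h', hω w s (h.trans h'), hi']
  have hmem : ∀ w, v _ w.2 ∈ K (t w) (a w) := fun w => by
    obtain ⟨X, hX, hX', -, -⟩ := hv _ (a w) (hα _ w.2).1 (hα _ w.2).2.le
    exact hX (hX'.mem ⟨w.2, le_refl (a w)⟩)
  have hzero : ∀ w s, 0 ≤ s → s ≤ a w → ω w s = 0 := fun w s hs hsa => by
    rw [hω w s (hsa.trans (hbd w).2.1.le)]
    have h1 := hmem w
    rw [hK0 _ _ (hbd w).2.1.le (hs.trans hsa)] at h1
    rw [← hi' s (a w) (t w) hsa (hbd w).2.1.le, LinearMap.mem_ker.1 h1, map_zero]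
  -- the bars that are born at `b`
  have hborn : ∀ b : ℤ, 0 ≤ b → b < l → ∀ c, -1 ≤ c → c ≤ b → ∃ X ≤ K b c,
      BasisOf (fun w : {w | c ≤ a w ∧ t w = b} => ω w b) X ∧
      Disjoint (I b) X ∧ I b ⊔ X = I b ⊔ K b c := by
    intro b hb hbl c hc hcb
    obtain ⟨X, hX, hX', hX''⟩ := hv ⟨b, hb⟩ c hc hcb
    refine ⟨X, hX, ?_, hX''⟩
    let e : {j | c ≤ α ⟨b, hb⟩ j} ≃ {w | c ≤ a w ∧ t w = b} := Equiv.ofBijective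
      (fun j => ⟨⟨⟨b, Finset.mem_Ico.2 ⟨hb, hbl⟩⟩, j.1⟩, j.2, rfl⟩) (by
        constructor
        · intro j j' h
          have h1 := congrArg Subtype.val h
          exact Subtype.ext (eq_of_heq (Sigma.mk.inj h1).2)
        · rintro ⟨⟨⟨b', h'⟩, j⟩, hj, rfl⟩
          exact ⟨⟨j, hj⟩, rfl⟩)
    have h2 := hX'.comp_equiv e.symm
    have h3 : (fun j : {j | c ≤ α ⟨b, hb⟩ j} => v ⟨b, hb⟩ j) ∘ e.symm =
        fun w : {w | c ≤ a w ∧ t w = b} => ω w b := by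
      funext w
      obtain ⟨j, rfl⟩ := e.surjective w
      rw [Function.comp_apply, e.symm_apply_apply]
      exact ((hω (e j).1 b le_rfl).trans (hi _ _ _)).symm
    rwa [h3] at h2
  have hmain : ∀ b : ℤ, 0 ≤ b → b ≤ l → ∀ c, -1 ≤ c → c ≤ b →
      BasisOf (fun w : {w | c ≤ a w ∧ a w < b ∧ b ≤ t w} => ω w b) (K b c) := by
    intro b hb hbl
    obtain ⟨k, rfl⟩ : ∃ k : ℕ, b = l - k := ⟨(l - b).toNat, by omega⟩
    clear hbl
    induction k with
    | zero =>
      intro c hc hcb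
      rw [Nat.cast_zero, sub_zero]
      have : IsEmpty {w | c ≤ a w ∧ a w < l ∧ (l : ℤ) ≤ t w} :=
        ⟨fun w => (hbd w.1).2.2.2.not_ge w.2.2.2⟩
      rw [show K l c = ⊥ from Subsingleton.elim _ _]
      exact BasisOf.of_isEmpty
    | succ k ih =>
      obtain ⟨b, hb'⟩ : ∃ b : ℤ, b = l - (k + 1 : ℕ) := ⟨_, rfl⟩
      have h2 : l - k = b + 1 := by push_cast at hb'; omega
      rw [h2] at ih
      rw [← hb'] at hb ⊢
      replace ih := ih (by omega)
      intro c hc hcb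
      have h3 : (K (b + 1) c) ⊓ LinearMap.ker (i b (b + 1) (by omega)) = K (b + 1) b := by
        rw [← hK0 (b + 1) b _ hb]
        exact inf_eq_right.2 (hKanti (b + 1) (by omega) hcb)
      have h4 : (K (b + 1) c).map (i b (b + 1) (by omega)) = I b ⊓ K b c := by
        rcases lt_or_ge c 0 with h | h
        · rw [hKneg _ _ h, hKneg _ _ h, inf_top_eq, ← LinearMap.range_eq_map]
        · rw [hK0 b c hcb h, hK0 (b + 1) c (by omega) h]
          ext x
          constructor
          · rintro ⟨y, hy, rfl⟩
            refine ⟨⟨y, rfl⟩, ?_⟩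
            exact (hi' c b (b + 1) hcb _ (by omega) y).trans hy
          · rintro ⟨⟨y, rfl⟩, hy⟩
            exact ⟨y, (hi' c b (b + 1) hcb _ (by omega) y).symm.trans hy, rfl⟩
      have h5 := BasisOf.image_of_ker (f := fun w => ω w (b + 1))
        (t := {w | c ≤ a w ∧ a w < b ∧ b + 1 ≤ t w}) (i b (b + 1) (by omega))
        (ih c hc (by omega)) (h3.symm ▸ ih b (by omega) (by omega))
        (by
          ext w
          simp only [Set.mem_ofPred_eq, Set.mem_union]
          omega)
        (by
          rw [Set.disjoint_left]
          rintro w ⟨h1, -⟩ ⟨-, h2, -⟩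
          omega)
      rw [h4] at h5
      have h6 : (fun w : {w | c ≤ a w ∧ a w < b ∧ b + 1 ≤ t w} =>
          i b (b + 1) (by omega) (ω w (b + 1))) =
          fun w : {w | c ≤ a w ∧ a w < b ∧ b + 1 ≤ t w} => ω w b :=
        funext fun w => hcomp _ _ _ _ w.2.2.2
      rw [h6] at h5
      obtain ⟨X, hX, hX', hX'', hX3⟩ := hborn b hb (by push_cast at hb'; omega) c hc hcb
      have h7 := BasisOf.union (f := fun w => ω w b) h5 hX' (hX''.mono_left inf_le_left)
      have h8 : {w | c ≤ a w ∧ a w < b ∧ b ≤ t w} =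
          {w | c ≤ a w ∧ a w < b ∧ b + 1 ≤ t w} ∪ {w | c ≤ a w ∧ t w = b} := by
        ext w
        have := hbd w
        simp only [Set.mem_ofPred_eq, Set.mem_union]
        omega
      have h9 : K b c = I b ⊓ K b c ⊔ X := by
        rw [inf_comm, inf_sup_assoc_of_le _ hX, hX3]
        exact (inf_eq_left.2 le_sup_right).symm
      rwa [← h8, ← h9] at h7
  refine ⟨W, inferInstance, t, a, ω, hbd, hcomp, hzero, fun b hb hbl => ?_, fun c b hcb hc hb => ?_⟩
  swap
  · have h1 := hmain b (hc.trans hcb) hb c (by omega) hcb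
    rwa [hK0 b c hcb hc] at h1
  have h1 := hmain b hb hbl (-1) le_rfl (by omega)
  rw [hKneg _ _ (by omega)] at h1
  have h2 : {w | -1 ≤ a w ∧ a w < b ∧ b ≤ t w} = {w | a w < b ∧ b ≤ t w} := by
    ext w
    have := hbd w
    simp only [Set.mem_ofPred_eq]
    omega
  rwa [h2] at h1

/-! ### Bases and set operations -/

namespace BasisOf

variable {V W ι : Type*} [AddCommGroup V] [Module ℝ V] [AddCommGroup W] [Module ℝ W]

theorem inf {f : ι → V} {s t : Set ι} {S T : Submodule ℝ V}
    (hs : BasisOf (fun i : s => f i) S) (ht : BasisOf (fun i : t => f i) T)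
    (hst : LinearIndepOn ℝ f (s ∪ t)) : BasisOf (fun i : ↥(s ∩ t) => f i) (S ⊓ T) := by
  rw [on_iff] at hs ht ⊢
  refine ⟨hs.1.mono Set.inter_subset_left, le_antisymm ?_ ?_⟩
  · rw [← hs.2, ← ht.2]
    exact le_inf (Submodule.span_mono (Set.image_mono Set.inter_subset_left))
      (Submodule.span_mono (Set.image_mono Set.inter_subset_right))
  · rintro x ⟨hx, hx'⟩
    have h1 : Disjoint (Submodule.span ℝ (f '' (s \ t))) (Submodule.span ℝ (f '' t)) := by
      rw [← Set.sdiff_union_self] at hst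
      exact ((linearIndepOn_union_iff Set.disjoint_sdiff_left).1 hst).2.2
    rw [SetLike.mem_coe, ← hs.2, ← Set.inter_union_sdiff s t, Set.image_union,
      Submodule.span_union] at hx
    obtain ⟨y, hy, z, hz, rfl⟩ := Submodule.mem_sup.1 hx
    have h2 : y ∈ Submodule.span ℝ (f '' t) :=
      Submodule.span_mono (Set.image_mono Set.inter_subset_right) hy
    rw [SetLike.mem_coe, ← ht.2] at hx'
    have h3 : z ∈ Submodule.span ℝ (f '' t) := by
      have := Submodule.sub_mem _ hx' h2
      rwa [add_sub_cancel_left] at this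
    rw [Submodule.disjoint_def.1 h1 z hz h3, add_zero]
    exact hy

/-- The image of the span of a part of a basis of `V`, where another part is a basis of the
kernel. -/
theorem map_diff {f : ι → V} {u k s : Set ι} {S : Submodule ℝ V} (g : V →ₗ[ℝ] W)
    (hu : BasisOf (fun i : u => f i) ⊤) (hk : BasisOf (fun i : k => f i) (LinearMap.ker g))
    (hs : BasisOf (fun i : s => f i) S) (hku : k ⊆ u) (hsu : s ⊆ u) :
    BasisOf (fun i : ↥(s \ k) => g (f i)) (S.map g) := by
  have h1 := hu.image_of_ker (s := k) (t := u \ k) g (by rwa [top_inf_eq])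
    (Set.union_sdiff_cancel hku).symm Set.disjoint_sdiff_right
  have h2 := (on_iff (f := fun i => g (f i))).1 h1
  refine (on_iff (f := fun i => g (f i))).2 ⟨h2.1.mono (Set.sdiff_subset_sdiff_left hsu), ?_⟩
  rw [on_iff] at hs
  rw [← hs.2, ← Submodule.span_image, Set.image_image]
  refine le_antisymm (Submodule.span_mono (Set.image_mono Set.sdiff_subset)) ?_
  rw [Submodule.span_le]
  rintro _ ⟨i, hi, rfl⟩
  by_cases hik : i ∈ k
  · have h3 : g (f i) = 0 := hk.mem ⟨i, hik⟩
    rw [SetLike.mem_coe]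
    simp only [h3]
    exact Submodule.zero_mem _
  · exact Submodule.subset_span ⟨i, ⟨hi, hik⟩, rfl⟩

/-- A basis of a preimage. -/
theorem comap {f : ι → V} {s t : Set ι} (q : V →ₗ[ℝ] W) (R : Submodule ℝ W)
    (hs : BasisOf (fun i : s => f i) (LinearMap.ker q))
    (ht : BasisOf (fun i : t => q (f i)) (LinearMap.range q ⊓ R)) :
    BasisOf (fun i : ↥(s ∪ t) => f i) (R.comap q) := by
  have h1 : LinearIndependent ℝ (fun i : t => f i) := LinearIndependent.of_comp q ht.li
  have h2 : BasisOf (fun i : t => f i) (Submodule.span ℝ (Set.range fun i : t => f i)) := ⟨h1, rfl⟩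
  have h3 : Disjoint (LinearMap.ker q) (Submodule.span ℝ (Set.range fun i : t => f i)) :=
    (Submodule.range_ker_disjoint ht.li).symm
  have h4 : R.comap q = LinearMap.ker q ⊔ Submodule.span ℝ (Set.range fun i : t => f i) := by
    refine le_antisymm (fun x hx => ?_) (sup_le (fun x hx => ?_) ?_)
    · have h5 : q x ∈ LinearMap.range q ⊓ R := ⟨⟨x, rfl⟩, hx⟩
      rw [← ht.span] at h5
      have h6 : (fun i : t => q (f i)) = q ∘ fun i : t => f i := rfl
      rw [h6, Set.range_comp, Submodule.span_image] at h5
      obtain ⟨y, hy, hyx⟩ := h5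
      have h7 : x = (x - y) + y := by abel
      rw [h7]
      refine Submodule.add_mem_sup ?_ hy
      rw [LinearMap.mem_ker, map_sub, hyx, sub_self]
    · rw [Submodule.mem_comap, LinearMap.mem_ker.1 hx]
      exact R.zero_mem
    · rw [Submodule.span_le]
      rintro _ ⟨i, rfl⟩
      exact (ht.mem i).2
  rw [h4]
  exact hs.union h2 h3

theorem congr_set (f : ι → V) {s t : Set ι} {S : Submodule ℝ V}
    (h : BasisOf (fun i : s => f i) S) (hst : s = t) : BasisOf (fun i : t => f i) S := hst ▸ h

theorem of_subsingleton [Subsingleton V] [IsEmpty ι] (f : ι → V) (S : Submodule ℝ V) :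
    BasisOf f S := by
  rw [show S = ⊥ from Subsingleton.elim _ _]
  exact of_isEmpty

end BasisOf

/-! ### The exact sequences of the filtration -/

namespace Filtration

open Subcomplex

variable {C : RealComplex.{u}} (F : Filtration C)

/-- The map `Hⁿ(F_t) → Hⁿ(F_s)` for `s ≤ t`. -/
noncomputable def incl (n s t : ℤ) (h : s ≤ t) :
    (F.F t).toCx.homology n →ₗ[ℝ] (F.F s).toCx.homology n :=
  (HomologicalComplex.homologyMap (inclusion (F.anti s t h)) n).hom

/-- The map `Hⁿ(F_s) → Hⁿ(F_s / F_t)` for `s ≤ t`. -/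
noncomputable def proj (n s t : ℤ) : (F.F s).toCx.homology n →ₗ[ℝ]
    ((F.F s).quot (F.F t)).homology n :=
  (HomologicalComplex.homologyMap ((F.F s).π (F.F t)) n).hom

/-- The connecting homomorphism `Hⁿ(F_s / F_t) → Hⁿ⁺¹(F_t)` for `s ≤ t`. -/
noncomputable def conn (n n' s t : ℤ) (h : s ≤ t) (hn : n + 1 = n') :
    ((F.F s).quot (F.F t)).homology n →ₗ[ℝ] (F.F t).toCx.homology n' :=
  ((pairSeq_shortExact (F.anti s t h)).δ n n' hn).hom

theorem incl_refl (n s : ℤ) (h : s ≤ s) (x) : F.incl n s s h x = x := by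
  have h1 : inclusion (F.anti s s h) = 𝟙 _ := rfl
  rw [incl, h1, HomologicalComplex.homologyMap_id]
  rfl

theorem incl_incl (n r s t : ℤ) (hrs : r ≤ s) (hst : s ≤ t) (hrt : r ≤ t) (x) :
    F.incl n r s hrs (F.incl n s t hst x) = F.incl n r t hrt x := by
  have h1 : inclusion (F.anti s t hst) ≫ inclusion (F.anti r s hrs) =
    inclusion (F.anti r t hrt) := rfl
  rw [incl, incl, incl, ← h1, HomologicalComplex.homologyMap_comp]
  rfl

theorem ker_proj (n s t : ℤ) (h : s ≤ t) :
    LinearMap.ker (F.proj n s t) = LinearMap.range (F.incl n s t h) :=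
  LinearMap.exact_iff.1 ((ShortComplex.ShortExact.moduleCat_exact_iff_function_exact _).1
    ((pairSeq_shortExact (F.anti s t h)).homology_exact₂ n))

theorem ker_conn (n n' s t : ℤ) (h : s ≤ t) (hn : n + 1 = n') :
    LinearMap.ker (F.conn n n' s t h hn) = LinearMap.range (F.proj n s t) :=
  LinearMap.exact_iff.1 ((ShortComplex.ShortExact.moduleCat_exact_iff_function_exact _).1
    ((pairSeq_shortExact (F.anti s t h)).homology_exact₃ n n' hn))

theorem ker_incl (n n' s t : ℤ) (h : s ≤ t) (hn : n + 1 = n') :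
    LinearMap.ker (F.incl n' s t h) = LinearMap.range (F.conn n n' s t h hn) :=
  LinearMap.exact_iff.1 ((ShortComplex.ShortExact.moduleCat_exact_iff_function_exact _).1
    ((pairSeq_shortExact (F.anti s t h)).homology_exact₁ n n' hn))

/-- The boundary operator of the filtration quotients factors through `Hⁿ⁺¹(F_s)`. -/
theorem bMap_eq (p s n n' : ℤ) (h : p ≤ s) (hn : n + 1 = n') (x) :
    F.bMap p s n n' h hn x = F.proj n' s (s + 1) (F.conn n n' p s h hn x) := by
  let φ : pairSeq (F.anti p s h) ⟶ quotSeq (F.anti p s h) (F.anti s (s + 1) (by omega)) :=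
    { τ₁ := (F.F s).π (F.F (s + 1))
      τ₂ := (F.F p).π (F.F (s + 1))
      τ₃ := 𝟙 _ }
  have h3 := HomologicalComplex.HomologySequence.δ_naturality φ (pairSeq_shortExact _)
    (quotSeq_shortExact (F.anti p s h) (F.anti s (s + 1) (by omega))) n n' hn
  have h4 := congrArg (fun g => g.hom x) h3
  refine Eq.trans ?_ h4.symm
  have h6 : HomologicalComplex.homologyMap φ.τ₃ n = 𝟙 _ :=
    HomologicalComplex.homologyMap_id _ _
  rw [h6]
  rfl

/-- Naturality of the connecting homomorphism in the subcomplex. -/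
theorem incl_conn (p s n n' : ℤ) (h : p < s) (h' : p + 1 ≤ s) (hn : n + 1 = n') (x) :
    F.incl n' (p + 1) s h' (F.conn n n' p s h.le hn x) =
      F.conn n n' p (p + 1) (by omega) hn (F.zMap p s n h x) := by
  let φ : pairSeq (F.anti p s h.le) ⟶ pairSeq (F.anti p (p + 1) (by omega)) :=
    { τ₁ := inclusion (F.anti (p + 1) s h)
      τ₂ := 𝟙 _
      τ₃ := quotMap (F.F p).le_refl' (F.anti (p + 1) s h)
      comm₁₂ := rfl
      comm₂₃ := rfl }
  have h3 := HomologicalComplex.HomologySequence.δ_naturality φ (pairSeq_shortExact _)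
    (pairSeq_shortExact _) n n' hn
  exact congrArg (fun g => g.hom x) h3

theorem mem_Z_iff (r : ℕ+) (p s n n' : ℤ) (hs : p + r = s) (hn : n + 1 = n') (x) :
    x ∈ F.Z r p n ↔ F.conn n n' p (p + 1) (by omega) hn x ∈
      LinearMap.range (F.incl n' (p + 1) s (by have := r.pos; omega)) := by
  have hr := r.pos
  have hps : p < s := by omega
  rw [F.Z_eq r p s n hs]
  constructor
  · rintro ⟨y, rfl⟩
    exact ⟨_, F.incl_conn p s n n' hps hps hn y⟩
  · rintro ⟨y, hy⟩
    have h1 : y ∈ LinearMap.ker (F.incl n' p s hps.le) := by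
      rw [LinearMap.mem_ker, ← F.incl_incl n' p (p + 1) s (by omega) hps, hy]
      have h2 : F.conn n n' p (p + 1) (by omega) hn x ∈ LinearMap.ker (F.incl n' p (p + 1)
        (by omega)) := by
        rw [F.ker_incl n n' p (p + 1) _ hn]
        exact ⟨x, rfl⟩
      exact h2
    rw [F.ker_incl n n' p s _ hn] at h1
    obtain ⟨z, rfl⟩ := h1
    rw [F.incl_conn p s n n' hps] at hy
    have h2 : x - F.zMap p s n hps z ∈ LinearMap.ker (F.conn n n' p (p + 1) (by omega) hn) := by
      rw [LinearMap.mem_ker, map_sub, hy, sub_self]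
    rw [F.ker_conn] at h2
    obtain ⟨w, hw⟩ := h2
    refine ⟨z + F.proj n p s w, ?_⟩
    have h3 : F.zMap p s n hps (F.proj n p s w) = F.proj n p (p + 1) w := by
      have h4 : (F.F p).π (F.F s) ≫ quotMap (F.F p).le_refl' (F.anti (p + 1) s hps) =
        (F.F p).π (F.F (p + 1)) := rfl
      rw [proj, proj, ← h4, HomologicalComplex.homologyMap_comp]
      rfl
    rw [map_add, h3, hw]
    abel

theorem B_eq_map (r : ℕ+) (t p n : ℤ) (ht : t + r = p + 1) :
    F.B r p n = (LinearMap.ker (F.incl n t p (by have := r.pos; omega))).map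
      (F.proj n p (p + 1)) := by
  have hr := r.pos
  rw [F.B_eq r t p (n - 1) n ht (by omega), F.ker_incl (n - 1) n t p _ (by omega)]
  rw [← LinearMap.range_comp]
  congr 1
  exact LinearMap.ext fun x => F.bMap_eq t p (n - 1) n (by omega) _ x

theorem ZInf_eq (p n : ℤ) : F.ZInf p n = LinearMap.range (F.proj n p (p + 1)) := rfl

/-- The map `Hⁿ(F_0) → Hⁿ(C)`. -/
noncomputable def toC (n : ℤ) : (F.F 0).toCx.homology n →ₗ[ℝ] C.homology n :=
  (HomologicalComplex.homologyMap F.isoZero.hom n).hom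

theorem toC_bijective (n : ℤ) : Function.Bijective (F.toC n) :=
  ⟨homologyMap_injective (HomotopyEquiv.ofIso F.isoZero) n,
    homologyMap_surjective (HomotopyEquiv.ofIso F.isoZero) n⟩

theorem toC_incl (n p : ℤ) (hp : 0 ≤ p) (x) : F.toC n (F.incl n 0 p hp x) =
    (HomologicalComplex.homologyMap (F.F p).ι n).hom x := by
  have h1 : inclusion (F.anti 0 p hp) ≫ F.isoZero.hom = (F.F p).ι := rfl
  rw [← h1, HomologicalComplex.homologyMap_comp]
  rfl

theorem FH_eq (p n : ℤ) (hp : 0 ≤ p) :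
    F.FH p n = (LinearMap.range (F.incl n 0 p hp)).map (F.toC n) := by
  rw [← LinearMap.range_comp]
  exact congrArg LinearMap.range (LinearMap.ext fun x => (F.toC_incl n p hp x).symm)

/-- The connecting homomorphism `Hⁿ(C / F_p) → Hⁿ⁺¹(F_p)`. -/
noncomputable def connTop (n n' p : ℤ) (hn : n + 1 = n') :
    ((⊤ : Subcomplex C).quot (F.F p)).homology n →ₗ[ℝ] (F.F p).toCx.homology n' :=
  ((subSeq_shortExact (F.F p)).δ n n' hn).hom

theorem range_connTop (n n' p : ℤ) (hn : n + 1 = n') (hp : 0 ≤ p) :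
    LinearMap.range (F.connTop n n' p hn) = LinearMap.ker (F.incl n' 0 p hp) := by
  have h1 : Function.Exact (F.connTop n n' p hn)
      (HomologicalComplex.homologyMap (F.F p).ι n').hom :=
    (ShortComplex.ShortExact.moduleCat_exact_iff_function_exact _).1
      ((subSeq_shortExact (F.F p)).homology_exact₁ n n' hn)
  rw [← LinearMap.exact_iff.1 h1]
  ext x
  rw [LinearMap.mem_ker, LinearMap.mem_ker, ← (F.toC_bijective n').1.eq_iff, map_zero, F.toC_incl]

theorem BInf_eq (p n : ℤ) (hp : 0 ≤ p) :
    F.BInf p n = (LinearMap.ker (F.incl n 0 p hp)).map (F.proj n p (p + 1)) := by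
  rw [← F.range_connTop (n - 1) n p (by omega), ← LinearMap.range_comp]
  refine congrArg LinearMap.range (LinearMap.ext fun x => ?_)
  let φ : subSeq (F.F p) ⟶ quotSeq (F.F p).le_top' (F.anti p (p + 1) (by omega)) :=
    { τ₁ := (F.F p).π (F.F (p + 1))
      τ₂ := (F.F (p + 1)).πTop
      τ₃ := 𝟙 _ }
  have h3 := HomologicalComplex.HomologySequence.δ_naturality φ (subSeq_shortExact (F.F p))
    (quotSeq_shortExact (F.F p).le_top' (F.anti p (p + 1) (by omega))) (n - 1) n (by simp)
  have h4 := congrArg (fun g => g.hom x) h3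
  refine Eq.trans ?_ h4.symm
  have h6 : HomologicalComplex.homologyMap φ.τ₃ (n - 1) = 𝟙 _ :=
    HomologicalComplex.homologyMap_id _ _
  rw [h6]
  rfl

theorem ker_incl_of_neg (n s p : ℤ) (hs : s ≤ 0) (hp : 0 ≤ p) (h : s ≤ p) :
    LinearMap.ker (F.incl n s p h) = LinearMap.ker (F.incl n 0 p hp) := by
  have h1 : F.F s ≤ F.F 0 := by rw [F.eq_top s hs, F.eq_top 0 le_rfl]; exact le_refl' _
  ext x
  rw [LinearMap.mem_ker, LinearMap.mem_ker, ← F.incl_incl n s 0 p hs hp h]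
  constructor
  · intro hx
    have h2 := congrArg (HomologicalComplex.homologyMap (inclusion h1) n).hom hx
    rw [map_zero] at h2
    have h3 : inclusion (F.anti s 0 hs) ≫ inclusion h1 = 𝟙 _ := rfl
    have h4 := congrArg (fun g : (F.F 0).toCx ⟶ (F.F 0).toCx =>
      (HomologicalComplex.homologyMap g n).hom (F.incl n 0 p hp x)) h3
    simp only [HomologicalComplex.homologyMap_comp, HomologicalComplex.homologyMap_id] at h4
    exact h4.symm.trans h2
  · intro hx
    rw [hx, map_zero]

/-- If `ξ ∈ Hⁿ(F_p / F_{p+1})` has boundary equal to the image of `η ∈ Hⁿ⁺¹(F_{p+r})`, then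
`d_r` sends the class of `ξ` to the class of `η`. -/
theorem dE_mk (r : ℕ+) (p s n n' : ℤ) (hs : p + r = s) (hn : n + 1 = n')
    (ξ : (F.gr p).homology n) (hξ : ξ ∈ F.Z r p n) (η : (F.F s).toCx.homology n')
    (hη : F.conn n n' p (p + 1) (by omega) hn ξ = F.incl n' (p + 1) s (by have := r.pos; omega) η)
    (hη' : F.proj n' s (s + 1) η ∈ F.Z r s n') :
    F.dE r p s n n' hs hn (Submodule.Quotient.mk ⟨ξ, hξ⟩) =
      Submodule.Quotient.mk ⟨F.proj n' s (s + 1) η, hη'⟩ := by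
  have hr := r.pos
  have hps : p < s := by omega
  have h0 := hξ
  rw [F.Z_eq r p s n hs] at h0
  obtain ⟨x, rfl⟩ := h0
  have h1 : F.dE r p s n n' hs hn (Submodule.Quotient.mk ⟨F.zMap p s n hps x, hξ⟩) =
      Submodule.Quotient.mk ⟨F.bMap p s n n' hps.le hn x, by
        refine F.range_bMap_le_range_zMap p s (s + r) n n' hps.le (by omega) hn ⟨x, rfl⟩⟩ := by
    simp only [dE, LinearMap.comp_apply]
    have h2 : subquotMap (F.Z_eq r p s n hs).le
      (F.range_bMap_le_range_zMap (p - r + 1) p (s + 1) (n - 1) n (by omega) (by omega)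
        (by omega)) (Submodule.Quotient.mk ⟨F.zMap p s n hps x, hξ⟩) =
      Submodule.Quotient.mk ⟨F.zMap p s n hps x, x, rfl⟩ := rfl
    have h3 := imageMap_mk (F.zMap p s n hps) (F.bMap p s n n' hps.le hn) _ _
      (F.bMap_mem p s n n' hps hn) x
    refine (congrArg _ (congrArg _ h2)).trans ?_
    exact congrArg _ h3
  rw [h1]
  refine (Submodule.Quotient.eq _).2 ?_
  change F.bMap p s n n' hps.le hn x - F.proj n' s (s + 1) η ∈ F.B r s n'
  rw [F.bMap_eq, ← map_sub, F.B_eq_map r (p + 1) s n' (by omega)]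
  refine ⟨_, ?_, rfl⟩
  rw [SetLike.mem_coe, LinearMap.mem_ker, map_sub, F.incl_conn p s n n' hps, hη, sub_self]

end Filtration

/-! ### Bases of the spectral sequence -/

namespace BasisOf

variable {V W ι κ : Type*} [AddCommGroup V] [Module ℝ V] [AddCommGroup W] [Module ℝ W]

theorem image {f : ι → V} {φ : κ → ι} (hφ : Function.Injective φ) {s : Set κ} {S : Submodule ℝ V}
    (h : BasisOf (fun i : s => f (φ i)) S) : BasisOf (fun i : ↥(φ '' s) => f i) S := by
  have h1 := h.comp_equiv (Equiv.Set.image φ s hφ).symm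
  have h2 : (fun i : s => f (φ i)) ∘ (Equiv.Set.image φ s hφ).symm = fun i : ↥(φ '' s) => f i := by
    funext i
    obtain ⟨j, rfl⟩ := (Equiv.Set.image φ s hφ).surjective i
    rw [Function.comp_apply, Equiv.symm_apply_apply]
    rfl
  rwa [h2] at h1

end BasisOf

namespace Filtration

open Subcomplex

variable {C : RealComplex.{u}} (F : Filtration C)

/-- An interval decomposition of the cohomologies of the members of a filtration with `F_l = 0`.
The bar `w` in degree `n` is born at `t w` and dies at `a w`: it consists of the classes `ω w s` for
`a w < s ≤ t w`. Bars with `a w = -1` never die; they give a basis of the cohomology of `C`. If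
`0 ≤ a w`, then the last non-zero class of the bar, which lies in the cohomology of `F_{a w + 1}`,
is the boundary of the class `kap n w (a w)` in the cohomology of `F_{a w} / F_{a w + 1}`. The values
of `ω w s` for `s > t w` and of `kap n w p` for `p ≠ a w` carry no meaning. -/
structure Bars (l : ℕ) where
  W : ℤ → Type u
  finite : ∀ n, Finite (W n)
  t : ∀ {n}, W n → ℤ
  a : ∀ {n}, W n → ℤ
  ω : ∀ {n}, W n → ∀ s, (F.F s).toCx.homology n
  kap : ∀ n, W (n + 1) → ∀ p, (F.gr p).homology n
  bounds : ∀ {n} (w : W n), -1 ≤ a w ∧ a w < t w ∧ 0 ≤ t w ∧ t w < l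
  incl_ω : ∀ {n} (w : W n) (s s' : ℤ) (h : s ≤ s'), s' ≤ t w → F.incl n s s' h (ω w s') = ω w s
  basis : ∀ (n b : ℤ), 0 ≤ b → b ≤ l →
    BasisOf (fun w : {w : W n | a w < b ∧ b ≤ t w} => ω w.1 b) ⊤
  basis_ker : ∀ (n c b : ℤ) (h : c ≤ b), 0 ≤ c → b ≤ l →
    BasisOf (fun w : {w : W n | c ≤ a w ∧ a w < b ∧ b ≤ t w} => ω w.1 b)
      (LinearMap.ker (F.incl n c b h))
  conn_kap : ∀ n (w : W (n + 1)) (p : ℤ), a w = p → 0 ≤ p →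
    F.conn n (n + 1) p (p + 1) (by omega) rfl (kap n w p) = ω w (p + 1)
  bounded : ∃ N : ℕ, ∀ n : ℤ, (N : ℤ) ≤ |n| → IsEmpty (W n)

variable {F}

theorem subsingleton_homology_of_le (l : ℕ) (hl : F.F l = ⊥) (s n : ℤ) (hs : l ≤ s) :
    Subsingleton ((F.F s).toCx.homology n) := by
  have : Subsingleton ((F.F s).toCx.X n) := by
    rw [F.eq_bot_of_le l hl s hs]
    exact inferInstanceAs (Subsingleton (⊥ : Submodule ℝ (C.X n)))
  have := (IsClass.iCycles_injective (F.F s).toCx n).subsingleton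
  exact (IsClass.homologyπ_surjective (F.F s).toCx n).subsingleton

theorem subsingleton_gr (l : ℕ) (hl : F.F l = ⊥) (p n : ℤ) (hp : p < 0 ∨ l ≤ p) :
    Subsingleton ((F.gr p).homology n) := by
  refine F.subsingleton_homology_gr p n ?_
  rcases hp with h | h
  · rw [F.eq_top _ h.le, F.eq_top _ (by omega)]
  · rw [F.eq_bot_of_le l hl _ h, F.eq_bot_of_le l hl _ (by omega)]

theorem nonempty_bars (l : ℕ) (hl : F.F l = ⊥) (σ : ∀ p, SimpleStructure (F.gr p)) :
    Nonempty (F.Bars l) := by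
  have hrep : ∀ s : ℤ, s ≤ l → Nonempty (SimpleRep (F.F s).toCx) := fun s hs => by
    obtain ⟨τ, -⟩ := F.exists_isPreferredAt l hl σ s hs
    obtain ⟨u, -⟩ := τ.exists_rep
    exact ⟨u⟩
  have hfin : ∀ s n : ℤ, Module.Finite ℝ ((F.F s).toCx.homology n) := fun s n => by
    rcases le_total s l with h | h
    · exact (hrep s h).some.finite_homology n
    · have := subsingleton_homology_of_le l hl s n h
      exact Module.Finite.of_surjective (0 : ℝ →ₗ[ℝ] _) fun x => ⟨0, Subsingleton.elim _ _⟩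
  have hbars := fun n => by
    have := fun s => hfin s n
    have := subsingleton_homology_of_le l hl l n le_rfl
    exact exists_bars (V := fun s => (F.F s).toCx.homology n) (F.incl n) (F.incl_refl n)
      (F.incl_incl n) l
  choose W hW t a ω hbd hincl hzero hbasis hker using hbars
  have hkap : ∀ n (w : W (n + 1)) (p : ℤ), ∃ κ : (F.gr p).homology n, a _ w = p → 0 ≤ p →
      F.conn n (n + 1) p (p + 1) (by omega) rfl κ = ω _ w (p + 1) := by
    intro n w p
    by_cases h : a _ w = p ∧ 0 ≤ p
    · have h1 : ω _ w (p + 1) ∈ LinearMap.ker (F.incl (n + 1) p (p + 1) (by omega)) := by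
        have h2 := hbd _ w
        have h3 := hincl _ w p (p + 1) (by omega) (by omega)
        rw [hzero _ w p h.2 h.1.ge] at h3
        exact h3
      rw [F.ker_incl n (n + 1) p (p + 1) _ rfl] at h1
      obtain ⟨κ, hκ⟩ := h1
      exact ⟨κ, fun _ _ => hκ⟩
    · exact ⟨0, fun h1 h2 => (h ⟨h1, h2⟩).elim⟩
  choose kap hkap using hkap
  have hN : ∀ s : ℤ, ∃ N : ℕ, s ≤ l → ∀ n : ℤ, (N : ℤ) ≤ |n| →
      Subsingleton ((F.F s).toCx.homology n) := fun s => by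
    by_cases h : s ≤ l
    · obtain ⟨N, hN⟩ := (hrep s h).some.bounded_homology
      exact ⟨N, fun _ => hN⟩
    · exact ⟨0, fun h' => (h h').elim⟩
  choose N hN using hN
  exact ⟨
    { W := W, finite := hW, t := t _, a := a _, ω := ω _, kap := kap
      bounds := hbd _
      incl_ω := hincl _
      basis := hbasis
      basis_ker := hker
      conn_kap := hkap
      bounded := by
        refine ⟨∑ s ∈ Finset.Ico (0 : ℤ) l, N s, fun n hn => ⟨fun w => ?_⟩⟩
        have h1 := hbd n w
        have h2 : N (t n w) ≤ ∑ s ∈ Finset.Ico (0 : ℤ) l, N s :=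
          Finset.single_le_sum (f := N) (fun _ _ => Nat.zero_le _)
            (Finset.mem_Ico.2 ⟨h1.2.2.1, h1.2.2.2⟩)
        have h3 := hN (t n w) (by omega) n (by omega)
        exact (hbasis n (t n w) h1.2.2.1 h1.2.2.2.le).li.ne_zero ⟨w, h1.2.1, le_rfl⟩
          (Subsingleton.elim _ _) }⟩

namespace Bars

variable {l : ℕ} (β : F.Bars l)

instance (n : ℤ) : Finite (β.W n) := β.finite n

/-- The index type for a basis of the cohomology of the filtration quotients: a class of
`F_p / F_{p+1}` either comes from a bar that is born at `p`, or it bounds a bar that dies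
at `p`. -/
abbrev I (n : ℤ) : Type u := β.W n ⊕ β.W (n + 1)

/-- The family of classes in the cohomology of the filtration quotients. -/
noncomputable def fam (n p : ℤ) : β.I n → (F.gr p).homology n :=
  Sum.elim (fun w => F.proj n p (p + 1) (β.ω w p)) fun w => β.kap n w p

/-- The index set of a basis of `Z_r`, where `s = p + r`. -/
def zSet (n p s : ℤ) : Set (β.I n) :=
  Sum.inl '' {w | β.t w = p} ∪ Sum.inr '' {w | β.a w = p ∧ 0 ≤ p ∧ s ≤ β.t w}

/-- The index set of a basis of `B_r`, where `c = p - r + 1`. -/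
def bSet (n p c : ℤ) : Set (β.I n) :=
  Sum.inl '' {w | β.t w = p ∧ c ≤ β.a w ∧ 0 ≤ β.a w}

theorem inl_mem_zSet {n p s : ℤ} {w : β.W n} : Sum.inl w ∈ β.zSet n p s ↔ β.t w = p := by
  simp [zSet]

theorem inr_mem_zSet {n p s : ℤ} {w : β.W (n + 1)} :
    Sum.inr w ∈ β.zSet n p s ↔ β.a w = p ∧ 0 ≤ p ∧ s ≤ β.t w := by
  simp [zSet]

theorem inl_mem_bSet {n p c : ℤ} {w : β.W n} :
    Sum.inl w ∈ β.bSet n p c ↔ β.t w = p ∧ c ≤ β.a w ∧ 0 ≤ β.a w := by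
  simp [bSet]

theorem inr_notMem_bSet {n p c : ℤ} {w : β.W (n + 1)} : Sum.inr w ∉ β.bSet n p c := by
  simp [bSet]

theorem zSet_eq_empty {n p s : ℤ} (hp : p < 0 ∨ l ≤ p) : β.zSet n p s = ∅ := by
  rw [Set.eq_empty_iff_forall_notMem]
  rintro (w | w) hw
  · have := β.bounds w
    rw [inl_mem_zSet] at hw
    omega
  · have := β.bounds w
    rw [inr_mem_zSet] at hw
    omega

theorem bSet_subset {n p c s : ℤ} : β.bSet n p c ⊆ β.zSet n p s := by
  rintro (w | w) hw
  · rw [inl_mem_zSet]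
    exact (β.inl_mem_bSet.1 hw).1
  · exact (β.inr_notMem_bSet hw).elim

theorem bSet_eq_empty {n p c : ℤ} (hp : p < 0 ∨ l ≤ p) : β.bSet n p c = ∅ :=
  Set.subset_empty_iff.1 (β.bSet_subset.trans (β.zSet_eq_empty (s := 0) hp).le)

theorem basis_range_incl (hl : F.F l = ⊥) (n b s : ℤ) (h : b ≤ s) (hb : 0 ≤ b) :
    BasisOf (fun w : {w : β.W n | β.a w < b ∧ s ≤ β.t w} => β.ω w.1 b)
      (LinearMap.range (F.incl n b s h)) := by
  rcases le_or_gt s l with hs | hs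
  · have h1 := BasisOf.map_diff (f := fun w : β.W n => β.ω w s) (F.incl n b s h)
      (β.basis n s (hb.trans h) hs) (β.basis_ker n b s h hb hs) (β.basis n s (hb.trans h) hs)
      (fun w hw => hw.2) le_rfl
    rw [← LinearMap.range_eq_map] at h1
    have h2 : {w : β.W n | β.a w < s ∧ s ≤ β.t w} \ {w | b ≤ β.a w ∧ β.a w < s ∧ s ≤ β.t w} =
        {w | β.a w < b ∧ s ≤ β.t w} := by
      ext w
      simp only [Set.mem_ofPred_eq, Set.mem_sdiff]
      omega
    rw [h2] at h1
    have h3 : (fun w : {w : β.W n | β.a w < b ∧ s ≤ β.t w} => F.incl n b s h (β.ω w.1 s)) =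
        fun w => β.ω w.1 b := funext fun w => β.incl_ω w.1 b s h w.2.2
    rwa [h3] at h1
  · have : IsEmpty {w : β.W n | β.a w < b ∧ s ≤ β.t w} := ⟨fun w => by
      have h1 := β.bounds w.1
      have h2 := w.2.2
      omega⟩
    have h1 : LinearMap.range (F.incl n b s h) = ⊥ := by
      rw [eq_bot_iff]
      rintro _ ⟨x, rfl⟩
      have := subsingleton_homology_of_le l hl s n hs.le
      rw [Subsingleton.elim x 0, map_zero]
      exact Submodule.zero_mem _
    rw [h1]
    exact BasisOf.of_isEmpty

/-- A basis of the image in the cohomology of `F_p / F_{p+1}` of the span of a set of bars. -/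
theorem basis_proj (hl : F.F l = ⊥) (n p : ℤ) (hp : 0 ≤ p) (hpl : p < l) {P : β.W n → Prop}
    {S : Submodule ℝ ((F.F p).toCx.homology n)}
    (hS : BasisOf (fun w : {w : β.W n | P w ∧ β.a w < p ∧ p ≤ β.t w} => β.ω w.1 p) S) :
    BasisOf (fun i : ↥(Sum.inl '' {w : β.W n | P w ∧ β.t w = p} : Set (β.I n)) => β.fam n p i)
      (S.map (F.proj n p (p + 1))) := by
  refine BasisOf.image Sum.inl_injective ?_
  have h1 := BasisOf.map_diff (f := fun w : β.W n => β.ω w p)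
    (s := {w : β.W n | P w ∧ β.a w < p ∧ p ≤ β.t w})
    (k := {w : β.W n | β.a w < p ∧ p + 1 ≤ β.t w}) (F.proj n p (p + 1)) (β.basis n p hp hpl.le)
    (by rw [F.ker_proj n p (p + 1) (by omega)]; exact β.basis_range_incl hl n p (p + 1) _ hp) hS
    (fun w hw => ⟨hw.1, by have h2 := hw.2; omega⟩) fun w hw => hw.2
  refine BasisOf.congr_set (fun w => F.proj n p (p + 1) (β.ω w p)) h1 ?_
  ext w
  have := β.bounds w
  simp only [Set.mem_ofPred_eq, Set.mem_sdiff]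
  constructor
  · rintro ⟨⟨h1, h2⟩, h3⟩
    exact ⟨h1, by omega⟩
  · rintro ⟨h1, h2⟩
    exact ⟨⟨h1, by omega⟩, by omega⟩

theorem basis_ZInf (hl : F.F l = ⊥) (n p : ℤ) :
    BasisOf (fun i : β.zSet n p l => β.fam n p i) (F.ZInf p n) := by
  by_cases hp : p < 0 ∨ l ≤ p
  · have := subsingleton_gr l hl p n hp
    rw [β.zSet_eq_empty hp]
    exact BasisOf.of_subsingleton _ _
  · have h1 := β.basis_proj hl n p (by omega) (by omega) (P := fun _ => True) (S := ⊤)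
      ((β.basis n p (by omega) (by omega)).congr_set (fun w => β.ω w p)
        (by ext w; exact ⟨fun h => ⟨trivial, h⟩, fun h => h.2⟩))
    rw [← LinearMap.range_eq_map, ← F.ZInf_eq] at h1
    refine h1.congr_set (β.fam n p) ?_
    ext x
    rcases x with w | w
    · simp [zSet]
    · have := β.bounds w
      simp only [inr_mem_zSet, Set.mem_image]
      constructor
      · rintro ⟨w', -, h⟩
        cases h
      · omega

theorem basis_BInf (hl : F.F l = ⊥) (n p : ℤ) :
    BasisOf (fun i : β.bSet n p 0 => β.fam n p i) (F.BInf p n) := by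
  by_cases hp : p < 0 ∨ l ≤ p
  · have := subsingleton_gr l hl p n hp
    rw [β.bSet_eq_empty hp]
    exact BasisOf.of_subsingleton _ _
  · rw [F.BInf_eq p n (by omega)]
    refine (β.basis_proj hl n p (by omega) (by omega) (P := fun w => 0 ≤ β.a w)
      (β.basis_ker n 0 p _ le_rfl (by omega))).congr_set (β.fam n p) ?_
    refine congrArg (Sum.inl '' ·) ?_
    ext w
    simp only [Set.mem_ofPred_eq]
    tauto

/-- The part `B_r` of the cohomology of `F_p / F_{p+1}` is spanned by the bars born at `p` that die
within `r - 1` steps. -/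
theorem basis_B (hl : F.F l = ⊥) (r : ℕ+) (n p c : ℤ) (hc : c + r = p + 1) :
    BasisOf (fun i : β.bSet n p c => β.fam n p i) (F.B r p n) := by
  have hr := r.pos
  by_cases hp : p < 0 ∨ l ≤ p
  · have := subsingleton_gr l hl p n hp
    rw [β.bSet_eq_empty hp]
    exact BasisOf.of_subsingleton _ _
  · rw [F.B_eq_map r c p n hc]
    have h1 : BasisOf (fun w : {w : β.W n | (c ≤ β.a w ∧ 0 ≤ β.a w) ∧ β.a w < p ∧ p ≤ β.t w} =>
        β.ω w.1 p) (LinearMap.ker (F.incl n c p (by omega))) := by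
      rcases le_total 0 c with h | h
      · refine (β.basis_ker n c p (by omega) h (by omega)).congr_set (fun w => β.ω w p) ?_
        ext w
        simp only [Set.mem_ofPred_eq]
        omega
      · rw [F.ker_incl_of_neg n c p h (by omega)]
        refine (β.basis_ker n 0 p (by omega) le_rfl (by omega)).congr_set (fun w => β.ω w p) ?_
        ext w
        simp only [Set.mem_ofPred_eq]
        omega
    refine (β.basis_proj hl n p (by omega) (by omega) h1).congr_set (β.fam n p) ?_
    refine congrArg (Sum.inl '' ·) ?_
    ext w
    simp only [Set.mem_ofPred_eq]
    tauto

/-- The part `Z_r` of the cohomology of `F_p / F_{p+1}` is spanned by the bars born at `p`, together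
with the classes whose boundaries are bars of length at least `r` that die at `p`. -/
theorem basis_Z (hl : F.F l = ⊥) (r : ℕ+) (n p s : ℤ) (hs : p + r = s) :
    BasisOf (fun i : β.zSet n p s => β.fam n p i) (F.Z r p n) := by
  have hr := r.pos
  by_cases hp : p < 0 ∨ l ≤ p
  · have := subsingleton_gr l hl p n hp
    rw [β.zSet_eq_empty hp]
    exact BasisOf.of_subsingleton _ _
  · have hps : p + 1 ≤ s := by omega
    have hZ : F.Z r p n = (LinearMap.range (F.incl (n + 1) (p + 1) s hps)).comap
        (F.conn n (n + 1) p (p + 1) (by omega) rfl) := by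
      ext x
      exact F.mem_Z_iff r p s n (n + 1) hs rfl x
    rw [hZ]
    have h1 : BasisOf (fun i : ↥(Sum.inl '' {w : β.W n | β.t w = p} : Set (β.I n)) => β.fam n p i)
        (LinearMap.ker (F.conn n (n + 1) p (p + 1) (by omega) rfl)) := by
      have h1 := β.basis_proj hl n p (by omega) (by omega) (P := fun _ => True) (S := ⊤)
        ((β.basis n p (by omega) (by omega)).congr_set (fun w => β.ω w p)
          (by ext w; exact ⟨fun h => ⟨trivial, h⟩, fun h => h.2⟩))
      rw [← LinearMap.range_eq_map, ← F.ker_conn n (n + 1) p (p + 1) (by omega) rfl] at h1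
      refine h1.congr_set (β.fam n p) (congrArg (Sum.inl '' ·) ?_)
      ext w
      exact ⟨fun h => h.2, fun h => ⟨trivial, h⟩⟩
    refine BasisOf.comap (f := β.fam n p) _ _ h1
      (BasisOf.image (f := fun i => F.conn n (n + 1) p (p + 1) (by omega) rfl (β.fam n p i))
        Sum.inr_injective ?_)
    rw [← F.ker_incl n (n + 1) p (p + 1) _ rfl]
    have h2 := BasisOf.inf (f := fun w : β.W (n + 1) => β.ω w (p + 1))
      (β.basis_ker (n + 1) p (p + 1) (by omega) (by omega) (by omega))
      (β.basis_range_incl hl (n + 1) (p + 1) s hps (by omega))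
      ((BasisOf.on_iff.1 (β.basis (n + 1) (p + 1) (by omega) (by omega))).1.mono (by
        rintro w (hw | hw)
        · exact hw.2
        · exact ⟨hw.1, hps.trans hw.2⟩))
    have h3 := h2.congr_set (fun w : β.W (n + 1) => β.ω w (p + 1))
      (t := {w | β.a w = p ∧ 0 ≤ p ∧ s ≤ β.t w}) (by
      ext w
      constructor
      · rintro ⟨⟨h1, h2, h3⟩, h4, h5⟩
        exact ⟨by omega, by omega, h5⟩
      · rintro ⟨h1, h2, h3⟩
        exact ⟨⟨by omega, by omega, by omega⟩, by omega, h3⟩)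
    have h4 : (fun i : {w : β.W (n + 1) | β.a w = p ∧ 0 ≤ p ∧ s ≤ β.t w} =>
        F.conn n (n + 1) p (p + 1) (by omega) rfl (β.fam n p (Sum.inr i.1))) =
        fun w => β.ω w.1 (p + 1) := funext fun w => β.conn_kap n w.1 p w.2.1 w.2.2.1
    rwa [h4]

theorem basis_gr (hl : F.F l = ⊥) (n p : ℤ) :
    BasisOf (fun i : β.zSet n p (p + 1) => β.fam n p i) ⊤ := by
  have h1 := β.basis_Z hl 1 n p (p + 1) rfl
  have h2 : F.Z 1 p n = ⊤ := by
    rw [eq_top_iff]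
    rintro x -
    exact (F.mem_Z_iff 1 p (p + 1) n (n + 1) rfl rfl x).2 ⟨_, F.incl_refl _ _ _ _⟩
  rwa [h2] at h1

theorem basis_FH (hl : F.F l = ⊥) (n p : ℤ) (hp : 0 ≤ p) :
    BasisOf (fun w : {w : β.W n | β.a w < 0 ∧ p ≤ β.t w} => F.toC n (β.ω w.1 0)) (F.FH p n) := by
  rw [F.FH_eq p n hp]
  exact (β.basis_range_incl hl n 0 p hp le_rfl).map (F.toC n) fun x _ hx =>
    (F.toC_bijective n).1 (hx.trans (map_zero _).symm)

end Bars

end Filtration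

/-! ### Volumes in subquotients -/

section Subquotients

variable {V ι κ : Type*} [AddCommGroup V] [Module ℝ V]

theorem HilbertStructure.logVol_of_subsingleton [Subsingleton V] (h : HilbertStructure V)
    [Finite ι] {v : ι → V} (hv : LinearIndependent ℝ v) : h.logVol v = 0 := by
  have : IsEmpty ι := ⟨fun i => hv.ne_zero i (Subsingleton.elim _ _)⟩
  exact h.logVol_of_isEmpty v

variable {A B : Submodule ℝ V}

/-- The volume of a family in `A / B` is the quotient of the volume of a lift to `A`, together with
a basis of `B`, by the volume of that basis. -/
theorem HilbertStructure.logVol_subquot (h : HilbertStructure V) (hBA : B ≤ A) [Finite ι]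
    [Finite κ] {v : ι → V} (hv : BasisOf v B) {w : κ → V} (hw : ∀ j, w j ∈ A)
    (hli : LinearIndependent ℝ (Sum.elim v w)) :
    (h.subquot A B).logVol (fun j => (Submodule.Quotient.mk ⟨w j, hw j⟩ : Subquot A B)) =
      h.logVol (Sum.elim v w) - h.logVol v := by
  let v' : ι → A := fun i => ⟨v i, hBA (hv.mem i)⟩
  let w' : κ → A := fun j => ⟨w j, hw j⟩
  have hv' : BasisOf v' (LinearMap.ker (B.submoduleOf A).mkQ) := by
    rw [Submodule.ker_mkQ]
    refine BasisOf.of_map A.subtype A.subtype_injective ?_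
    have h1 : (B.submoduleOf A).map A.subtype = B := by
      rw [Submodule.submoduleOf, Submodule.map_comap_subtype, inf_eq_right.2 hBA]
    rw [h1]
    exact hv
  have h2 : A.subtype ∘ Sum.elim v' w' = Sum.elim v w := by
    funext i
    rcases i with i | i <;> rfl
  have hli' : LinearIndependent ℝ (Sum.elim v' w') := LinearIndependent.of_comp A.subtype (by
    rw [h2]
    exact hli)
  have hq : LinearIndependent ℝ ((B.submoduleOf A).mkQ ∘ w') := by
    obtain ⟨h3, h4, h5⟩ := linearIndependent_sum.1 hli'
    refine LinearIndependent.map h4 ?_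
    rw [← hv'.span]
    exact h5.symm
  have h6 := HilbertStructure.logVol_sumElim (h.comap A.subtype A.subtype_injective) _ _
    (HilbertStructure.isCoisometry_map _ _ (Submodule.mkQ_surjective (B.submoduleOf A))) v' w'
    hv' hq
  have h7 : (h.comap A.subtype A.subtype_injective).logVol (Sum.elim v' w') =
      h.logVol (Sum.elim v w) := by
    rw [← h2]
    rfl
  rw [← h7, h6]
  change _ = h.logVol v + _ - h.logVol v
  rw [add_sub_cancel_left]
  rfl

theorem BasisOf.subquot (hBA : B ≤ A) {v : ι → V} (hv : BasisOf v B) {w : κ → V}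
    (hw : ∀ j, w j ∈ A) (h : BasisOf (Sum.elim v w) A) :
    BasisOf (fun j => (Submodule.Quotient.mk ⟨w j, hw j⟩ : Subquot A B)) ⊤ := by
  let v' : ι → A := fun i => ⟨v i, hBA (hv.mem i)⟩
  let w' : κ → A := fun j => ⟨w j, hw j⟩
  have hv' : BasisOf v' (LinearMap.ker (B.submoduleOf A).mkQ) := by
    rw [Submodule.ker_mkQ]
    refine BasisOf.of_map A.subtype A.subtype_injective ?_
    have h1 : (B.submoduleOf A).map A.subtype = B := by
      rw [Submodule.submoduleOf, Submodule.map_comap_subtype, inf_eq_right.2 hBA]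
    rw [h1]
    exact hv
  have h2 : A.subtype ∘ Sum.elim v' w' = Sum.elim v w := by
    funext i
    rcases i with i | i <;> rfl
  have h3 : BasisOf (Sum.elim v' w') ⊤ := by
    refine BasisOf.of_map A.subtype A.subtype_injective ?_
    rw [h2, ← LinearMap.range_eq_map, Submodule.range_subtype]
    exact h
  have h4 := BasisOf.of_sumElim _ hv' h3
  rwa [Submodule.range_mkQ] at h4

end Subquotients

/-! ### The torsion with respect to the induced structure on cohomology -/

theorem IsAdapted.basis_ker {ι ε : ℤ → Type*} {X : RealComplex.{u}} {y : ∀ n, ι n → X.X n}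
    {e : ∀ n, ε n → X.X n} (h : IsAdapted X y e) (n : ℤ) :
    BasisOf (Sum.elim (fun j => (X.d (n - 1) n).hom (y (n - 1) j)) (e n))
      (LinearMap.ker (X.d n (n + 1)).hom) := by
  have h1 := (h.basis n).comp_equiv (Equiv.sumAssoc _ _ _)
  have h2 : adaptedFamily X y e n ∘ Equiv.sumAssoc _ _ _ =
      Sum.elim (Sum.elim (fun j => (X.d (n - 1) n).hom (y (n - 1) j)) (e n)) (y n) := by
    funext i
    rcases i with (i | i) | i <;> rfl
  rw [h2] at h1
  refine ⟨(linearIndependent_sum.1 h1.li).1, le_antisymm ?_ fun x hx => ?_⟩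
  · rw [Submodule.span_le]
    rintro _ ⟨j | j, rfl⟩
    · exact d_d_apply X _ _ _ _
    · exact h.d_e _ _ _
  · have h3 : x ∈ Submodule.span ℝ (Set.range
        (Sum.elim (Sum.elim (fun j => (X.d (n - 1) n).hom (y (n - 1) j)) (e n)) (y n))) := by
      rw [h1.span]; trivial
    rw [Set.Sum.elim_range, Submodule.span_union, Submodule.mem_sup] at h3
    obtain ⟨a, ha, b, hb, rfl⟩ := h3
    have h4 : (X.d n (n + 1)).hom a = 0 := by
      refine (Submodule.span_le (p := LinearMap.ker (X.d n (n + 1)).hom)).2 ?_ ha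
      rintro _ ⟨j | j, rfl⟩
      · exact d_d_apply X _ _ _ _
      · exact h.d_e _ _ _
    rw [LinearMap.mem_ker, map_add, h4, zero_add] at hx
    have h5 : b = 0 := Submodule.disjoint_def.1
      (Submodule.range_ker_disjoint (f := (X.d n (n + 1)).hom) (h.li_d rfl)) b hb hx
    rwa [h5, add_zero]

theorem finite_support_of_bounded {φ : ℤ → ℝ} (N : ℕ) (h : ∀ n : ℤ, (N : ℤ) ≤ |n| → φ n = 0) :
    (Function.support φ).Finite :=
  (Set.finite_Icc (-(N : ℤ)) N).subset fun n hn => abs_le.1 (by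
    by_contra h1
    exact hn (h n (by omega)))

/-- The torsion of a finite Hilbert complex whose cohomology carries the induced structure. -/
theorem HilbertComplex.torsion_homologyHilbert (X : HilbertComplex.{u}) {ι ε : ℤ → Type*}
    [∀ n, Finite (ι n)] [∀ n, Finite (ε n)] {y : ∀ n, ι n → X.cx.X n} {e : ∀ n, ε n → X.cx.X n}
    (hX : IsAdapted X.cx y e) :
    X.torsion X.homologyHilbert = ∑ᶠ n : ℤ, (-1 : ℝ) ^ n *
      ((X.hilbert n).logVol (Sum.elim (fun j => (X.cx.d (n - 1) n).hom (y (n - 1) j)) (e n)) -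
        (X.hilbert n).logVol (fun j => (X.cx.d (n - 1) n).hom (y (n - 1) j)) -
        (X.hilbert n).logVol (adaptedFamily X.cx y e n)) := by
  have hz : ∀ n x, (X.cx.d n (n + 1)).hom x = 0 → ∃ z, (X.cx.iCycles n).hom z = x :=
    fun n x hx => by
      obtain ⟨ξ, z, hz, -⟩ := IsClass.of_d_eq_zero rfl hx
      exact ⟨z, hz⟩
  choose v hv using fun n j => hz n ((X.cx.d (n - 1) n).hom (y (n - 1) j)) (d_d_apply _ _ _ _ _)
  choose w hw using fun n j => hz n (e n j) (hX.d_e _ _ _)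
  have hi := IsClass.iCycles_injective X.cx
  have hmap : ∀ n, (⊤ : Submodule ℝ (X.cx.cycles n)).map (X.cx.iCycles n).hom =
      LinearMap.ker (X.cx.d n (n + 1)).hom := fun n => by
    rw [← LinearMap.range_eq_map]
    ext x
    constructor
    · rintro ⟨z, rfl⟩
      exact congrArg (fun g => g.hom z) (X.cx.iCycles_d n (n + 1))
    · exact hz n x
  have hvw : ∀ n, (X.cx.iCycles n).hom ∘ Sum.elim (v n) (w n) =
      Sum.elim (fun j => (X.cx.d (n - 1) n).hom (y (n - 1) j)) (e n) := fun n => by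
    funext i
    rcases i with i | i
    · exact hv n i
    · exact hw n i
  have hbasis : ∀ n, BasisOf (Sum.elim (v n) (w n)) ⊤ := fun n => by
    refine BasisOf.of_map (X.cx.iCycles n).hom (hi n) ?_
    rw [hvw, hmap]
    exact hX.basis_ker n
  have hker : ∀ n, BasisOf (v n) (LinearMap.ker (X.cx.homologyπ n).hom) := fun n => by
    refine BasisOf.of_map (X.cx.iCycles n).hom (hi n) ?_
    have h1 : (X.cx.iCycles n).hom ∘ v n =
      fun j => (X.cx.d (n - 1) n).hom (y (n - 1) j) := funext (hv n)
    rw [h1]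
    refine ⟨hX.li_d (sub_add_cancel n 1), le_antisymm ?_ ?_⟩
    · rw [Submodule.span_le]
      rintro _ ⟨j, rfl⟩
      refine ⟨v n j, ?_, hv n j⟩
      have h2 := IsClass.of_d (K := X.cx) (n := n) (y (n - 1) j)
      have h3 : IsClass X.cx n ((X.cx.d (n - 1) n).hom (y (n - 1) j))
        ((X.cx.homologyπ n).hom (v n j)) := ⟨_, hv n j, rfl⟩
      exact h3.unique h2
    · rintro _ ⟨z, hz0, rfl⟩
      have h3 : IsClass X.cx n ((X.cx.iCycles n).hom z) 0 := ⟨z, rfl, hz0⟩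
      obtain ⟨x, hx⟩ := h3.exists_of_zero (sub_add_cancel n 1)
      rw [← hx]
      exact hX.range_d_le _ _ x
  let η : ∀ n, ε n → X.cx.homology n := fun n => (X.cx.homologyπ n).hom ∘ w n
  have hη : ∀ n, BasisOf (η n) ⊤ := fun n => by
    have h1 := BasisOf.of_sumElim _ (hker n) (hbasis n)
    rwa [LinearMap.range_eq_top.2 (IsClass.homologyπ_surjective X.cx n)] at h1
  have hvol : ∀ n, (X.homologyHilbert n).logVol (η n) =
      (X.hilbert n).logVol (Sum.elim (fun j => (X.cx.d (n - 1) n).hom (y (n - 1) j)) (e n)) -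
        (X.hilbert n).logVol (fun j => (X.cx.d (n - 1) n).hom (y (n - 1) j)) := fun n => by
    have h1 := HilbertStructure.logVol_sumElim
      ((X.hilbert n).comap (X.cx.iCycles n).hom (hi n)) _ _
      (HilbertStructure.isCoisometry_map _ _ (IsClass.homologyπ_surjective X.cx n)) (v n) (w n)
      (hker n) (hη n).li
    rw [← hvw, eq_sub_iff_add_eq, add_comm,
      show (fun j => (X.cx.d (n - 1) n).hom (y (n - 1) j)) = (X.cx.iCycles n).hom ∘ v n from
        (funext (hv n)).symm]
    exact h1.symm
  rw [X.torsion_eq hX X.homologyHilbert η hη fun n j => ⟨w n j, hw n j, rfl⟩, cohomologyVol,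
    adaptedVol, ← finsum_sub_distrib]
  · refine finsum_congr fun n => ?_
    rw [hvol]
    ring
  · obtain ⟨N, hN⟩ := X.bounded
    refine finite_support_of_bounded N fun n hn => ?_
    have := hN n hn
    have h1 : Subsingleton (X.cx.homology n) :=
      have := (hi n).subsingleton
      (IsClass.homologyπ_surjective X.cx n).subsingleton
    rw [HilbertStructure.logVol_of_subsingleton _ (hη n).li, mul_zero]
  · refine (finite_support_logVol X hX).subset fun n hn h0 => hn ?_
    simp only [h0, mul_zero]

/-! ### The torsion of the pages of the spectral sequence -/

section Volumes

variable {V ι κ : Type*} [AddCommGroup V] [Module ℝ V]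

theorem BasisOf.of_range {f : ι → V} {T : Set ι} {S : Submodule ℝ V}
    (h : BasisOf (fun i : T => f i) S) {φ : κ → ι} (hφ : Function.Injective φ)
    (hT : Set.range φ = T) : BasisOf (fun j => f (φ j)) S := by
  subst hT
  exact h.comp_equiv (Equiv.ofInjective φ hφ)

theorem HilbertStructure.logVol_range (h : HilbertStructure V) (f : ι → V) {T : Set ι} [Finite T]
    [Finite κ] {φ : κ → ι} (hφ : Function.Injective φ) (hT : Set.range φ = T) :
    h.logVol (fun j => f (φ j)) = h.logVol (fun i : T => f i) := by
  subst hT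
  exact h.logVol_congr (Equiv.ofInjective φ hφ) fun _ => rfl

variable {A B : Submodule ℝ V} {f : ι → V} {s t : Set ι} {φ : κ → ι}

theorem injective_sumElim_val (hφ : Function.Injective φ) (hd : ∀ j, φ j ∉ s) :
    Function.Injective (Sum.elim (fun i : s => (i : ι)) φ) :=
  Subtype.val_injective.sumElim hφ fun i j h => hd j (h ▸ i.2)

/-- A family of basis vectors of `A`, disjoint from a basis of `B`, has as its volume in `A / B`
the quotient of two volumes in `A`. -/
theorem HilbertStructure.logVol_subquot_range (h : HilbertStructure V) [Finite ι] [Finite κ]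
    (hst : s ⊆ t) (hs : BasisOf (fun i : s => f i) B) (ht : BasisOf (fun i : t => f i) A)
    (hφ : Function.Injective φ) (hd : ∀ j, φ j ∉ s) {T : Set ι} (hT : s ∪ Set.range φ = T)
    (hTt : T ⊆ t) (hw : ∀ j, f (φ j) ∈ A) :
    (h.subquot A B).logVol (fun j => (Submodule.Quotient.mk ⟨f (φ j), hw j⟩ : Subquot A B)) =
      h.logVol (fun i : T => f i) - h.logVol (fun i : s => f i) := by
  have hBA : B ≤ A := by
    rw [← hs.span, Submodule.span_le]
    rintro _ ⟨i, rfl⟩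
    exact ht.mem ⟨i.1, hst i.2⟩
  have hR : Set.range (Sum.elim (fun i : s => (i : ι)) φ) = T := by
    rw [Set.Sum.elim_range, Subtype.range_coe, hT]
  have h1 : (Sum.elim (fun i : s => f i) fun j => f (φ j)) =
      fun x => f (Sum.elim (fun i : s => (i : ι)) φ x) := by
    funext x
    rcases x with x | x <;> rfl
  rw [h.logVol_subquot hBA hs hw, h1, h.logVol_range f (injective_sumElim_val hφ hd) hR]
  rw [h1]
  refine LinearIndependent.comp (v := fun i : t => f i) ht.li
    (fun x => ⟨_, hTt (hR ▸ Set.mem_range_self x)⟩) fun x y hxy => ?_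
  exact injective_sumElim_val hφ hd (congrArg Subtype.val hxy)

theorem BasisOf.subquot_range (hst : s ⊆ t) (hs : BasisOf (fun i : s => f i) B)
    (ht : BasisOf (fun i : t => f i) A) (hφ : Function.Injective φ) (hd : ∀ j, φ j ∉ s)
    (hT : s ∪ Set.range φ = t) (hw : ∀ j, f (φ j) ∈ A) :
    BasisOf (fun j => (Submodule.Quotient.mk ⟨f (φ j), hw j⟩ : Subquot A B)) ⊤ := by
  have hBA : B ≤ A := by
    rw [← hs.span, Submodule.span_le]
    rintro _ ⟨i, rfl⟩
    exact ht.mem ⟨i.1, hst i.2⟩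
  refine BasisOf.subquot hBA hs hw ?_
  have h1 : (Sum.elim (fun i : s => f i) fun j => f (φ j)) =
      fun x => f (Sum.elim (fun i : s => (i : ι)) φ x) := by
    funext x
    rcases x with x | x <;> rfl
  rw [h1]
  exact ht.of_range (injective_sumElim_val hφ hd)
    (by rw [Set.Sum.elim_range, Subtype.range_coe, hT])

end Volumes

namespace Filtration

variable {C : RealComplex.{u}} {F : Filtration C}

theorem pageCx_d (r : ℕ+) (p q k k' : ℤ) (h : k + 1 = k') :
    (F.pageCx r p q).d k k' = ModuleCat.ofHom
      (F.dE r (p + r * k) (p + r * k') (p + q + k) (p + q + k') (by subst h; ring) (by omega)) :=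
  dif_pos h

namespace Bars

variable {l : ℕ} (β : F.Bars l)

/-- The index set of the basis elements of `E_r` that are mapped by `d_r` to linearly independent
elements. -/
def srcSet (r : ℕ+) (n p : ℤ) : Set (β.I n) := β.zSet n p (p + r) \ β.zSet n p (p + r + 1)

/-- The index set of the basis elements of `E_r` that are boundaries under `d_r`. -/
def tgtSet (r : ℕ+) (n p : ℤ) : Set (β.I n) := β.bSet n p (p - r) \ β.bSet n p (p - r + 1)

/-- The index set of the basis elements of `E_r` whose classes form a basis of `E_{r+1}`. -/
def restSet (r : ℕ+) (n p : ℤ) : Set (β.I n) := β.zSet n p (p + r + 1) \ β.bSet n p (p - r)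

theorem zSet_anti {n p s s' : ℤ} (h : s ≤ s') : β.zSet n p s' ⊆ β.zSet n p s := by
  rintro (w | w) hw
  · rwa [inl_mem_zSet] at hw ⊢
  · rw [inr_mem_zSet] at hw ⊢
    omega

theorem bSet_anti {n p c c' : ℤ} (h : c ≤ c') : β.bSet n p c' ⊆ β.bSet n p c := by
  rintro (w | w) hw
  · rw [inl_mem_bSet] at hw ⊢
    omega
  · exact (β.inr_notMem_bSet hw).elim

theorem fam_mem_Z (hl : F.F l = ⊥) (r : ℕ+) (n p : ℤ) {i : β.I n} (hi : i ∈ β.zSet n p (p + r)) :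
    β.fam n p i ∈ F.Z r p n := (β.basis_Z hl r n p (p + r) rfl).mem ⟨i, hi⟩

/-- A class that survives to the next page is a cocycle. -/
theorem dE_eq_zero (r : ℕ+) (n n' p s : ℤ) (hs : p + r = s) (hn : n + 1 = n')
    {i : β.I n} (hi : i ∈ β.zSet n p (p + r + 1)) (hz : β.fam n p i ∈ F.Z r p n) :
    F.dE r p s n n' hs hn (Submodule.Quotient.mk ⟨β.fam n p i, hz⟩) = 0 := by
  subst hn hs
  have hr := r.pos
  have h0 : ∀ η : (F.F (p + r)).toCx.homology (n + 1),
      F.conn n (n + 1) p (p + 1) (by omega) rfl (β.fam n p i) =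
        F.incl (n + 1) (p + 1) (p + r) (by omega) η →
      F.proj (n + 1) (p + r) (p + r + 1) η = 0 →
      F.dE r p (p + r) n (n + 1) rfl rfl (Submodule.Quotient.mk ⟨β.fam n p i, hz⟩) = 0 :=
    fun η h1 h2 => by
      rw [F.dE_mk r p (p + r) n (n + 1) rfl rfl _ hz η h1 (by rw [h2]; exact zero_mem _)]
      exact (Submodule.Quotient.mk_eq_zero _).2 (by
        change F.proj (n + 1) (p + r) (p + r + 1) η ∈ F.B r (p + r) (n + 1)
        rw [h2]; exact zero_mem _)
  rcases i with w | w
  · refine h0 0 ?_ (map_zero _)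
    rw [map_zero]
    have h1 : β.fam n p (Sum.inl w) ∈
        LinearMap.ker (F.conn n (n + 1) p (p + 1) (by omega) rfl) := by
      rw [F.ker_conn n (n + 1) p (p + 1) (by omega) rfl]
      exact ⟨_, rfl⟩
    exact h1
  · rw [inr_mem_zSet] at hi
    refine h0 (β.ω w (p + r)) ?_ ?_
    · rw [β.incl_ω w _ _ _ (by omega)]
      exact β.conn_kap n w p hi.1 hi.2.1
    · have h1 : β.ω w (p + r) ∈ LinearMap.ker (F.proj (n + 1) (p + r) (p + r + 1)) := by
        rw [F.ker_proj (n + 1) (p + r) (p + r + 1) (by omega)]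
        exact ⟨_, β.incl_ω w (p + r) (p + r + 1) (by omega) hi.2.2⟩
      exact h1

/-- The differential `d_r` maps the classes that bound bars of length `r` to the classes of these
bars. -/
theorem exists_dE (hl : F.F l = ⊥) (r : ℕ+) (n n' p s : ℤ) (hs : p + r = s) (hn : n + 1 = n') :
    ∃ φ : β.srcSet r n p → β.I n', Function.Injective φ ∧ Set.range φ = β.tgtSet r n' s ∧
      ∀ i, ∃ hz : β.fam n' s (φ i) ∈ F.Z r s n',
        F.dE r p s n n' hs hn (Submodule.Quotient.mk ⟨β.fam n p i, β.fam_mem_Z hl r n p i.2.1⟩) =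
          Submodule.Quotient.mk ⟨β.fam n' s (φ i), hz⟩ := by
  subst hn hs
  have hr := r.pos
  have h1 : ∀ i : β.srcSet r n p, ∃ w : β.W (n + 1), i.1 = Sum.inr w ∧
      β.a w = p ∧ 0 ≤ p ∧ β.t w = p + r := by
    rintro ⟨w | w, h1, h2⟩
    · rw [inl_mem_zSet] at h1 h2
      exact (h2 h1).elim
    · rw [inr_mem_zSet] at h1 h2
      exact ⟨w, rfl, h1.1, h1.2.1, by omega⟩
  choose w hw ha hp ht using h1
  refine ⟨fun i => Sum.inl (w i), fun i j hij => ?_, ?_, fun i => ?_⟩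
  · exact Subtype.ext (by rw [hw, hw, Sum.inl_injective hij])
  · ext x
    constructor
    · rintro ⟨i, rfl⟩
      have h2 := ha i
      have h3 := hp i
      exact ⟨β.inl_mem_bSet.2 ⟨ht i, by omega, by omega⟩, fun h => by
        have := β.inl_mem_bSet.1 h
        omega⟩
    · rintro ⟨h2, h3⟩
      rcases x with x | x
      · rw [inl_mem_bSet] at h2 h3
        have h4 : (Sum.inr x : β.I n) ∈ β.srcSet r n p :=
          ⟨β.inr_mem_zSet.2 ⟨by omega, by omega, by omega⟩, fun h => by
            have := β.inr_mem_zSet.1 h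
            omega⟩
        exact ⟨⟨_, h4⟩, congrArg Sum.inl (Sum.inr_injective (hw ⟨_, h4⟩)).symm⟩
      · exact (β.inr_notMem_bSet h2).elim
  · have hz : β.fam (n + 1) (p + r) (Sum.inl (w i)) ∈ F.Z r (p + r) (n + 1) :=
      β.fam_mem_Z hl r _ _ (β.inl_mem_zSet.2 (ht i))
    refine ⟨hz, ?_⟩
    refine F.dE_mk r p (p + r) n (n + 1) rfl rfl _ _ (β.ω (w i) (p + r)) ?_ hz
    rw [β.incl_ω _ _ _ _ (ht i).ge, ← β.conn_kap n (w i) p (ha i) (hp i), hw i]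
    rfl

/-- The logarithmic volume of a set of basis vectors of the cohomology of `F_p / F_{p+1}`. -/
noncomputable def vol (g : ∀ p n, HilbertStructure ((F.gr p).homology n)) (n p : ℤ)
    (T : Set (β.I n)) : ℝ := (g p n).logVol fun i : T => β.fam n p i

theorem vol_empty (g : ∀ p n, HilbertStructure ((F.gr p).homology n)) (n p : ℤ) :
    β.vol g n p ∅ = 0 := HilbertStructure.logVol_of_isEmpty _ _

/-- The contribution of `E_r` in filtration index `p` and total degree `n` to the torsion of the
`r`-th page. -/
noncomputable def pageTerm (g : ∀ p n, HilbertStructure ((F.gr p).homology n)) (r : ℕ+)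
    (n p : ℤ) : ℝ :=
  β.vol g n p (β.zSet n p (p + r + 1)) - β.vol g n p (β.zSet n p (p + r)) +
    β.vol g n p (β.bSet n p (p - r + 1)) - β.vol g n p (β.bSet n p (p - r))

/-- The torsion of a complex of the `r`-th page, computed with the adapted basis that is given by
the classes bounding bars of length `r` and by the basis of `E_{r+1}`. -/
theorem pageTorsion_eq (hl : F.F l = ⊥) (g : ∀ p n, HilbertStructure ((F.gr p).homology n))
    (r : ℕ+) (p q : ℤ) :
    F.pageTorsion g r p q =
      ∑ᶠ k : ℤ, (-1 : ℝ) ^ k * β.pageTerm g r (p + q + k) (p + r * k) := by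
  let P : ℤ → ℤ := fun k => p + r * k
  let N : ℤ → ℤ := fun k => p + q + k
  have hB := fun k => β.basis_B hl r (N k) (P k) (P k - r + 1) (by ring)
  have hZ := fun k => β.basis_Z hl r (N k) (P k) (P k + r) rfl
  have hP : ∀ k, P (k - 1) + r = P k := fun k => by simp only [P]; ring
  have hN : ∀ k, N (k - 1) + 1 = N k := fun k => by simp only [N]; ring
  choose φ hφi hφr hφ using fun k => β.exists_dE hl r (N (k - 1)) (N k) (P (k - 1)) (P k) (hP k)
    (hN k)
  have hsub : ∀ k, β.restSet r (N k) (P k) ⊆ β.zSet (N k) (P k) (P k + r) := fun k i hi =>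
    β.zSet_anti (by omega) hi.1
  let y : ∀ k, β.srcSet r (N k) (P k) → (F.pageCx r p q).X k := fun k i =>
    (Submodule.Quotient.mk ⟨β.fam (N k) (P k) i, β.fam_mem_Z hl r _ _ i.2.1⟩ :
      F.E r (P k) (N k))
  let e : ∀ k, β.restSet r (N k) (P k) → (F.pageCx r p q).X k := fun k i =>
    (Submodule.Quotient.mk ⟨β.fam (N k) (P k) i, β.fam_mem_Z hl r _ _ (hsub k i.2)⟩ :
      F.E r (P k) (N k))
  have hdy : ∀ k (i : β.srcSet r (N (k - 1)) (P (k - 1))),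
      ((F.pageCx r p q).d (k - 1) k).hom (y (k - 1) i) =
        (Submodule.Quotient.mk ⟨β.fam (N k) (P k) (φ k i), (hφ k i).1⟩ : F.E r (P k) (N k)) :=
    fun k i => by
      rw [pageCx_d r p q (k - 1) k (by ring)]
      exact (hφ k i).2
  -- The three parts of the basis of `E_r`, and the positions of their sums.
  let ψ₂ : ∀ k, β.srcSet r (N (k - 1)) (P (k - 1)) ⊕ β.restSet r (N k) (P k) → β.I (N k) :=
    fun k => Sum.elim (φ k) Subtype.val
  let ψ₃ : ∀ k, β.srcSet r (N (k - 1)) (P (k - 1)) ⊕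
      (β.restSet r (N k) (P k) ⊕ β.srcSet r (N k) (P k)) → β.I (N k) :=
    fun k => Sum.elim (φ k) (Sum.elim Subtype.val Subtype.val)
  have hφt : ∀ k i, φ k i ∈ β.tgtSet r (N k) (P k) := fun k i => hφr k ▸ Set.mem_range_self i
  have hcc : ∀ k, β.bSet (N k) (P k) (P k - r + 1) ⊆ β.bSet (N k) (P k) (P k - r) :=
    fun k => β.bSet_anti (by omega)
  have hzz : ∀ k, β.zSet (N k) (P k) (P k + r + 1) ⊆ β.zSet (N k) (P k) (P k + r) :=
    fun k => β.zSet_anti (by omega)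
  have hi₂ : ∀ k, Function.Injective (ψ₂ k) := fun k =>
    (hφi k).sumElim Subtype.val_injective fun i j hij => j.2.2 (hij ▸ (hφt k i).1)
  have hi₃ : ∀ k, Function.Injective (ψ₃ k) := fun k =>
    (hφi k).sumElim (Subtype.val_injective.sumElim Subtype.val_injective
      fun i j hij => j.2.2 (hij ▸ i.2.1)) fun i j hij => by
        rcases j with j | j
        · have h1 : φ k i = j.1 := hij
          exact j.2.2 (h1 ▸ (hφt k i).1)
        · have h1 : φ k i = j.1 := hij
          exact j.2.2 (β.bSet_subset (h1 ▸ (hφt k i).1))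
  have hd₁ : ∀ k i, φ k i ∉ β.bSet (N k) (P k) (P k - r + 1) := fun k i => (hφt k i).2
  have hd₂ : ∀ k i, ψ₂ k i ∉ β.bSet (N k) (P k) (P k - r + 1) := fun k i => by
    rcases i with i | i
    · exact hd₁ k i
    · exact fun h => i.2.2 (hcc k h)
  have hd₃ : ∀ k i, ψ₃ k i ∉ β.bSet (N k) (P k) (P k - r + 1) := fun k i => by
    rcases i with i | i | i
    · exact hd₁ k i
    · exact fun h => i.2.2 (hcc k h)
    · exact fun h => i.2.2 (β.bSet_subset h)
  have hu₁ : ∀ k, β.bSet (N k) (P k) (P k - r + 1) ∪ Set.range (φ k) =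
      β.bSet (N k) (P k) (P k - r) := fun k => by
    rw [hφr, tgtSet, Set.union_sdiff_cancel (hcc k)]
  have hu₂ : ∀ k, β.bSet (N k) (P k) (P k - r + 1) ∪ Set.range (ψ₂ k) =
      β.zSet (N k) (P k) (P k + r + 1) := fun k => by
    rw [Set.Sum.elim_range, ← Set.union_assoc, hu₁, Subtype.range_coe, restSet,
      Set.union_sdiff_cancel β.bSet_subset]
  have hu₃ : ∀ k, β.bSet (N k) (P k) (P k - r + 1) ∪ Set.range (ψ₃ k) =
      β.zSet (N k) (P k) (P k + r) := fun k => by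
    rw [Set.Sum.elim_range, Set.Sum.elim_range, ← Set.union_assoc, hu₁, Subtype.range_coe,
      Subtype.range_coe, ← Set.union_assoc, restSet, Set.union_sdiff_cancel β.bSet_subset,
      srcSet, Set.union_sdiff_cancel (hzz k)]
  have hw₂ : ∀ k i, β.fam (N k) (P k) (ψ₂ k i) ∈ F.Z r (P k) (N k) := fun k i =>
    β.fam_mem_Z hl r _ _ (hzz k (hu₂ k ▸ Or.inr (Set.mem_range_self i)))
  have hw₃ : ∀ k i, β.fam (N k) (P k) (ψ₃ k i) ∈ F.Z r (P k) (N k) := fun k i =>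
    β.fam_mem_Z hl r _ _ (hu₃ k ▸ Or.inr (Set.mem_range_self i))
  have he₂ : ∀ k, Sum.elim (fun j => ((F.pageCx r p q).d (k - 1) k).hom (y (k - 1) j)) (e k) =
      fun i => (Submodule.Quotient.mk ⟨β.fam (N k) (P k) (ψ₂ k i), hw₂ k i⟩ :
        F.E r (P k) (N k)) := fun k => by
    funext i
    rcases i with i | i
    · exact hdy k i
    · rfl
  have he₃ : ∀ k, adaptedFamily (F.pageCx r p q) y e k =
      fun i => (Submodule.Quotient.mk ⟨β.fam (N k) (P k) (ψ₃ k i), hw₃ k i⟩ :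
        F.E r (P k) (N k)) := fun k => by
    funext i
    rcases i with i | i | i
    · exact hdy k i
    · rfl
    · rfl
  have hA : IsAdapted (F.pageCx r p q) y e := by
    constructor
    · intro k k' j
      by_cases hk : k + 1 = k'
      · rw [pageCx_d r p q k k' hk]
        exact β.dE_eq_zero r (N k) (N k') (P k) (P k') (by subst hk; simp only [P]; ring)
          (by simp only [N]; omega) j.2.1 (β.fam_mem_Z hl r _ _ (hsub k j.2))
      · rw [(F.pageCx r p q).shape k k' hk]
        rfl
    · intro k
      rw [he₃]
      exact BasisOf.subquot_range β.bSet_subset (hB k) (hZ k) (hi₃ k) (hd₃ k) (hu₃ k) (hw₃ k)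
  rw [pageTorsion, (F.page g r p q).torsion_homologyHilbert hA]
  refine finsum_congr fun k => congrArg _ ?_
  have hv₁ := (g (P k) (N k)).logVol_subquot_range β.bSet_subset (hB k) (hZ k) (hφi k) (hd₁ k)
    (hu₁ k) β.bSet_subset fun i => (hφ k i).1
  have hv₂ := (g (P k) (N k)).logVol_subquot_range β.bSet_subset (hB k) (hZ k) (hi₂ k) (hd₂ k)
    (hu₂ k) (hzz k) (hw₂ k)
  have hv₃ := (g (P k) (N k)).logVol_subquot_range β.bSet_subset (hB k) (hZ k) (hi₃ k) (hd₃ k)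
    (hu₃ k) subset_rfl (hw₃ k)
  have h1 : (fun j => ((F.pageCx r p q).d (k - 1) k).hom (y (k - 1) j)) =
      fun i => (Submodule.Quotient.mk ⟨β.fam (N k) (P k) (φ k i), (hφ k i).1⟩ :
        F.E r (P k) (N k)) := funext (hdy k)
  have e₁ := (congrArg (((F.page g r p q).hilbert k).logVol) h1).trans hv₁
  have e₂ := (congrArg (((F.page g r p q).hilbert k).logVol) (he₂ k)).trans hv₂
  have e₃ := (congrArg (((F.page g r p q).hilbert k).logVol) (he₃ k)).trans hv₃
  refine (congrArg₂ (· - ·) (congrArg₂ (· - ·) e₂ e₁) e₃).trans ?_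
  simp only [pageTerm, vol, P, N]
  ring

end Bars

end Filtration

/-! ### The comparison of the limit page with the graded cohomology -/

theorem injective_of_linearIndependent {V W ι : Type*} [AddCommGroup V] [Module ℝ V]
    [AddCommGroup W] [Module ℝ W] (f : V →ₗ[ℝ] W) {v : ι → V} (hv : BasisOf v ⊤)
    (h : LinearIndependent ℝ (f ∘ v)) : Function.Injective f := by
  have h1 := Submodule.range_ker_disjoint h
  rw [hv.span, top_disjoint] at h1
  exact LinearMap.ker_eq_bot.1 h1

theorem bracket_of_subsingleton {V W : Type*} [AddCommGroup V] [Module ℝ V]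
    [AddCommGroup W] [Module ℝ W] [Subsingleton V] (h : HilbertStructure V)
    (k : HilbertStructure W) (f : V →ₗ[ℝ] W) : bracket h k f = 0 := by
  have h1 : BasisOf (fun x : PEmpty.{1} => (x.elim : V)) ⊤ := BasisOf.of_subsingleton _ _
  rw [bracket_eq h k f (Function.injective_of_subsingleton f) h1,
    HilbertStructure.logVol_of_isEmpty, HilbertStructure.logVol_of_isEmpty, sub_zero]

namespace Filtration

variable {C : RealComplex.{u}} {F : Filtration C}

theorem FH_eq_of_eq {p p' : ℤ} (h : F.F p = F.F p') (n : ℤ) : F.FH p n = F.FH p' n := by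
  have h1 : ∀ K L : Subcomplex C, K = L →
      LinearMap.range (HomologicalComplex.homologyMap K.ι n).hom =
        LinearMap.range (HomologicalComplex.homologyMap L.ι n).hom := by
    rintro K _ rfl
    rfl
  exact h1 _ _ h

theorem ψBracket_eq_zero (l : ℕ) (hl : F.F l = ⊥)
    (g : ∀ p n, HilbertStructure ((F.gr p).homology n)) (h : ∀ n, HilbertStructure (C.homology n))
    (p q : ℤ) (hp : p < 0 ∨ l ≤ p) : F.ψBracket g h p q = 0 := by
  have h1 : F.FH p (p + q) = F.FH (p + 1) (p + q) := by
    refine FH_eq_of_eq ?_ _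
    rcases hp with hp | hp
    · rw [F.eq_top _ hp.le, F.eq_top _ (by omega)]
    · rw [F.eq_bot_of_le l hl _ hp, F.eq_bot_of_le l hl _ (by omega)]
  have : Subsingleton (Subquot (F.FH p (p + q)) (F.FH (p + 1) (p + q))) := by
    refine Submodule.Quotient.subsingleton_iff.2 ?_
    rw [← h1]
    exact Submodule.submoduleOf_self _
  exact bracket_of_subsingleton _ _ _

namespace Bars

variable {l : ℕ} (β : F.Bars l)

/-- The logarithmic volume of the basis of `F^{p,q}`, where `n = p + q`, given by the bars that are
not truncated in `C`. -/
noncomputable def limitVol (h : ∀ n, HilbertStructure (C.homology n)) (n p : ℤ) : ℝ :=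
  (h n).logVol fun w : {w : β.W n | β.a w < 0 ∧ p ≤ β.t w} => F.toC n (β.ω w.1 0)

/-- The isomorphism `ψ` matches the undying bars born at `p` in `H(C)` and in `E_∞`. -/
theorem bracket_ψ_eq (hl : F.F l = ⊥) (g : ∀ p n, HilbertStructure ((F.gr p).homology n))
    (h : ∀ n, HilbertStructure (C.homology n)) (p n : ℤ) (hp : 0 ≤ p) :
    bracket ((h n).subquot (F.FH p n) (F.FH (p + 1) n))
        ((g p n).subquot (F.ZInf p n) (F.BInf p n)) (F.ψ p n) =
      β.vol g n p (β.zSet n p l) - β.vol g n p (β.bSet n p 0) - β.limitVol h n p +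
        β.limitVol h n (p + 1) := by
  let T : Set (β.W n) := {w | β.a w < 0 ∧ β.t w = p}
  let f : β.W n → C.homology n := fun w => F.toC n (β.ω w 0)
  let s : Set (β.W n) := {w | β.a w < 0 ∧ p + 1 ≤ β.t w}
  let t : Set (β.W n) := {w | β.a w < 0 ∧ p ≤ β.t w}
  have hst : s ⊆ t := fun w hw => ⟨hw.1, (Int.le_add_one le_rfl).trans hw.2⟩
  have hs : BasisOf (fun w : s => f w) (F.FH (p + 1) n) := β.basis_FH hl n (p + 1) (by omega)
  have ht : BasisOf (fun w : t => f w) (F.FH p n) := β.basis_FH hl n p hp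
  have hTs : ∀ w : T, w.1 ∉ s := fun w hw => by
    have h1 := w.2.2
    have h2 := hw.2
    omega
  have hT : s ∪ Set.range (Subtype.val : T → β.W n) = t := by
    rw [Subtype.range_coe]
    ext w
    simp only [s, t, T, Set.mem_union, Set.mem_ofPred_eq]
    omega
  have hf : ∀ w : T, f w.1 ∈ F.FH p n := fun w => ht.mem ⟨w.1, w.2.1, w.2.2.ge⟩
  have hb : β.bSet n p 0 ⊆ β.zSet n p l := β.bSet_subset
  have hφ : Function.Injective fun w : T => (Sum.inl w.1 : β.I n) :=
    Sum.inl_injective.comp Subtype.val_injective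
  have hφs : ∀ w : T, (Sum.inl w.1 : β.I n) ∉ β.bSet n p 0 := fun w hw => by
    have h1 := w.2.1
    have h2 := β.inl_mem_bSet.1 hw
    omega
  have hφT : β.bSet n p 0 ∪ Set.range (fun w : T => (Sum.inl w.1 : β.I n)) = β.zSet n p l := by
    ext (w | w)
    · simp only [Set.mem_union, inl_mem_bSet, inl_mem_zSet, Set.mem_range, Sum.inl.injEq,
        Subtype.exists, exists_prop, exists_eq_right]
      simp only [T, Set.mem_ofPred_eq]
      omega
    · have h1 := β.bounds w
      simp only [Set.mem_union, Set.mem_range, inr_mem_zSet, reduceCtorEq, exists_false, or_false]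
      exact ⟨fun hw => (β.inr_notMem_bSet hw).elim, fun hw => by omega⟩
  have hg : ∀ w : T, β.fam n p (Sum.inl w.1) ∈ F.ZInf p n := fun w => ⟨β.ω w.1 p, rfl⟩
  have hv := BasisOf.subquot_range hst hs ht Subtype.val_injective hTs hT hf
  have hv' := BasisOf.subquot_range hb (β.basis_BInf hl n p) (β.basis_ZInf hl n p) hφ hφs hφT hg
  have h1 : F.ψ p n ∘ (fun w : T => (Submodule.Quotient.mk ⟨f w.1, hf w⟩ :
      Subquot (F.FH p n) (F.FH (p + 1) n))) =
      fun w => (Submodule.Quotient.mk ⟨β.fam n p (Sum.inl w.1), hg w⟩ : F.EInf p n) := by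
    funext w
    have h2 : f w.1 = (HomologicalComplex.homologyMap (F.F p).ι n).hom (β.ω w.1 p) := by
      rw [← F.toC_incl n p hp, β.incl_ω w.1 0 p hp w.2.2.ge]
    have h3 : (Submodule.Quotient.mk ⟨f w.1, hf w⟩ : Subquot (F.FH p n) (F.FH (p + 1) n)) =
        Submodule.Quotient.mk ⟨(HomologicalComplex.homologyMap (F.F p).ι n).hom (β.ω w.1 p),
          β.ω w.1 p, rfl⟩ := by
      congr 1
      exact Subtype.ext h2
    rw [Function.comp_apply, h3]
    exact imageMap_mk _ _ _ _ (F.FH_mem p n) (β.ω w.1 p)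
  rw [bracket_eq _ _ (F.ψ p n) (injective_of_linearIndependent _ hv (h1 ▸ hv'.li)) hv, h1,
    (g p n).logVol_subquot_range hb (β.basis_BInf hl n p) (β.basis_ZInf hl n p) hφ hφs hφT
      subset_rfl hg,
    (h n).logVol_subquot_range hst hs ht Subtype.val_injective hTs hT subset_rfl hf]
  simp only [vol, limitVol]
  change _ - ((h n).logVol (fun w : t => f w) - (h n).logVol fun w : s => f w) =
    _ - (h n).logVol (fun w : t => f w) + (h n).logVol fun w : s => f w
  ring

end Bars

end Filtration

/-! ### The torsion of the preferred simple structure -/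

theorem BasisOf.module_finite {V ι : Type*} [AddCommGroup V] [Module ℝ V] [Finite ι] {v : ι → V}
    (h : BasisOf v ⊤) : Module.Finite ℝ V :=
  ⟨Submodule.fg_def.2 ⟨_, Set.finite_range v, h.span⟩⟩

theorem nonempty_hilbertStructure (V : Type*) [AddCommGroup V] [Module ℝ V] [Module.Finite ℝ V] :
    Nonempty (HilbertStructure V) := by
  let b := Module.finBasis ℝ V
  refine ⟨HilbertStructure.mk' inferInstance (fun x y => ∑ i, b.repr x i * b.repr y i)
    (fun x y => Finset.sum_congr rfl fun i _ => mul_comm _ _)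
    (fun x => Finset.sum_nonneg fun i _ => mul_self_nonneg _)
    (fun x y z => by simp [add_mul, Finset.sum_add_distrib])
    (fun r x y => by simp [Finset.mul_sum, mul_assoc]) fun x hx => ?_⟩
  rw [Finset.sum_eq_zero_iff_of_nonneg fun i _ => mul_self_nonneg _] at hx
  refine b.repr.injective (Finsupp.ext fun i => ?_)
  rw [map_zero]
  exact mul_self_eq_zero.1 (hx i (Finset.mem_univ i))

namespace Filtration

variable {C : RealComplex.{u}} {F : Filtration C}

namespace Bars

variable {l : ℕ} (β : F.Bars l)

/-- The alternating sum of the logarithmic volumes of the bases of the cohomology of `F_p` that are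
given by the bars. -/
noncomputable def stageVol (p : ℤ) (h : ∀ n, HilbertStructure ((F.F p).toCx.homology n)) : ℝ :=
  cohomologyVol h fun n (w : {w : β.W n | β.a w < p ∧ p ≤ β.t w}) => β.ω w.1 p

/-- The alternating sum of the logarithmic volumes of the bases of the cohomology of `F_p / F_{p+1}`
that are given by the bars. -/
noncomputable def grVol (g : ∀ p n, HilbertStructure ((F.gr p).homology n)) (p : ℤ) : ℝ :=
  ∑ᶠ n : ℤ, (-1 : ℝ) ^ n * β.vol g n p (β.zSet n p (p + 1))

/-- The bars that die at `p`, seen as boundaries, and the bars that continue beyond `p` in both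
directions form a basis of the cohomology of `F_{p+1}`. -/
theorem exists_stage_index (p m n : ℤ) (hp : 0 ≤ p) (hm : m + 1 = n) :
    ∃ φ : {w : β.W (m + 1) | β.a w = p} ⊕ {w : β.W n | β.a w < p ∧ p + 1 ≤ β.t w} → β.W n,
      Function.Injective φ ∧ Set.range φ = {w : β.W n | β.a w < p + 1 ∧ p + 1 ≤ β.t w} ∧
      (Sum.elim (fun j : {w : β.W (m + 1) | β.a w = p} =>
          F.conn m n p (p + 1) (by omega) hm (β.kap m j.1 p))
        fun j : {w : β.W n | β.a w < p ∧ p + 1 ≤ β.t w} => β.ω j.1 (p + 1)) =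
        fun j => β.ω (φ j) (p + 1) := by
  subst hm
  refine ⟨Sum.elim Subtype.val Subtype.val, ?_, ?_, ?_⟩
  · refine Subtype.val_injective.sumElim Subtype.val_injective fun i j hij => ?_
    have h1 : β.a i.1 = p := i.2
    have h2 : β.a j.1 < p := j.2.1
    rw [hij] at h1
    omega
  · rw [Set.Sum.elim_range, Subtype.range_coe, Subtype.range_coe]
    ext w
    have := β.bounds w
    simp only [Set.mem_union, Set.mem_ofPred_eq]
    omega
  · funext j
    rcases j with j | j
    · exact β.conn_kap m j.1 p j.2 hp
    · rfl

/-- The torsion of `F_p` from those of `F_{p+1}` and `F_p / F_{p+1}`: the basis of the cohomology of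
`F_{p+1}` consists of the boundaries of the classes `kap` and of the bars that continue to `F_p`. -/
theorem torsion_step (hl : F.F l = ⊥) (g : ∀ p n, HilbertStructure ((F.gr p).homology n)) (p : ℤ)
    (hp : 0 ≤ p) (hpl : p < l) {τ' : SimpleStructure (F.F (p + 1)).toCx}
    {τ : SimpleStructure (F.F p).toCx} {υ : SimpleStructure (F.gr p)}
    (hτ : HasSequenceTorsion (Subcomplex.inclusion (F.anti p (p + 1) (by omega)))
      ((F.F p).π (F.F (p + 1))) τ' τ υ 0)
    (h : ∀ n, HilbertStructure ((F.F p).toCx.homology n))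
    (h' : ∀ n, HilbertStructure ((F.F (p + 1)).toCx.homology n)) :
    τ.torsion h - β.stageVol p h =
      (τ'.torsion h' - β.stageVol (p + 1) h') + (υ.torsion (g p) - β.grVol g p) := by
  obtain ⟨u₁, u₂, u₃, a, b, ha, hab, hb, hu₁, hu₂, hu₃, haf, hbg, h0⟩ := hτ
  have hS := Subcomplex.pairSeq_shortExact (F.anti p (p + 1) (by omega))
  let lam : ∀ n, {w : β.W n | β.a w < p ∧ p + 1 ≤ β.t w} → (F.F (p + 1)).toCx.homology n :=
    fun n w => β.ω w.1 (p + 1)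
  let kap : ∀ n, {w : β.W (n + 1) | β.a w = p} → (F.gr p).homology n := fun n w => β.kap n w.1 p
  let mu : ∀ n, {w : β.W n | β.t w = p} → (F.F p).toCx.homology n := fun n w => β.ω w.1 p
  choose φ₁ hi₁ hr₁ he₁ using fun n : ℤ => β.exists_stage_index p (n - 1) n hp (sub_add_cancel n 1)
  let φ₂ : ∀ n, {w : β.W n | β.a w < p ∧ p + 1 ≤ β.t w} ⊕ {w : β.W n | β.t w = p} → β.W n :=
    fun n => Sum.elim Subtype.val Subtype.val
  have hi₂ : ∀ n, Function.Injective (φ₂ n) := fun n =>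
    Subtype.val_injective.sumElim Subtype.val_injective fun i j hij => by
      have h1 : p + 1 ≤ β.t i.1 := i.2.2
      have h2 : β.t j.1 = p := j.2
      rw [hij] at h1
      omega
  have hr₂ : ∀ n, Set.range (φ₂ n) = {w | β.a w < p ∧ p ≤ β.t w} := fun n => by
    rw [Set.Sum.elim_range, Subtype.range_coe, Subtype.range_coe]
    ext w
    have := β.bounds w
    simp only [Set.mem_union, Set.mem_ofPred_eq]
    omega
  have he₂ : ∀ n, Sum.elim (fun j => F.incl n p (p + 1) (by omega) (lam n j)) (mu n) =
      fun j => β.ω (φ₂ n j) p := fun n => by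
    funext j
    rcases j with j | j
    · exact β.incl_ω j.1 p (p + 1) (by omega) j.2.2
    · rfl
  let φ₃ : ∀ n, {w : β.W n | β.t w = p} ⊕ {w : β.W (n + 1) | β.a w = p} → β.I n :=
    fun n => Sum.elim (fun w => Sum.inl w.1) fun w => Sum.inr w.1
  have hi₃ : ∀ n, Function.Injective (φ₃ n) := fun n =>
    (Sum.inl_injective.comp Subtype.val_injective).sumElim
      (Sum.inr_injective.comp Subtype.val_injective) fun i j => Sum.inl_ne_inr
  have hr₃ : ∀ n, Set.range (φ₃ n) = β.zSet n p (p + 1) := fun n => by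
    ext (w | w)
    · rw [inl_mem_zSet]
      constructor
      · rintro ⟨j | j, hj⟩
        · cases hj
          exact j.2
        · cases hj
      · exact fun hw => ⟨.inl ⟨w, hw⟩, rfl⟩
    · rw [inr_mem_zSet]
      constructor
      · rintro ⟨j | j, hj⟩
        · cases hj
        · cases hj
          have h1 : β.a j.1 = p := j.2
          have h2 := β.bounds j.1
          omega
      · exact fun hw => ⟨.inr ⟨w, hw.1⟩, rfl⟩
  have he₃ : ∀ n, Sum.elim (fun j => F.proj n p (p + 1) (mu n j)) (kap n) =
      fun j => β.fam n p (φ₃ n j) := fun n => by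
    funext j
    rcases j with j | j <;> rfl
  have key := torsion_additive hS ha hab hb haf hbg lam kap mu
    (fun n => by
      refine Eq.mpr (congrArg (BasisOf · _) (he₁ n)) ?_
      exact (β.basis n (p + 1) (by omega) (by omega)).of_range (f := fun w => β.ω w (p + 1))
        (hi₁ n) (hr₁ n))
    (fun n => by
      refine Eq.mpr (congrArg (BasisOf · _) (he₂ n)) ?_
      exact (β.basis n p hp hpl.le).of_range (f := fun w => β.ω w p) (hi₂ n) (hr₂ n))
    (fun n => by
      refine Eq.mpr (congrArg (BasisOf · _) (he₃ n)) ?_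
      exact (β.basis_gr hl n p).of_range (hi₃ n) (hr₃ n)) h' h (g p)
  rw [h0, sub_zero] at key
  rw [SimpleStructure.torsion_eq hu₁, SimpleStructure.torsion_eq hu₂,
    SimpleStructure.torsion_eq hu₃]
  refine Eq.trans (congrArg (HSub.hSub _) ?_) (key.trans
    (congrArg₂ (· + ·) (congrArg (HSub.hSub _) ?_) (congrArg (HSub.hSub _) ?_)))
  · refine finsum_congr fun n => congrArg _ ?_
    exact (((h n).logVol_range (fun w => β.ω w p) (hi₂ n) (hr₂ n)).symm).trans
      (congrArg (h n).logVol (he₂ n).symm)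
  · refine finsum_congr fun n => congrArg _ ?_
    exact (congrArg (h' n).logVol (he₁ n)).trans
      ((h' n).logVol_range (fun w => β.ω w (p + 1)) (hi₁ n) (hr₁ n))
  · refine finsum_congr fun n => congrArg _ ?_
    exact (congrArg (g p n).logVol (he₃ n)).trans
      ((g p n).logVol_range (β.fam n p) (hi₃ n) (hr₃ n))

/-- The torsion of the preferred simple structure on `F_p`, by descending induction: relative to the
bases given by the bars, torsions add up. -/
theorem torsion_of_isPreferredAt (hl : F.F l = ⊥) (σ : ∀ p, SimpleStructure (F.gr p))
    (g : ∀ p n, HilbertStructure ((F.gr p).homology n)) {p : ℤ}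
    {τ : SimpleStructure (F.F p).toCx} (hτ : F.IsPreferredAt l σ p τ) (hp : 0 ≤ p)
    (h : ∀ n, HilbertStructure ((F.F p).toCx.homology n)) :
    τ.torsion h - β.stageVol p h =
      ∑ p' ∈ Finset.Ico p l, ((σ p').torsion (g p') - β.grVol g p') := by
  induction hτ with
  | base τ u hu hτ =>
    -- The complex `F_l` and its trivial representative vanish, so all volumes in sight are `0`.
    have hη := fun n => β.basis n l hp le_rfl
    obtain ⟨ι, y, e, hye, he⟩ := u.exists_isAdapted _ hη
    have := fun n => (hye.finite n).1
    rw [Finset.Ico_self, Finset.sum_empty, SimpleStructure.torsion_eq hτ,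
      u.torsion_eq hye h _ hη he, stageVol, sub_right_comm, sub_self, zero_sub, neg_eq_zero]
    refine (finsum_congr fun n => ?_).trans finsum_zero
    rw [HilbertStructure.logVol_of_subsingleton _ (hye.basis n).li, mul_zero]
  | step p hpl τ' τ hτ' hτ ih =>
    have h' : ∀ n, Nonempty (HilbertStructure ((F.F (p + 1)).toCx.homology n)) := fun n => by
      have := (β.basis n (p + 1) (by omega) (by omega)).module_finite
      exact nonempty_hilbertStructure _
    rw [β.torsion_step hl g p hp hpl hτ h fun n => (h' n).some,
      ih (by omega) fun n => (h' n).some, add_comm]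
    have h1 : Finset.Ico p (l : ℤ) = insert p (Finset.Ico (p + 1) (l : ℤ)) := by
      ext x
      simp only [Finset.mem_Ico, Finset.mem_insert]
      omega
    rw [h1, Finset.sum_insert (by simp)]

end Bars

end Filtration

/-! ### Summation over all pages -/

theorem finsum_eq_sum_Icc {φ : ℤ → ℝ} (M : ℕ) (h : ∀ n : ℤ, (M : ℤ) ≤ |n| → φ n = 0) :
    ∑ᶠ n : ℤ, (-1 : ℝ) ^ n * φ n = ∑ n ∈ Finset.Icc (-(M : ℤ)) M, (-1 : ℝ) ^ n * φ n := by
  refine finsum_eq_sum_of_support_subset _ fun n hn => ?_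
  rw [Finset.mem_coe, Finset.mem_Icc, ← abs_le]
  by_contra h1
  refine hn ?_
  beta_reduce
  rw [h n (by omega), mul_zero]

theorem finsum_shift (φ : ℤ → ℝ) (p : ℤ) :
    ∑ᶠ q : ℤ, (-1 : ℝ) ^ (p + q) * φ (p + q) = ∑ᶠ n : ℤ, (-1 : ℝ) ^ n * φ n :=
  finsum_comp_equiv (Equiv.addLeft p) (f := fun n => (-1 : ℝ) ^ n * φ n)

theorem sum_Ico_sub_succ (f : ℤ → ℝ) (l : ℕ) :
    ∑ p ∈ Finset.Ico (0 : ℤ) l, (f p - f (p + 1)) = f 0 - f l := by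
  induction l with
  | zero => simp
  | succ l ih =>
    have h1 : Finset.Ico (0 : ℤ) ((l + 1 : ℕ) : ℤ) = insert (l : ℤ) (Finset.Ico (0 : ℤ) l) := by
      ext x
      simp only [Finset.mem_Ico, Finset.mem_insert]
      omega
    rw [h1, Finset.sum_insert (by simp), ih]
    push_cast
    ring

/-- Division with remainder by `r`, for a function supported in `[0, l)`. -/
theorem sum_Ico_div_mod (G : ℤ → ℝ) (l : ℕ) (r : ℕ+) (hG : ∀ P : ℤ, P < 0 ∨ l ≤ P → G P = 0) :
    ∑ p ∈ Finset.Ico (0 : ℤ) r, ∑ k ∈ Finset.Ico (0 : ℤ) l, G (p + r * k) =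
      ∑ P ∈ Finset.Ico (0 : ℤ) l, G P := by
  have hr : (0 : ℤ) < r := by exact_mod_cast r.pos
  rw [← Finset.sum_product']
  have h1 : ∑ x ∈ Finset.Ico (0 : ℤ) r ×ˢ Finset.Ico (0 : ℤ) l, G (x.1 + r * x.2) =
      ∑ P ∈ Finset.Ico (0 : ℤ) (r * l), G P := by
    refine Finset.sum_nbij' (fun x => x.1 + r * x.2) (fun P => (P % r, P / r)) ?_ ?_ ?_ ?_
      fun _ _ => rfl
    · rintro ⟨p, k⟩ h
      simp only [Finset.mem_product, Finset.mem_Ico] at h ⊢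
      constructor
      · have := mul_nonneg hr.le h.2.1
        omega
      · have h2 : (r : ℤ) * (k + 1) ≤ r * l := mul_le_mul_of_nonneg_left (by omega) hr.le
        rw [mul_add] at h2
        omega
    · intro P h
      simp only [Finset.mem_product, Finset.mem_Ico] at h ⊢
      exact ⟨⟨Int.emod_nonneg _ hr.ne', Int.emod_lt_of_pos _ hr⟩, Int.ediv_nonneg h.1 hr.le,
        Int.ediv_lt_of_lt_mul hr (by rw [mul_comm]; exact h.2)⟩
    · rintro ⟨p, k⟩ h
      simp only [Finset.mem_product, Finset.mem_Ico] at h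
      refine Prod.ext ?_ ?_
      · change (p + r * k) % r = p
        rw [Int.add_mul_emod_self_left, Int.emod_eq_of_lt h.1.1 h.1.2]
      · change (p + r * k) / r = k
        rw [Int.add_mul_ediv_left _ _ hr.ne', Int.ediv_eq_zero_of_lt h.1.1 h.1.2, zero_add]
    · intro P _
      exact Int.emod_add_mul_ediv P r
  rw [h1]
  refine (Finset.sum_subset (fun P hP => ?_) fun P hP hP' => hG P ?_).symm
  · rw [Finset.mem_Ico] at hP ⊢
    have h2 : (1 : ℤ) * l ≤ r * l := mul_le_mul_of_nonneg_right (by omega) (by omega)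
    omega
  · rw [Finset.mem_Ico] at hP hP'
    omega

namespace Filtration

variable {C : RealComplex.{u}} {F : Filtration C}

namespace Bars

variable {l : ℕ} (β : F.Bars l)

theorem exists_bound : ∃ M : ℕ, ∀ n : ℤ, (M : ℤ) ≤ |n| → IsEmpty (β.I n) := by
  obtain ⟨N, hN⟩ := β.bounded
  refine ⟨N + 1, fun n hn => ?_⟩
  have h1 := hN n (by omega)
  have h2 := hN (n + 1) (by
    have := abs_sub_abs_le_abs_sub n (-1)
    rw [abs_neg, abs_one, sub_neg_eq_add] at this
    omega)
  exact isEmpty_sum.2 ⟨h1, h2⟩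

theorem zSet_of_le {n p s : ℤ} (hs : l ≤ s) : β.zSet n p s = β.zSet n p l := by
  ext (w | w)
  · rw [inl_mem_zSet, inl_mem_zSet]
  · have := β.bounds w
    rw [inr_mem_zSet, inr_mem_zSet]
    omega

theorem bSet_of_nonpos {n p c : ℤ} (hc : c ≤ 0) : β.bSet n p c = β.bSet n p 0 := by
  ext (w | w)
  · rw [inl_mem_bSet, inl_mem_bSet]
    omega
  · exact iff_of_false β.inr_notMem_bSet β.inr_notMem_bSet

theorem bSet_self {n p : ℤ} : β.bSet n p p = ∅ := by
  rw [Set.eq_empty_iff_forall_notMem]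
  rintro (w | w) hw
  · have := β.bounds w
    rw [inl_mem_bSet] at hw
    omega
  · exact β.inr_notMem_bSet hw

variable (g : ∀ p n, HilbertStructure ((F.gr p).homology n))

theorem vol_of_isEmpty {n : ℤ} (hn : IsEmpty (β.I n)) (p : ℤ) (T : Set (β.I n)) :
    β.vol g n p T = 0 := HilbertStructure.logVol_of_isEmpty _ _

theorem pageTerm_of_isEmpty (r : ℕ+) {n : ℤ} (hn : IsEmpty (β.I n)) (p : ℤ) :
    β.pageTerm g r n p = 0 := by
  simp only [pageTerm, β.vol_of_isEmpty g hn]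
  ring

theorem pageTerm_of_notMem (r : ℕ+) (n p : ℤ) (hp : p < 0 ∨ l ≤ p) : β.pageTerm g r n p = 0 := by
  simp only [pageTerm, β.zSet_eq_empty hp, β.bSet_eq_empty hp, vol_empty]
  ring

theorem pageTerm_of_le (r : ℕ+) (n p : ℤ) (hr : (l : ℤ) ≤ r) : β.pageTerm g r n p = 0 := by
  by_cases hp : p < 0 ∨ l ≤ p
  · exact β.pageTerm_of_notMem g r n p hp
  · rw [pageTerm, β.zSet_of_le (s := p + r + 1) (by omega), β.zSet_of_le (s := p + r) (by omega),
      β.bSet_of_nonpos (c := p - r + 1) (by omega), β.bSet_of_nonpos (c := p - r) (by omega)]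
    ring

/-- The contributions of `E_1, E_2, …` in a fixed bidegree telescope. -/
theorem sum_pageTerm (n p : ℤ) (hp : 0 ≤ p) :
    ∑ m ∈ Finset.range l, β.pageTerm g m.succPNat n p =
      β.vol g n p (β.zSet n p l) - β.vol g n p (β.zSet n p (p + 1)) -
        β.vol g n p (β.bSet n p 0) := by
  by_cases hpl : l ≤ p
  · rw [Finset.sum_eq_zero fun m _ => β.pageTerm_of_notMem g _ n p (.inr hpl),
      β.zSet_eq_empty (.inr hpl), β.zSet_eq_empty (.inr hpl), β.bSet_eq_empty (.inr hpl), vol_empty]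
    ring
  · have h1 := Finset.sum_range_sub (fun m : ℕ => β.vol g n p (β.zSet n p (p + m + 1)) -
      β.vol g n p (β.bSet n p (p - m))) l
    rw [β.zSet_of_le (s := p + l + 1) (by omega), β.bSet_of_nonpos (c := p - l) (by omega),
      Nat.cast_zero, add_zero, sub_zero, bSet_self, vol_empty, sub_zero] at h1
    rw [sub_right_comm, ← h1]
    refine Finset.sum_congr rfl fun m _ => ?_
    have h2 : ((m.succPNat : ℕ+) : ℤ) = m + 1 := by
      rw [Nat.succPNat_coe, Nat.cast_succ]
    simp only [pageTerm, h2, Nat.cast_add, Nat.cast_one]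
    rw [show p - ((m : ℤ) + 1) + 1 = p - m by ring, show p + ((m : ℤ) + 1) = p + m + 1 by ring]
    ring

/-- The sum of the torsions of all the complexes into which the `r`-th page decomposes. -/
theorem sum_pageTorsion (hl : F.F l = ⊥) (r : ℕ+) {M : ℕ}
    (hM : ∀ n : ℤ, (M : ℤ) ≤ |n| → IsEmpty (β.I n)) :
    ∑ p ∈ Finset.Ico (0 : ℤ) r, ∑ᶠ q : ℤ, (-1 : ℝ) ^ (p + q) * F.pageTorsion g r p q =
      ∑ p ∈ Finset.Ico (0 : ℤ) l, ∑ n ∈ Finset.Icc (-(M : ℤ)) M,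
        (-1 : ℝ) ^ n * β.pageTerm g r n p := by
  have hr : (0 : ℤ) < r := by exact_mod_cast r.pos
  have h0 : ∀ P, ∀ n : ℤ, (M : ℤ) ≤ |n| → β.pageTerm g r n P = 0 := fun P n hn =>
    β.pageTerm_of_isEmpty g r (hM n hn) P
  rw [← sum_Ico_div_mod (fun P => ∑ n ∈ Finset.Icc (-(M : ℤ)) M,
    (-1 : ℝ) ^ n * β.pageTerm g r n P) l r fun P hP => Finset.sum_eq_zero fun n _ => by
      rw [β.pageTerm_of_notMem g r n P hP, mul_zero]]
  refine Finset.sum_congr rfl fun p hp => ?_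
  rw [Finset.mem_Ico] at hp
  have h1 : ∀ q : ℤ, (-1 : ℝ) ^ (p + q) * F.pageTorsion g r p q =
      ∑ k ∈ Finset.Ico (0 : ℤ) l,
        (-1 : ℝ) ^ (p + k + q) * β.pageTerm g r (p + k + q) (p + r * k) := fun q => by
    rw [β.pageTorsion_eq hl g r p q, finsum_eq_sum_of_support_subset (s := Finset.Ico (0 : ℤ) l)]
    · rw [Finset.mul_sum]
      refine Finset.sum_congr rfl fun k _ => ?_
      rw [← mul_assoc, ← zpow_add₀ (by norm_num), show p + k + q = p + q + k by ring]
    · intro k hk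
      rw [Finset.mem_coe, Finset.mem_Ico]
      by_contra h2
      refine hk ?_
      beta_reduce
      rw [β.pageTerm_of_notMem g r _ (p + r * k), mul_zero]
      rcases lt_or_ge k 0 with h3 | h3
      · have h4 : (r : ℤ) * (k + 1) ≤ r * 0 := mul_le_mul_of_nonneg_left (by omega) hr.le
        rw [mul_zero, mul_add] at h4
        left
        omega
      · have h4 : (1 : ℤ) * k ≤ r * k := mul_le_mul_of_nonneg_right (by omega) h3
        right
        omega
  rw [finsum_congr h1, finsum_sum_comm]
  · refine Finset.sum_congr rfl fun k _ => ?_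
    rw [finsum_shift (fun n => β.pageTerm g r n (p + r * k)) (p + k),
      finsum_eq_sum_Icc M (h0 _)]
  · intro k _
    refine ((Set.finite_Icc (-(M : ℤ)) M).preimage (f := fun q => p + k + q)
      (add_right_injective _).injOn).subset fun q hq => ?_
    refine abs_le.1 ?_
    by_contra h2
    refine hq ?_
    beta_reduce at h2 ⊢
    rw [h0 _ _ (by omega), mul_zero]

variable (h : ∀ n, HilbertStructure (C.homology n))

theorem limitVol_of_le (n p : ℤ) (hp : l ≤ p) : β.limitVol h n p = 0 := by
  have : IsEmpty {w : β.W n | β.a w < 0 ∧ p ≤ β.t w} := ⟨fun w => by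
    have h1 := β.bounds w.1
    have h2 := w.2.2
    omega⟩
  exact HilbertStructure.logVol_of_isEmpty _ _

theorem limitVol_of_isEmpty {n : ℤ} (hn : IsEmpty (β.I n)) (p : ℤ) : β.limitVol h n p = 0 := by
  have := (isEmpty_sum.1 hn).1
  exact HilbertStructure.logVol_of_isEmpty _ _

theorem torsion_eq_of_isPreferred (hl : F.F l = ⊥) (σ : ∀ p, SimpleStructure (F.gr p))
    {σC : SimpleStructure C} (hσ : F.IsPreferred l σ σC) :
    σC.torsion h = ∑ p ∈ Finset.Ico (0 : ℤ) l, ((σ p).torsion (g p) - β.grVol g p) +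
      ∑ᶠ n : ℤ, (-1 : ℝ) ^ n * β.limitVol h n 0 := by
  obtain ⟨τ, hτ, rfl⟩ := hσ
  let h' : ∀ n, HilbertStructure ((F.F 0).toCx.homology n) := fun n =>
    (h n).comap (F.toC n) (F.toC_bijective n).1
  rw [← β.torsion_of_isPreferredAt hl σ g hτ le_rfl h', ← sub_eq_iff_eq_add]
  exact SimpleStructure.transport_torsion F.isoZero τ h h'
    (fun n (w : {w : β.W n | β.a w < 0 ∧ 0 ≤ β.t w}) => β.ω w.1 0)
    fun n => β.basis n 0 le_rfl (by omega)

/-- The logarithmic volumes that enter the filtered torsion telescope to those that enter the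
torsion of the preferred simple structure. -/
theorem filteredTorsion_eq (hl : F.F l = ⊥) (σ : ∀ p, SimpleStructure (F.gr p)) :
    F.filteredTorsion l σ g h =
      ∑ p ∈ Finset.Ico (0 : ℤ) l, ((σ p).torsion (g p) - β.grVol g p) +
      ∑ᶠ n : ℤ, (-1 : ℝ) ^ n * β.limitVol h n 0 := by
  obtain ⟨M, hM⟩ := β.exists_bound
  let A := Finset.Icc (-(M : ℤ)) M
  have hpage : ∑ᶠ r : ℕ+, ∑ p ∈ Finset.Ico (0 : ℤ) r,
      ∑ᶠ q : ℤ, (-1 : ℝ) ^ (p + q) * F.pageTorsion g r p q =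
      ∑ p ∈ Finset.Ico (0 : ℤ) l, ∑ n ∈ A, (-1 : ℝ) ^ n * (β.vol g n p (β.zSet n p l) -
        β.vol g n p (β.zSet n p (p + 1)) - β.vol g n p (β.bSet n p 0)) := by
    rw [finsum_congr fun r => β.sum_pageTorsion g hl r hM,
      ← finsum_comp_equiv Equiv.pnatEquivNat.symm,
      finsum_eq_sum_of_support_subset (s := Finset.range l)]
    · rw [Finset.sum_comm]
      refine Finset.sum_congr rfl fun p hp => ?_
      rw [Finset.sum_comm]
      refine Finset.sum_congr rfl fun n _ => ?_
      rw [← Finset.mul_sum, ← β.sum_pageTerm g n p (Finset.mem_Ico.1 hp).1]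
      rfl
    · intro m hm
      rw [Finset.mem_coe, Finset.mem_range]
      by_contra h2
      refine hm (Finset.sum_eq_zero fun p _ => Finset.sum_eq_zero fun n _ => ?_)
      rw [β.pageTerm_of_le, mul_zero]
      change (l : ℤ) ≤ (m.succPNat : ℕ)
      rw [Nat.succPNat_coe]
      omega
  have hψ : ∑ᶠ (p : ℤ) (q : ℤ), (-1 : ℝ) ^ (p + q) * F.ψBracket g h p q =
      ∑ p ∈ Finset.Ico (0 : ℤ) l, ∑ n ∈ A, (-1 : ℝ) ^ n * (β.vol g n p (β.zSet n p l) -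
        β.vol g n p (β.bSet n p 0) - β.limitVol h n p + β.limitVol h n (p + 1)) := by
    rw [finsum_eq_sum_of_support_subset (s := Finset.Ico (0 : ℤ) l)]
    · refine Finset.sum_congr rfl fun p hp => ?_
      refine (finsum_congr fun q => congrArg ((-1 : ℝ) ^ (p + q) * ·)
        (β.bracket_ψ_eq hl g h p (p + q) (Finset.mem_Ico.1 hp).1)).trans ?_
      rw [finsum_shift (fun n => β.vol g n p (β.zSet n p l) -
          β.vol g n p (β.bSet n p 0) - β.limitVol h n p + β.limitVol h n (p + 1)) p,
        finsum_eq_sum_Icc M fun n hn => ?_]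
      rw [β.vol_of_isEmpty g (hM n hn), β.vol_of_isEmpty g (hM n hn),
        β.limitVol_of_isEmpty h (hM n hn), β.limitVol_of_isEmpty h (hM n hn)]
      ring
    · intro p hp
      rw [Finset.mem_coe, Finset.mem_Ico]
      by_contra h2
      refine hp ((finsum_congr fun q => ?_).trans finsum_zero)
      rw [ψBracket_eq_zero l hl g h p q (by omega), mul_zero]
  have hgr : ∀ p, β.grVol g p = ∑ n ∈ A, (-1 : ℝ) ^ n * β.vol g n p (β.zSet n p (p + 1)) :=
    fun p => finsum_eq_sum_Icc M fun n hn => β.vol_of_isEmpty g (hM n hn) _ _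
  have hlim : ∑ᶠ n : ℤ, (-1 : ℝ) ^ n * β.limitVol h n 0 =
      ∑ p ∈ Finset.Ico (0 : ℤ) l, ∑ n ∈ A,
        (-1 : ℝ) ^ n * (β.limitVol h n p - β.limitVol h n (p + 1)) := by
    rw [finsum_eq_sum_Icc M fun n hn => β.limitVol_of_isEmpty h (hM n hn) 0, Finset.sum_comm]
    refine Finset.sum_congr rfl fun n _ => ?_
    rw [← Finset.mul_sum, sum_Ico_sub_succ (fun p => β.limitVol h n p),
      β.limitVol_of_le h n l le_rfl, sub_zero]
  rw [filteredTorsion, hpage, hψ, hlim, add_sub_assoc, ← Finset.sum_sub_distrib,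
    Finset.sum_sub_distrib (fun p => (σ p).torsion (g p)), sub_add_eq_add_sub, add_sub_assoc,
    ← Finset.sum_sub_distrib]
  congr 1
  refine Finset.sum_congr rfl fun p _ => ?_
  rw [hgr, ← Finset.sum_sub_distrib, ← Finset.sum_sub_distrib]
  exact Finset.sum_congr rfl fun n _ => by ring

theorem finite_pageTorsion (β : F.Bars l) (hl : F.F l = ⊥) :
    {x : ℕ+ × ℤ × ℤ | x.2.1 ∈ Finset.Ico (0 : ℤ) x.1 ∧
      F.pageTorsion g x.1 x.2.1 x.2.2 ≠ 0}.Finite := by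
  obtain ⟨M, hM⟩ := β.exists_bound
  refine ((Set.finite_Iic l.succPNat).prod ((Set.finite_Icc (0 : ℤ) l).prod
    (Set.finite_Icc (-(M + 2 * l : ℤ)) M))).subset ?_
  rintro ⟨r, p, q⟩ ⟨hp, hx⟩
  rw [Finset.mem_Ico] at hp
  have hx' : F.pageTorsion g r p q ≠ 0 := hx
  simp only at hp
  have hr : (0 : ℤ) < r := by exact_mod_cast r.pos
  obtain ⟨k, hk⟩ : ∃ k, β.pageTerm g r (p + q + k) (p + r * k) ≠ 0 := by
    by_contra! h1
    refine hx' ?_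
    rw [β.pageTorsion_eq hl g r p q]
    exact (finsum_congr fun k => by rw [h1, mul_zero]).trans finsum_zero
  have h1 : (r : ℤ) < l := by
    by_contra h1
    exact hk (β.pageTerm_of_le g r _ _ (by omega))
  have h2 : ¬ (p + r * k < 0 ∨ l ≤ p + r * k) := fun h2 => hk (β.pageTerm_of_notMem g r _ _ h2)
  have h3 : ¬ (M : ℤ) ≤ |p + q + k| := fun h3 => hk (β.pageTerm_of_isEmpty g r (hM _ h3) _)
  have h4 : |p + q + k| ≤ M := by omega
  rw [abs_le] at h4
  have h5 : 0 ≤ k := by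
    by_contra h5
    have h6 : (r : ℤ) * (k + 1) ≤ r * 0 := mul_le_mul_of_nonneg_left (by omega) hr.le
    rw [mul_zero, mul_add] at h6
    omega
  have h6 : (1 : ℤ) * k ≤ r * k := mul_le_mul_of_nonneg_right (by omega) h5
  simp only [Set.mem_prod, Set.mem_Iic, Set.mem_Icc]
  refine ⟨?_, ⟨hp.1, by omega⟩, by omega, by omega⟩
  rw [← PNat.coe_le_coe, Nat.succPNat_coe]
  omega

theorem finite_ψBracket (β : F.Bars l) (hl : F.F l = ⊥) :
    {x : ℤ × ℤ | F.ψBracket g h x.1 x.2 ≠ 0}.Finite := by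
  obtain ⟨M, hM⟩ := β.exists_bound
  refine ((Set.finite_Icc (0 : ℤ) l).prod (Set.finite_Icc (-(M + l : ℤ)) M)).subset ?_
  rintro ⟨p, q⟩ hx
  have hx' : F.ψBracket g h p q ≠ 0 := hx
  have h1 : ¬ (p < 0 ∨ l ≤ p) := fun h1 => hx' (ψBracket_eq_zero l hl g h p q h1)
  have h2 : |p + q| ≤ M := by
    by_contra h2
    have h3 := hM (p + q) (by omega)
    refine hx' ((β.bracket_ψ_eq hl g h p (p + q) (by omega)).trans ?_)
    rw [β.vol_of_isEmpty g h3, β.vol_of_isEmpty g h3, β.limitVol_of_isEmpty h h3,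
      β.limitVol_of_isEmpty h h3]
    ring
  rw [abs_le] at h2
  exact ⟨⟨by omega, by omega⟩, by omega, by omega⟩

end Bars

end Filtration

end FilteredTorsion

theorem theorem4p4 (C : FilteredTorsion.RealComplex.{u}) (F : FilteredTorsion.Filtration C)
    (l : ℕ) (hl : F.F l = ⊥)
    (σ : ∀ p, FilteredTorsion.SimpleStructure (F.gr p))
    (g : ∀ p n, FilteredTorsion.HilbertStructure ((F.gr p).homology n))
    (h : ∀ n, FilteredTorsion.HilbertStructure (C.homology n)) :
    (∃! σC : FilteredTorsion.SimpleStructure C, F.IsPreferred l σ σC) ∧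
    {x : ℕ+ × ℤ × ℤ | x.2.1 ∈ Finset.Ico (0 : ℤ) x.1 ∧
      F.pageTorsion g x.1 x.2.1 x.2.2 ≠ 0}.Finite ∧
    {x : ℤ × ℤ | F.ψBracket g h x.1 x.2 ≠ 0}.Finite ∧
    ∀ σC : FilteredTorsion.SimpleStructure C, F.IsPreferred l σ σC →
      σC.torsion h = F.filteredTorsion l σ g h := by
  obtain ⟨β⟩ := FilteredTorsion.Filtration.nonempty_bars l hl σ
  obtain ⟨τ, hτ⟩ := F.exists_isPreferredAt l hl σ 0 (Int.natCast_nonneg l)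
  refine ⟨⟨τ.transport F.isoZero, ⟨τ, hτ, rfl⟩, fun σC hσC => ?_⟩, β.finite_pageTorsion g hl,
    β.finite_ψBracket g h hl, fun σC hσC => ?_⟩
  · refine FilteredTorsion.SimpleStructure.ext_of_torsion h ?_
    rw [β.torsion_eq_of_isPreferred g h hl σ hσC,
      β.torsion_eq_of_isPreferred g h hl σ ⟨τ, hτ, rfl⟩]
  · rw [β.torsion_eq_of_isPreferred g h hl σ hσC, β.filteredTorsion_eq g h hl σ]
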